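/- **Conventions.** An arithmetic circuit with $n$ input nodes and $m$ output nodes is a finite acyclic network of gates, each of which computes one of: a constant $\zeta\in\mathbb Q$, $a+b$, $a-b$, $\zeta\cdot a$ with $\zeta\in\mathbb Q$, $a\cdot b$, $\max\{a,b\}$, $\min\{a,b\}$; it represents a function $\mathbb R^n\to\mathbb R^m$. A circuit with comparison gates may also use the gate $G_>$, whose output is $1$ if its input is positive and $0$ otherwise. Constants are written in binary. "Polynomial time" means Turing machine polynomial time in the length of the written instance. A search problem $P$ assigns to every instance $I$ (a finite string) a set $\mathrm{Sol}_P(I)\subseteq\mathbb R^{d_P(I)}$ of solutions. A reduction from $P$ to $Q$ consists of a polynomial-time map $f$ from instances of $P$ to instances of $Q$ and of a polynomial-time map that constructs, from an instance $I$ of $P$, a circuit with comparison gates $g_I:\mathbb R^{d_Q(f(I))}\to\mathbb R^{d_P(I)}$ such that $g_I(y)\in\mathrm{Sol}_P(I)$ for every $y\in\mathrm{Sol}_Q(f(I))$. Borsuk–Ulam is the following search problem. Input: an arithmetic circuit (without comparison gates) that represents a function $f:\mathbb R^{d+1}\to\mathbb R^d$, for some $d \ge 0$. Task: find $x\in\mathbb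 R^{d+1}$ with $\sum_{i=1}^{d+1}|x_i|=1$ and $f(x)=f(-x)$. The class $\mathtt{BU}$ consists of all search problems that reduce to Borsuk–Ulam. An existential formula is a formula $\Phi(x)=\exists z_1\dots\exists z_k\,\psi(x,z)$ with free variables $x=(x_1,\dots,x_n)$, where $\psi$ is built by $\land,\lor,\lnot$ from comparisons ($<,\le,=,\ge,>$) of polynomial expressions with integer coefficients (built from variables and integer constants by $+,-,\cdot$). It is true if $\exists x\,\Phi(x)$ holds over $\mathbb R$. The class $\mathtt{FETR}$ consists of all search problems $P$ for which there are a reduction from $P$ to the problem "given an existential formula $\Phi$, find $x$ with $\Phi(x)$", mapping $I$ to $\Phi_I$, such that moreover, for every instance $I$, $\Phi_I$ is true if and only if $\mathrm{Sol}_P(I)\neq\emptyset$ (in particular, the decision version of $P$ lies in $\mathtt{ETR}$). The class $\mathtt{TFETR}$ consists of those $P \in \mathtt{FETR}$ for which every instance has a solution. **Theorem 3.4.** $\mathtt{BU}\subseteq\mathtt{TFETR}$. Moreover, there is a polynomial-time map that sends every instance of Borsuk–Ulam, a circuit for a function $f:\mathbb R^{d+1}\to\mathbb R^d$, to an existential formula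 $\Phi_f$ with $d+1$ free variables such that, for all $x\in\mathbb R^{d+1}$, $$\Phi_f(x)\iff \sum_{i=1}^{d+1}|x_i|=1\ \text{ and }\ f(x)=f(-x),$$ and every formula $\Phi_f$ is true, i.e. satisfied by some $x\in\mathbb R^{d+1}$. -/

import Mathlib

/-!
# Arithmetic circuits, real-valued search problems, and the existential theory of the reals

Instances are finite strings, "polynomial time" is Turing machine polynomial time
(`Turing.TM2ComputableInPolyTime`), solutions are real vectors.
-/

namespace BorsukUlamETR

/-! ## Strings -/

/-- The finite alphabet in which circuits and formulas are written. -/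
inductive Sym : Type
  | one | sep | zeroBit | oneBit | plusSign | minusSign
  | left | right
  | const | add | sub | smul | mul | max | min | pos
  | var | lt | le | eq | ge | gt | and | or | not
  deriving DecidableEq

instance : Fintype Sym where
  elems := {.one, .sep, .zeroBit, .oneBit, .plusSign, .minusSign, .left, .right, .const, .add, .sub,
    .smul, .mul, .max, .min, .pos, .var, .lt, .le, .eq, .ge, .gt, .and, .or, .not}
  complete x := by cases x <;> decide

/-- An encoding is self-delimiting if the object can be read off from any string that starts with
its encoding. -/
def SelfDelimiting {α : Type} (e : α → List Sym) : Prop :=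
  ∀ a b s t, e a ++ s = e b ++ t → a = b ∧ s = t

theorem SelfDelimiting.injective {α : Type} {e : α → List Sym} (h : SelfDelimiting e) :
    Function.Injective e :=
  fun a b hab => (h a b [] [] (by rw [hab])).1

/-- Unary notation, used for the names of nodes and variables. -/
def encUnary : ℕ → List Sym
  | 0 => [Sym.sep]
  | n + 1 => Sym.one :: encUnary n

theorem encUnary_sd : SelfDelimiting encUnary := by
  intro a
  induction a with
  | zero => intro b s t h; cases b <;> simp_all [encUnary]
  | succ a ih =>
    intro b s t h
    cases b with
    | zero => simp [encUnary] at h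
    | succ b =>
      simp only [encUnary, List.cons_append, List.cons.injEq, true_and] at h
      have := ih b s t h
      simp [this.1, this.2]

/-- Self-delimiting form of a list of bits. -/
def encBits : List Bool → List Sym
  | [] => [Sym.sep]
  | b :: l => (bif b then Sym.oneBit else Sym.zeroBit) :: encBits l

theorem encBits_sd : SelfDelimiting encBits := by
  intro a
  induction a with
  | nil =>
    intro b s t h
    cases b with
    | nil => simpa [encBits] using h
    | cons x b => cases x <;> simp [encBits] at h
  | cons y a ih =>
    intro b s t h
    cases b with
    | nil => cases y <;> simp [encBits] at h
    | cons x b =>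
      simp only [encBits, List.cons_append, List.cons.injEq] at h
      have := ih b s t h.2
      have hxy : y = x := by
        cases x <;> cases y <;> simp_all
      simp [this.1, this.2, hxy]

/-- Binary notation for natural numbers. -/
def encNat (n : ℕ) : List Sym := encBits (Computability.encodeNat n)

theorem encNat_sd : SelfDelimiting encNat := by
  intro a b s t h
  have := encBits_sd _ _ s t h
  refine ⟨?_, this.2⟩
  rw [← Computability.decode_encodeNat a, this.1, Computability.decode_encodeNat]

/-- Binary notation for integers: a sign and the absolute value. -/
def encInt (z : ℤ) : List Sym :=
  (if z < 0 then Sym.minusSign else Sym.plusSign) :: encNat z.natAbs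

theorem encInt_sd : SelfDelimiting encInt := by
  intro a b s t h
  simp only [encInt, List.cons_append, List.cons.injEq] at h
  have := encNat_sd _ _ s t h.2
  refine ⟨?_, this.2⟩
  have h1 := h.1
  have h2 := this.1
  split_ifs at h1 <;> omega

/-- Rational numbers: numerator and denominator (in lowest terms) in binary. -/
def encRat (q : ℚ) : List Sym := encInt q.num ++ encNat q.den

theorem encRat_sd : SelfDelimiting encRat := by
  intro a b s t h
  simp only [encRat, List.append_assoc] at h
  have h1 := encInt_sd _ _ _ _ h
  have h2 := encNat_sd _ _ _ _ h1.2
  exact ⟨Rat.ext h1.1 h2.1, h2.2⟩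

/-- Names from two families, numbered in unary. -/
def encName {n k : ℕ} : Fin n ⊕ Fin k → List Sym
  | Sum.inl i => Sym.left :: encUnary i
  | Sum.inr j => Sym.right :: encUnary j

theorem encName_sd {n k : ℕ} : SelfDelimiting (encName : Fin n ⊕ Fin k → List Sym) := by
  rintro (a | a) (b | b) s t h <;> simp only [encName, List.cons_append, List.cons.injEq,
    reduceCtorEq, false_and, true_and] at h
  all_goals
    have := encUnary_sd _ _ _ _ h
    exact ⟨by rw [Fin.ext this.1], this.2⟩

/-- The encodings of `a 0, …, a (k - 1)`, one after the other. -/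
def encTuple {α : Type} (e : α → List Sym) {k : ℕ} (a : Fin k → α) : List Sym :=
  (List.ofFn fun i => e (a i)).flatten

theorem encTuple_sd {α : Type} {e : α → List Sym} (he : SelfDelimiting e) (k : ℕ) :
    SelfDelimiting (encTuple e : (Fin k → α) → List Sym) := by
  induction k with
  | zero =>
    intro a b s t h
    exact ⟨Subsingleton.elim _ _, by simpa [encTuple] using h⟩
  | succ k ih =>
    intro a b s t h
    simp only [encTuple, List.ofFn_succ, List.flatten_cons, List.append_assoc] at h
    have h1 := he _ _ _ _ h
    have h2 := ih (fun i => a i.succ) (fun i => b i.succ) s t h1.2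
    refine ⟨?_, h2.2⟩
    funext i
    refine Fin.cases h1.1 (fun j => ?_) i
    exact congrFun h2.1 j

/-! ## Arithmetic circuits -/

/-- The gates, with input nodes in `V` (each gate is attached to its output node, which is not
recorded here): `const ζ`, `+`, `-`, multiplication by a rational constant `ζ`, `*`, `max`, `min`,
and the comparison gate `pos`, which outputs `1` if its input is positive and `0` otherwise. -/
inductive Gate (V : Type) : Type
  | const (ζ : ℚ)
  | add (a b : V)
  | sub (a b : V)
  | smul (ζ : ℚ) (a : V)
  | mul (a b : V)
  | max (a b : V)
  | min (a b : V)
  | pos (a : V)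

namespace Gate

variable {V : Type}

/-- The nodes that a gate reads. -/
def operands : Gate V → List V
  | const _ => []
  | add a b => [a, b]
  | sub a b => [a, b]
  | smul _ a => [a]
  | mul a b => [a, b]
  | max a b => [a, b]
  | min a b => [a, b]
  | pos a => [a]

/-- The value at the output node of a gate, from the values `v` at all nodes. -/
noncomputable def eval (v : V → ℝ) : Gate V → ℝ
  | const ζ => (ζ : ℝ)
  | add a b => v a + v b
  | sub a b => v a - v b
  | smul ζ a => v a * (ζ : ℝ)
  | mul a b => v a * v b
  | max a b => Max.max (v a) (v b)
  | min a b => Min.min (v a) (v b)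
  | pos a => if 0 < v a then 1 else 0

/-- All gates except the comparison gate. -/
def IsArithmetic : Gate V → Prop
  | pos _ => False
  | _ => True

theorem eval_congr {v w : V → ℝ} (g : Gate V) (h : ∀ a ∈ g.operands, v a = w a) :
    g.eval v = g.eval w := by
  cases g <;> simp_all [operands, eval]

/-- A gate as a string. -/
def enc (e : V → List Sym) : Gate V → List Sym
  | const ζ => Sym.const :: encRat ζ
  | add a b => Sym.add :: (e a ++ e b)
  | sub a b => Sym.sub :: (e a ++ e b)
  | smul ζ a => Sym.smul :: (encRat ζ ++ e a)
  | mul a b => Sym.mul :: (e a ++ e b)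
  | max a b => Sym.max :: (e a ++ e b)
  | min a b => Sym.min :: (e a ++ e b)
  | pos a => Sym.pos :: e a

theorem enc_sd {e : V → List Sym} (he : SelfDelimiting e) : SelfDelimiting (enc e) := by
  intro a b s t h
  have two : ∀ x y x' y' : V, e x ++ (e y ++ s) = e x' ++ (e y' ++ t) →
      x = x' ∧ y = y' ∧ s = t := by
    intro x y x' y' h
    have h1 := he _ _ _ _ h
    have h2 := he _ _ _ _ h1.2
    exact ⟨h1.1, h2.1, h2.2⟩
  cases a <;> cases b <;>
    simp only [enc, List.cons_append, List.append_assoc, List.cons.injEq, reduceCtorEq, false_and,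
      true_and] at h
  case const.const => have := encRat_sd _ _ _ _ h; simp [this.1, this.2]
  case smul.smul =>
    have h1 := encRat_sd _ _ _ _ h
    have h2 := he _ _ _ _ h1.2
    simp [h1.1, h2.1, h2.2]
  case pos.pos => have := he _ _ _ _ h; simp [this.1, this.2]
  all_goals
    have := two _ _ _ _ h
    simp [this.1, this.2.1, this.2.2]

end Gate

/-- An arithmetic circuit with `n` input nodes and `m` output nodes. The nodes are the input nodes
(`Sum.inl`) and one node for each of the `size` gates (`Sum.inr`), the output of that gate. The
gates come in any order; following gates from output to input never leads into a cycle. -/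
structure Circuit (n m : ℕ) : Type where
  size : ℕ
  gate : Fin size → Gate (Fin n ⊕ Fin size)
  out : Fin m → Fin n ⊕ Fin size
  acyclic : ∀ j, ¬ Relation.TransGen
    (fun i j : Fin size => (Sum.inr i : Fin n ⊕ Fin size) ∈ (gate j).operands) j j

namespace Circuit

variable {n m : ℕ}

/-- Values at all nodes that satisfy the constraints of all gates and agree with `x` at the
input nodes. -/
def IsValuation (c : Circuit n m) (x : Fin n → ℝ) (v : Fin n ⊕ Fin c.size → ℝ) : Prop :=
  (∀ i, v (Sum.inl i) = x i) ∧ ∀ j, v (Sum.inr j) = (c.gate j).eval v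

theorem wellFounded (c : Circuit n m) : WellFounded
    (fun i j : Fin c.size => (Sum.inr i : Fin n ⊕ Fin c.size) ∈ (c.gate j).operands) := by
  have : Std.Irrefl (Relation.TransGen
    (fun i j : Fin c.size => (Sum.inr i : Fin n ⊕ Fin c.size) ∈ (c.gate j).operands)) :=
    ⟨c.acyclic⟩
  exact Subrelation.wf (fun h => Relation.TransGen.single h)
    (Finite.wellFounded_of_trans_of_irrefl (Relation.TransGen
    (fun i j : Fin c.size => (Sum.inr i : Fin n ⊕ Fin c.size) ∈ (c.gate j).operands)))

theorem existsUnique_isValuation (c : Circuit n m) (x : Fin n → ℝ) :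
    ∃! v, c.IsValuation x v := by
  classical
  let F : ∀ j : Fin c.size, (∀ i, (Sum.inr i : Fin n ⊕ Fin c.size) ∈ (c.gate j).operands → ℝ) → ℝ :=
    fun j rec => (c.gate j).eval (Sum.elim x fun i =>
      if h : (Sum.inr i : Fin n ⊕ Fin c.size) ∈ (c.gate j).operands then rec i h else 0)
  refine ⟨Sum.elim x (c.wellFounded.fix F), ⟨fun i => rfl, fun j => ?_⟩, ?_⟩
  · simp only [Sum.elim_inr]
    rw [WellFounded.fix_eq]
    refine Gate.eval_congr _ fun a ha => ?_
    rcases a with a | a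
    · rfl
    · simp [ha]
  · rintro w ⟨hw1, hw2⟩
    funext a
    rcases a with i | j
    · exact hw1 i
    · induction j using c.wellFounded.induction with
      | _ j ih =>
        rw [hw2 j, Sum.elim_inr, WellFounded.fix_eq]
        refine Gate.eval_congr _ fun a ha => ?_
        rcases a with a | a
        · exact hw1 a
        · simpa [ha] using ih a ha

/-- The values that the circuit computes at its nodes on the input `x`. -/
noncomputable def value (c : Circuit n m) (x : Fin n → ℝ) : Fin n ⊕ Fin c.size → ℝ :=
  (c.existsUnique_isValuation x).choose

/-- The function `ℝⁿ → ℝᵐ` that the circuit represents. -/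
noncomputable def eval (c : Circuit n m) (x : Fin n → ℝ) : Fin m → ℝ :=
  fun i => c.value x (c.out i)

/-- The circuit has no comparison gate. -/
def IsArithmetic (c : Circuit n m) : Prop := ∀ j, (c.gate j).IsArithmetic

/-- A circuit as a string: the numbers of inputs, gates and outputs, the gates, the outputs. -/
def enc (c : Σ n m : ℕ, Circuit n m) : List Sym :=
  encUnary c.1 ++ (encUnary c.2.2.size ++ (encUnary c.2.1 ++
    (encTuple (Gate.enc encName) c.2.2.gate ++ encTuple encName c.2.2.out)))

theorem enc_injective : Function.Injective enc := by
  rintro ⟨n, m, ⟨k, G, O, hc⟩⟩ ⟨n', m', ⟨k', G', O', hc'⟩⟩ h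
  simp only [enc] at h
  obtain ⟨rfl, h⟩ := encUnary_sd _ _ _ _ h
  obtain ⟨rfl, h⟩ := encUnary_sd _ _ _ _ h
  obtain ⟨rfl, h⟩ := encUnary_sd _ _ _ _ h
  obtain ⟨rfl, hO⟩ := encTuple_sd (Gate.enc_sd encName_sd) _ _ _ _ _ h
  obtain rfl := (encTuple_sd encName_sd _).injective hO
  rfl

end Circuit

/-! ## The existential theory of the reals -/

/-- Polynomial expressions with integer coefficients in the variables `V`. -/
inductive Term (V : Type) : Type
  | var (a : V)
  | const (z : ℤ)
  | add (s t : Term V)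
  | sub (s t : Term V)
  | mul (s t : Term V)

namespace Term

variable {V : Type}

noncomputable def eval (v : V → ℝ) : Term V → ℝ
  | var a => v a
  | const z => (z : ℝ)
  | add s t => s.eval v + t.eval v
  | sub s t => s.eval v - t.eval v
  | mul s t => s.eval v * t.eval v

def enc (e : V → List Sym) : Term V → List Sym
  | var a => Sym.var :: e a
  | const z => Sym.const :: encInt z
  | add s t => Sym.add :: (s.enc e ++ t.enc e)
  | sub s t => Sym.sub :: (s.enc e ++ t.enc e)
  | mul s t => Sym.mul :: (s.enc e ++ t.enc e)

theorem enc_sd {e : V → List Sym} (he : SelfDelimiting e) : SelfDelimiting (enc e) := by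
  intro a
  induction a with
  | var a =>
    intro b s t h
    cases b <;> simp only [enc, List.cons_append, List.append_assoc, List.cons.injEq,
      reduceCtorEq, false_and, true_and] at h
    have := he _ _ _ _ h
    simp [this.1, this.2]
  | const z =>
    intro b s t h
    cases b <;> simp only [enc, List.cons_append, List.append_assoc, List.cons.injEq,
      reduceCtorEq, false_and, true_and] at h
    have := encInt_sd _ _ _ _ h
    simp [this.1, this.2]
  | add p q hp hq | sub p q hp hq | mul p q hp hq =>
    intro b s t h
    cases b <;> simp only [enc, List.cons_append, List.append_assoc, List.cons.injEq,
      reduceCtorEq, false_and, true_and] at h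
    have h1 := hp _ _ _ h
    have h2 := hq _ _ _ h1.2
    simp [h1.1, h2.1, h2.2]

end Term

/-- Quantifier-free formulas: polynomials compared by `<, ≤, =, ≥, >`, and `∧, ∨, ¬`. -/
inductive QF (V : Type) : Type
  | lt (s t : Term V)
  | le (s t : Term V)
  | eq (s t : Term V)
  | ge (s t : Term V)
  | gt (s t : Term V)
  | and (p q : QF V)
  | or (p q : QF V)
  | not (p : QF V)

namespace QF

variable {V : Type}

def Holds (v : V → ℝ) : QF V → Prop
  | lt s t => s.eval v < t.eval v
  | le s t => s.eval v ≤ t.eval v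
  | eq s t => s.eval v = t.eval v
  | ge s t => s.eval v ≥ t.eval v
  | gt s t => s.eval v > t.eval v
  | and p q => p.Holds v ∧ q.Holds v
  | or p q => p.Holds v ∨ q.Holds v
  | not p => ¬ p.Holds v

def enc (e : V → List Sym) : QF V → List Sym
  | lt s t => Sym.lt :: (s.enc e ++ t.enc e)
  | le s t => Sym.le :: (s.enc e ++ t.enc e)
  | eq s t => Sym.eq :: (s.enc e ++ t.enc e)
  | ge s t => Sym.ge :: (s.enc e ++ t.enc e)
  | gt s t => Sym.gt :: (s.enc e ++ t.enc e)
  | and p q => Sym.and :: (p.enc e ++ q.enc e)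
  | or p q => Sym.or :: (p.enc e ++ q.enc e)
  | not p => Sym.not :: p.enc e

theorem enc_sd {e : V → List Sym} (he : SelfDelimiting e) : SelfDelimiting (enc e) := by
  intro a
  induction a with
  | lt p q | le p q | eq p q | ge p q | gt p q =>
    intro b s t h
    cases b <;> simp only [enc, List.cons_append, List.append_assoc, List.cons.injEq,
      reduceCtorEq, false_and, true_and] at h
    have h1 := Term.enc_sd he _ _ _ _ h
    have h2 := Term.enc_sd he _ _ _ _ h1.2
    simp [h1.1, h2.1, h2.2]
  | and p q hp hq | or p q hp hq =>
    intro b s t h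
    cases b <;> simp only [enc, List.cons_append, List.append_assoc, List.cons.injEq,
      reduceCtorEq, false_and, true_and] at h
    have h1 := hp _ _ _ h
    have h2 := hq _ _ _ h1.2
    simp [h1.1, h2.1, h2.2]
  | not p hp =>
    intro b s t h
    cases b <;> simp only [enc, List.cons_append, List.append_assoc, List.cons.injEq,
      reduceCtorEq, false_and, true_and] at h
    have h1 := hp _ _ _ h
    simp [h1.1, h1.2]

end QF

/-- An existential formula `∃ z₁ … z_bound, body (x₁, …, xₙ, z₁, …, z_bound)` with free variables
`x₁, …, xₙ` (`Sum.inl`). -/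
structure ExFormula (n : ℕ) : Type where
  bound : ℕ
  body : QF (Fin n ⊕ Fin bound)

namespace ExFormula

/-- The formula is satisfied by the real numbers `x₁, …, xₙ`. -/
def Holds {n : ℕ} (φ : ExFormula n) (x : Fin n → ℝ) : Prop :=
  ∃ z : Fin φ.bound → ℝ, φ.body.Holds (Sum.elim x z)

/-- The existential closure of the formula is true, that is, belongs to the existential theory of
the reals. -/
def IsTrue {n : ℕ} (φ : ExFormula n) : Prop := ∃ x, φ.Holds x

/-- A formula as a string. -/
def enc (φ : Σ n : ℕ, ExFormula n) : List Sym :=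
  encUnary φ.1 ++ (encUnary φ.2.bound ++ φ.2.body.enc encName)

theorem enc_injective : Function.Injective enc := by
  rintro ⟨n, ⟨k, b⟩⟩ ⟨n', ⟨k', b'⟩⟩ h
  simp only [enc] at h
  obtain ⟨rfl, h⟩ := encUnary_sd _ _ _ _ h
  obtain ⟨rfl, h⟩ := encUnary_sd _ _ _ _ h
  obtain rfl := (QF.enc_sd encName_sd).injective h
  rfl

end ExFormula

/-! ## Search problems and reductions -/

/-- A search problem with real-valued solutions: instances, written as strings over a finite
alphabet, and for each instance `I` the set of its solutions, vectors of `dim I` real numbers. -/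
structure SearchProblem : Type 1 where
  Inst : Type
  Alphabet : Type
  finite_alphabet : Finite Alphabet
  enc : Inst → List Alphabet
  enc_injective : Function.Injective enc
  dim : Inst → ℕ
  Sol : (I : Inst) → Set (Fin (dim I) → ℝ)

/-- The decision version of a search problem: does the instance have a solution? -/
def SearchProblem.Solvable (P : SearchProblem) (I : P.Inst) : Prop := (P.Sol I).Nonempty

/-- `f` is computed by a Turing machine in time polynomial in the length of the input string. -/
def PolyTime {α β Γ Δ : Type} (ea : α → List Γ) (eb : β → List Δ) (f : α → β) : Prop :=
  Nonempty (Turing.TM2ComputableInPolyTime ea eb f)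

/-- Polynomial-time reductions between search problems with real-valued solutions: `f` maps
instances of `P` to instances of `Q`, and `g I` maps the solutions of `f I` to solutions of `I`.
Here `g I` is an arithmetic circuit, which may use comparison gates, and the circuit is
constructed from `I` in polynomial time (so it has polynomial size). -/
def IsReduction (P Q : SearchProblem) (f : P.Inst → Q.Inst)
    (g : (I : P.Inst) → Circuit (Q.dim (f I)) (P.dim I)) : Prop :=
  PolyTime P.enc Q.enc f ∧
  PolyTime P.enc Circuit.enc (fun I => ⟨Q.dim (f I), P.dim I, g I⟩) ∧
  ∀ I, ∀ y ∈ Q.Sol (f I), (g I).eval y ∈ P.Sol I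

/-- The problem Borsuk-Ulam. Input: an arithmetic circuit (without comparison gates) for a function
`f : ℝ^(d+1) → ℝ^d`. Task: find `x` on the unit sphere of the `L₁` norm with `f x = f (-x)`. -/
noncomputable def borsukUlam : SearchProblem where
  Inst := Σ d : ℕ, {c : Circuit (d + 1) d // c.IsArithmetic}
  Alphabet := Sym
  finite_alphabet := inferInstance
  enc I := Circuit.enc ⟨I.1 + 1, I.1, I.2.1⟩
  enc_injective := by
    rintro ⟨d, c, hc⟩ ⟨d', c', hc'⟩ h
    have := Circuit.enc_injective h
    simp only [Sigma.mk.injEq, Nat.add_right_cancel_iff] at this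
    obtain ⟨rfl, h⟩ := this
    simpa using h
  dim I := I.1 + 1
  Sol I := {x | ∑ i, |x i| = 1 ∧ I.2.1.eval x = I.2.1.eval (-x)}

/-- The problem of solving an existential formula: given the formula, find real values of its free
variables that satisfy it. Its decision version is the existential theory of the reals. -/
noncomputable def solveETR : SearchProblem where
  Inst := Σ n : ℕ, ExFormula n
  Alphabet := Sym
  finite_alphabet := inferInstance
  enc := ExFormula.enc
  enc_injective := ExFormula.enc_injective
  dim φ := φ.1
  Sol φ := {x | φ.2.Holds x}

/-! ## The classes -/

/-- `BU`: the search problems that reduce to Borsuk-Ulam in polynomial time. -/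
def BU : Set SearchProblem := {P | ∃ f g, IsReduction P borsukUlam f g}

/-- `FETR`: a polynomial-time map `Φ` sends every instance `I` to an existential formula that is
true if and only if `I` has a solution (so that the decision version lies in `ETR`). As the problem
is to find a solution and not only to decide whether there is one, the values that satisfy `Φ I`
have to give solutions of `I` as in a reduction. -/
def FETR : Set SearchProblem :=
  {P | ∃ Φ g, IsReduction P solveETR Φ g ∧ ∀ I, P.Solvable I ↔ (Φ I).2.IsTrue}

/-- `TFETR`: the problems in `FETR` whose decision version always has the answer "yes". -/
def TFETR : Set SearchProblem := {P | P ∈ FETR ∧ ∀ I, P.Solvable I}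

end BorsukUlamETR

/-!
The Borsuk-Ulam theorem is reduced to odd polynomials `F₁, …, F_d` by approximation and
compactness. For odd `D` larger than all degrees, the perturbed system `x₀ ^ (2 D) = t (1 - ∑ xᵢ²)`,
`xᵢ ^ D = - t Fᵢ` has zeros that approach common zeros of the `Fᵢ` on the unit sphere as `t → ∞`.
The even polynomials modulo this system form an algebra of dimension `D ^ (d + 1)`. This is odd, so
the algebra has a real-valued homomorphism, and as some `x_k ^ 2` has a positive value this
homomorphism is the evaluation at a real point.

The formula of a circuit says that there is a table, with one row for each node, that holds the
values at `x` and at `-x`, the absolute values of the inputs and their partial sums. It is a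
conjunction of finitely many templates instantiated by row numbers, so a stack machine with two
counters can write it while it reads the circuit once.
-/

namespace BorsukUlamETR

/-! ### Real points of odd-dimensional algebras -/

section OddDimension

theorem even_finrank_of_isFiniteLength {K A : Type*} [Field K] [CommRing A] [Algebra K A]
    (hA : ∀ m : Ideal A, m.IsMaximal → Even (Module.finrank K (A ⧸ m)))
    {M : Type*} [AddCommGroup M] [Module A M] (hM : IsFiniteLength A M) :
    ∀ [Module K M] [IsScalarTower K A M] [Module.Finite K M], Even (Module.finrank K M) := by
  induction hM with
  | of_subsingleton =>
    intros
    rw [Module.finrank_zero_of_subsingleton]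
    exact Even.zero
  | @of_simple_quotient M _ _ N _ _ ih =>
    intros
    obtain ⟨m, hm, ⟨e⟩⟩ := isSimpleModule_iff_quot_maximal.1 ‹IsSimpleModule A (M ⧸ N)›
    have hquot : Module.finrank K (M ⧸ N.restrictScalars K) = Module.finrank K (A ⧸ m) :=
      ((Submodule.Quotient.restrictScalarsEquiv K N).trans (e.restrictScalars K)).finrank_eq
    have : Module.Finite K N := inferInstanceAs (Module.Finite K (N.restrictScalars K))
    rw [← (N.restrictScalars K).finrank_quotient_add_finrank, hquot]
    exact (hA m hm).add ih

theorem exists_algHom_real_of_odd_finrank {A : Type*} [CommRing A] [Algebra ℝ A]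
    (hA : Odd (Module.finrank ℝ A)) : Nonempty (A →ₐ[ℝ] ℝ) := by
  by_contra hne
  have : Module.Finite ℝ A := Module.finite_of_finrank_pos hA.pos
  have hlength : IsFiniteLength A A := isFiniteLength_iff_isNoetherian_isArtinian.2
    ⟨isNoetherian_of_tower ℝ inferInstance, isArtinian_of_tower ℝ inferInstance⟩
  refine Nat.not_even_iff_odd.2 hA (even_finrank_of_isFiniteLength (fun m hm => ?_) hlength)
  let _ : Field (A ⧸ m) := Ideal.Quotient.field m
  have : Module.Finite ℝ (A ⧸ m) :=
    Module.Finite.of_surjective (Ideal.Quotient.mkₐ ℝ m).toLinearMap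
      (Ideal.Quotient.mkₐ_surjective ℝ m)
  have : Algebra.IsAlgebraic ℝ (A ⧸ m) := Algebra.IsAlgebraic.of_finite ℝ (A ⧸ m)
  rcases Real.nonempty_algEquiv_or (A ⧸ m) with ⟨⟨e⟩⟩ | ⟨⟨e⟩⟩
  · exact (hne ⟨(e : (A ⧸ m) →ₐ[ℝ] ℝ).comp (Ideal.Quotient.mkₐ ℝ m)⟩).elim
  · rw [e.toLinearEquiv.finrank_eq, Complex.finrank_real_complex]
    exact even_two

end OddDimension

/-! ### Polynomial systems whose leading forms are pure powers -/

section LeadingForm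

open MvPolynomial

variable {ι R : Type*} [CommRing R]

/-- Polynomials of total degree less than `n`. Unlike a bound `totalDegree p < n`, membership in
`degLT ι R 0` forces `p = 0`. -/
noncomputable def degLT (ι R : Type*) [CommRing R] (n : ℕ) : Submodule R (MvPolynomial ι R) :=
  restrictSupport R {c | c.degree < n}

theorem degLT_mono {m n : ℕ} (h : m ≤ n) : degLT ι R m ≤ degLT ι R n :=
  restrictSupport_mono R fun _ hc => lt_of_lt_of_le hc h

theorem monomial_mem_degLT {n : ℕ} {c : ι →₀ ℕ} (h : c.degree < n) (a : R) :
    monomial c a ∈ degLT ι R n :=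
  (monomial_mem_restrictSupport R).2 (Or.inl h)

theorem exists_mem_degLT (p : MvPolynomial ι R) : ∃ n, p ∈ degLT ι R n :=
  ⟨p.support.sup (fun c => c.degree) + 1, (mem_restrictSupport_iff R).2 fun _ hc =>
    Nat.lt_succ_iff.2 (Finset.le_sup (f := fun c : ι →₀ ℕ => c.degree) hc)⟩

theorem mem_degLT_zero {p : MvPolynomial ι R} : p ∈ degLT ι R 0 ↔ p = 0 := by
  simp [degLT, restrictSupport_eq_span]

theorem mul_mem_degLT {m n : ℕ} {p q : MvPolynomial ι R} (hp : p ∈ degLT ι R m)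
    (hq : q ∈ degLT ι R (n + 1)) : p * q ∈ degLT ι R (m + n) := by
  have hpq := Submodule.mul_mem_mul hp hq
  rw [degLT, degLT, ← restrictSupport_add] at hpq
  refine restrictSupport_mono R ?_ hpq
  rintro _ ⟨a, ha, b, hb, rfl⟩
  simp only [Set.mem_ofPred_eq, map_add] at *
  omega

/-- The leading form of `p`, that is, its homogeneous part of highest degree, is the monomial
`x ^ c`. -/
def HasLeadingMonomial (p : MvPolynomial ι R) (c : ι →₀ ℕ) : Prop :=
  p - monomial c 1 ∈ degLT ι R c.degree

namespace HasLeadingMonomial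

theorem monomial (c : ι →₀ ℕ) : HasLeadingMonomial (monomial c (1 : R)) c := by
  simp [HasLeadingMonomial]

theorem X_pow_add (i : ι) (n : ℕ) {p : MvPolynomial ι R} (hp : p ∈ degLT ι R n) :
    HasLeadingMonomial (X i ^ n + p) (Finsupp.single i n) := by
  rw [HasLeadingMonomial, X_pow_eq_monomial, add_sub_cancel_left, Finsupp.degree_single]
  exact hp

theorem mem_degLT {p : MvPolynomial ι R} {c : ι →₀ ℕ} (h : HasLeadingMonomial p c) :
    p ∈ degLT ι R (c.degree + 1) := by
  simpa using add_mem (degLT_mono (Nat.le_succ _) h)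
    (monomial_mem_degLT (Nat.lt_succ_self c.degree) (1 : R))

theorem mul {p q : MvPolynomial ι R} {a b : ι →₀ ℕ} (hp : HasLeadingMonomial p a)
    (hq : HasLeadingMonomial q b) : HasLeadingMonomial (p * q) (a + b) := by
  have hleft := mul_mem_degLT hp hq.mem_degLT
  have hright := mul_mem_degLT hq (HasLeadingMonomial.monomial (R := R) a).mem_degLT
  rw [add_comm] at hright
  have hmonomial : MvPolynomial.monomial (a + b) (1 : R) =
      MvPolynomial.monomial a 1 * MvPolynomial.monomial b 1 := by
    simp [monomial_mul]
  rw [HasLeadingMonomial, hmonomial, map_add]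
  convert add_mem hleft hright using 1
  ring

theorem pow {p : MvPolynomial ι R} {a : ι →₀ ℕ} (hp : HasLeadingMonomial p a) (n : ℕ) :
    HasLeadingMonomial (p ^ n) (n • a) := by
  induction n with
  | zero => simpa using HasLeadingMonomial.monomial (R := R) (0 : ι →₀ ℕ)
  | succ n ih => rw [pow_succ, succ_nsmul]; exact ih.mul hp

theorem prod {κ : Type*} (s : Finset κ) {p : κ → MvPolynomial ι R} {a : κ → ι →₀ ℕ}
    (hp : ∀ k ∈ s, HasLeadingMonomial (p k) (a k)) :
    HasLeadingMonomial (∏ k ∈ s, p k) (∑ k ∈ s, a k) := by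
  classical
  induction s using Finset.induction_on with
  | empty => simpa using HasLeadingMonomial.monomial (R := R) (0 : ι →₀ ℕ)
  | insert k s hk ih =>
    rw [Finset.prod_insert hk, Finset.sum_insert hk]
    exact (hp k (Finset.mem_insert_self k s)).mul
      (ih fun j hj => hp j (Finset.mem_insert_of_mem hj))

end HasLeadingMonomial

section Unitriangular

variable {T : MvPolynomial ι R →ₗ[R] MvPolynomial ι R}

theorem sub_mem_degLT_of_hasLeadingMonomial (hT : ∀ c, HasLeadingMonomial (T (monomial c 1)) c)
    {n : ℕ} {p : MvPolynomial ι R} (hp : p ∈ degLT ι R (n + 1)) : T p - p ∈ degLT ι R n := by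
  have hle : degLT ι R (n + 1) ≤ (degLT ι R n).comap (T - LinearMap.id) := by
    rw [degLT, restrictSupport_eq_span, Submodule.span_le]
    rintro _ ⟨c, hc, rfl⟩
    exact degLT_mono (Nat.lt_succ_iff.1 hc) (hT c)
  exact hle hp

theorem bijective_of_hasLeadingMonomial (hT : ∀ c, HasLeadingMonomial (T (monomial c 1)) c) :
    Function.Bijective T := by
  constructor
  · refine LinearMap.ker_eq_bot.1 (LinearMap.ker_eq_bot'.2 fun p hp => ?_)
    obtain ⟨n, hn⟩ := exists_mem_degLT p
    induction n with
    | zero => exact mem_degLT_zero.1 hn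
    | succ n ih =>
      have hsub := sub_mem_degLT_of_hasLeadingMonomial hT hn
      rw [hp, zero_sub, neg_mem_iff] at hsub
      exact ih hsub
  · have hrange : ∀ n, degLT ι R n ≤ LinearMap.range T := by
      intro n
      induction n with
      | zero => exact fun p hp => mem_degLT_zero.1 hp ▸ zero_mem _
      | succ n ih =>
        intro p hp
        simpa using sub_mem (LinearMap.mem_range_self T p)
          (ih (sub_mem_degLT_of_hasLeadingMonomial hT hp))
    exact fun p => (exists_mem_degLT p).elim fun n hn => hrange n hn

end Unitriangular

section SubstPow

variable [Fintype ι] {e : ι → ℕ} {G : ι → MvPolynomial ι R}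

/-- The exponents of `c`, each reduced modulo the corresponding entry of `e`. -/
noncomputable def expMod (e : ι → ℕ) (c : ι →₀ ℕ) : ι →₀ ℕ :=
  Finsupp.equivFunOnFinite.symm fun i => c i % e i

/-- The linear map that replaces in each monomial the power `x i ^ e i` by `G i`, as often as
possible. It turns the monomials `x ^ c` with `c i < e i` into a basis modulo the `G i`. -/
noncomputable def substPow (e : ι → ℕ) (G : ι → MvPolynomial ι R) :
    MvPolynomial ι R →ₗ[R] MvPolynomial ι R :=
  (basisMonomials ι R).constr R fun c => monomial (expMod e c) 1 * ∏ i, G i ^ (c i / e i)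

theorem substPow_monomial (e : ι → ℕ) (G : ι → MvPolynomial ι R) (c : ι →₀ ℕ) :
    substPow e G (monomial c 1) = monomial (expMod e c) 1 * ∏ i, G i ^ (c i / e i) := by
  rw [← congrFun (coe_basisMonomials ι R) c, substPow, Module.Basis.constr_basis]

theorem expMod_add_sum (e : ι → ℕ) (c : ι →₀ ℕ) :
    expMod e c + ∑ i, (c i / e i) • Finsupp.single i (e i) = c := by
  classical
  ext j
  simp [expMod, Finsupp.single_apply, Nat.mod_add_div']

theorem substPow_hasLeadingMonomial (hG : ∀ i, HasLeadingMonomial (G i) (Finsupp.single i (e i)))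
    (c : ι →₀ ℕ) : HasLeadingMonomial (substPow e G (monomial c 1)) c := by
  have hprod := (HasLeadingMonomial.monomial (R := R) (expMod e c)).mul
    (HasLeadingMonomial.prod Finset.univ fun i _ => (hG i).pow (c i / e i))
  rwa [← substPow_monomial, expMod_add_sum] at hprod

theorem substPow_bijective (hG : ∀ i, HasLeadingMonomial (G i) (Finsupp.single i (e i))) :
    Function.Bijective (substPow e G) :=
  bijective_of_hasLeadingMonomial (substPow_hasLeadingMonomial hG)

theorem mul_substPow_monomial (he : ∀ i, 0 < e i) (i : ι) (c : ι →₀ ℕ) :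
    G i * substPow e G (monomial c 1) = substPow e G (monomial (c + Finsupp.single i (e i)) 1) := by
  classical
  have hmod : expMod e (c + Finsupp.single i (e i)) = expMod e c := by
    ext j
    rcases eq_or_ne i j with rfl | h <;> simp [expMod, *]
  have hdiv (j : ι) :
      (c + Finsupp.single i (e i)) j / e j = c j / e j + if j = i then 1 else 0 := by
    split_ifs with h
    · subst h; simp [Nat.add_div_right _ (he j)]
    · simp [Ne.symm h]
  simp only [substPow_monomial, hmod, hdiv, pow_add, Finset.prod_mul_distrib, pow_ite, pow_one,
    pow_zero, Finset.prod_ite_eq', Finset.mem_univ, if_true]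
  ring

theorem mul_substPow_mem_map (he : ∀ i, 0 < e i) (i : ι) (p : MvPolynomial ι R) :
    G i * substPow e G p ∈
      (restrictSupport R {c : ι →₀ ℕ | ∃ i, e i ≤ c i}).map (substPow e G) := by
  suffices hle : (⊤ : Submodule R (MvPolynomial ι R)) ≤
      ((restrictSupport R {c : ι →₀ ℕ | ∃ i, e i ≤ c i}).map (substPow e G)).comap
        (LinearMap.mulLeft R (G i) ∘ₗ substPow e G) from
    hle (Submodule.mem_top : p ∈ (⊤ : Submodule R (MvPolynomial ι R)))
  rw [← (basisMonomials ι R).span_eq, Submodule.span_le]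
  rintro _ ⟨c, rfl⟩
  rw [coe_basisMonomials, SetLike.mem_coe, Submodule.mem_comap, LinearMap.comp_apply,
    LinearMap.mulLeft_apply, mul_substPow_monomial he]
  exact ⟨_, (monomial_mem_restrictSupport R).2 (Or.inl ⟨i, by simp⟩), rfl⟩

theorem substPow_monomial_mem_span {c : ι →₀ ℕ} {i : ι} (he : 0 < e i) (hi : e i ≤ c i) :
    substPow e G (monomial c 1) ∈ Ideal.span (Set.range G) := by
  rw [substPow_monomial]
  refine Ideal.mul_mem_left _ _
    (Ideal.mem_of_dvd _ (Finset.dvd_prod_of_mem _ (Finset.mem_univ i)) ?_)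
  exact Ideal.pow_mem_of_mem _ (Ideal.subset_span (Set.mem_range_self i)) _ (Nat.div_pos hi he)

theorem span_eq_map_substPow (he : ∀ i, 0 < e i)
    (hG : ∀ i, HasLeadingMonomial (G i) (Finsupp.single i (e i))) :
    (Ideal.span (Set.range G)).restrictScalars R =
      (restrictSupport R {c : ι →₀ ℕ | ∃ i, e i ≤ c i}).map (substPow e G) := by
  refine le_antisymm (fun p hp => ?_) (Submodule.map_le_iff_le_comap.2 ?_)
  · obtain ⟨r, rfl⟩ := Ideal.mem_span_range_iff_exists_fun.1 hp
    refine Submodule.sum_mem _ fun i _ => ?_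
    obtain ⟨q, hq⟩ := (substPow_bijective hG).2 (r i)
    rw [← hq, mul_comm]
    exact mul_substPow_mem_map he i q
  · rw [restrictSupport_eq_span, Submodule.span_le]
    rintro _ ⟨c, ⟨i, hi⟩, rfl⟩
    exact substPow_monomial_mem_span (he i) hi

theorem substPow_mem_span_iff (he : ∀ i, 0 < e i)
    (hG : ∀ i, HasLeadingMonomial (G i) (Finsupp.single i (e i))) (p : MvPolynomial ι R) :
    substPow e G p ∈ Ideal.span (Set.range G) ↔ ∀ c : ι →₀ ℕ, (∀ i, c i < e i) → coeff c p = 0 := by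
  rw [← Submodule.restrictScalars_mem R, span_eq_map_substPow he hG,
    ← SetLike.mem_coe, Submodule.map_coe, (substPow_bijective hG).1.mem_set_image,
    SetLike.mem_coe, mem_restrictSupport_iff]
  refine forall_congr' fun c => ?_
  rw [SetLike.mem_coe, mem_support_iff, Set.mem_ofPred_eq, ← not_imp_not, not_not]
  push Not
  rfl

end SubstPow

end LeadingForm

/-! ### Even polynomials -/

section Parity

open MvPolynomial

variable {ι R : Type*} [CommRing R]

/-- The substitution `x ↦ -x`. -/
noncomputable def negVars (ι R : Type*) [CommRing R] : MvPolynomial ι R →ₐ[R] MvPolynomial ι R :=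
  aeval fun i => -X i

theorem negVars_X (i : ι) : negVars ι R (X i) = -X i :=
  aeval_X _ i

theorem negVars_monomial (c : ι →₀ ℕ) (a : R) :
    negVars ι R (monomial c a) = monomial c ((-1) ^ c.degree * a) := by
  have hpow (i : ι) (k : ℕ) : (-X i : MvPolynomial ι R) ^ k = C (-1) ^ k * X i ^ k := by
    rw [neg_pow, C_neg, C_1]
  rw [negVars, aeval_monomial, algebraMap_eq, monomial_eq, C_mul, C_pow]
  simp only [Finsupp.prod, hpow, Finset.prod_mul_distrib, Finset.prod_pow_eq_pow_sum,
    Finsupp.degree_apply]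
  ring

theorem coeff_negVars (p : MvPolynomial ι R) (c : ι →₀ ℕ) :
    coeff c (negVars ι R p) = (-1) ^ c.degree * coeff c p := by
  classical
  induction p using MvPolynomial.induction_on' with
  | monomial u a =>
    rw [negVars_monomial, coeff_monomial, coeff_monomial]
    split_ifs with h <;> simp [h]
  | add p q hp hq => rw [map_add, coeff_add, coeff_add, hp, hq, mul_add]

theorem eval_negVars (p : MvPolynomial ι R) (x : ι → R) :
    eval x (negVars ι R p) = eval (-x) p := by
  have hcomp : (aeval x : MvPolynomial ι R →ₐ[R] R).comp (negVars ι R) = aeval (-x) := by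
    ext i
    simp [negVars]
  simpa using DFunLike.congr_fun hcomp p

/-- Polynomials `p` with `p (-x) = p x`. -/
noncomputable def evenPoly (ι R : Type*) [CommRing R] : Subalgebra R (MvPolynomial ι R) :=
  AlgHom.equalizer (negVars ι R) (AlgHom.id R _)

theorem mem_evenPoly {p : MvPolynomial ι R} : p ∈ evenPoly ι R ↔ negVars ι R p = p := Iff.rfl

theorem mul_mem_evenPoly {p q : MvPolynomial ι R} (hp : negVars ι R p = -p)
    (hq : negVars ι R q = -q) : p * q ∈ evenPoly ι R := by
  rw [mem_evenPoly, map_mul, hp, hq, neg_mul_neg]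

theorem monomial_mem_evenPoly {c : ι →₀ ℕ} (hc : Even c.degree) (a : R) :
    monomial c a ∈ evenPoly ι R := by
  rw [mem_evenPoly, negVars_monomial, hc.neg_one_pow, one_mul]

theorem even_degree_of_mem_evenPoly [IsAddTorsionFree R] {p : MvPolynomial ι R}
    (hp : p ∈ evenPoly ι R) {c : ι →₀ ℕ} (hc : coeff c p ≠ 0) : Even c.degree := by
  by_contra hodd
  have hcoeff := coeff_negVars p c
  rw [mem_evenPoly.1 hp, (Nat.not_even_iff_odd.1 hodd).neg_one_pow, neg_one_mul] at hcoeff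
  exact hc (self_eq_neg.1 hcoeff)

section System

variable [Fintype ι] {e : ι → ℕ} {G : ι → MvPolynomial ι R}

theorem negVars_substPow_monomial (hparity : ∀ i, negVars ι R (G i) = (-1) ^ e i * G i)
    (c : ι →₀ ℕ) :
    negVars ι R (substPow e G (monomial c 1)) =
      (-1 : R) ^ c.degree • substPow e G (monomial c 1) := by
  have hprod : ∏ i, negVars ι R (G i ^ (c i / e i)) =
      (-1) ^ (∑ i, e i * (c i / e i)) * ∏ i, G i ^ (c i / e i) := by
    rw [← Finset.prod_pow_eq_pow_sum, ← Finset.prod_mul_distrib]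
    refine Finset.prod_congr rfl fun i _ => ?_
    rw [map_pow, hparity, mul_pow, pow_mul]
  have hdegree : c.degree = (expMod e c).degree + ∑ i, e i * (c i / e i) := by
    simp only [Finsupp.degree_eq_sum, ← Finset.sum_add_distrib]
    exact Finset.sum_congr rfl fun i _ => (Nat.mod_add_div (c i) (e i)).symm
  rw [substPow_monomial, map_mul, map_prod, negVars_monomial, hprod, hdegree, ← C_mul_monomial,
    smul_eq_C_mul]
  simp only [pow_add, map_mul, map_pow, map_neg, map_one]
  ring

theorem negVars_substPow (hparity : ∀ i, negVars ι R (G i) = (-1) ^ e i * G i)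
    (p : MvPolynomial ι R) : negVars ι R (substPow e G p) = substPow e G (negVars ι R p) := by
  suffices h : (negVars ι R).toLinearMap ∘ₗ substPow e G =
      substPow e G ∘ₗ (negVars ι R).toLinearMap from DFunLike.congr_fun h p
  refine (basisMonomials ι R).ext fun c => ?_
  simp only [coe_basisMonomials, LinearMap.comp_apply, AlgHom.toLinearMap_apply,
    negVars_substPow_monomial hparity, negVars_monomial, smul_eq_mul, mul_one,
    ← map_smul]

theorem substPow_mem_evenPoly_iff (hG : ∀ i, HasLeadingMonomial (G i) (Finsupp.single i (e i)))
    (hparity : ∀ i, negVars ι R (G i) = (-1) ^ e i * G i) {p : MvPolynomial ι R} :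
    substPow e G p ∈ evenPoly ι R ↔ p ∈ evenPoly ι R := by
  rw [mem_evenPoly, mem_evenPoly, negVars_substPow hparity]
  exact (substPow_bijective hG).1.eq_iff

variable [DecidableEq ι]

/-- Exponent vectors of even degree below `e`. -/
def evenBox (e : ι → ℕ) : Finset (ι → ℕ) :=
  (Fintype.piFinset fun i => Finset.range (e i)).filter fun c => Even (∑ i, c i)

theorem mem_evenBox {c : ι → ℕ} : c ∈ evenBox e ↔ (∀ i, c i < e i) ∧ Even (∑ i, c i) := by
  simp [evenBox]

theorem two_mul_card_evenBox (e : ι → ℕ) {i₀ : ι} (h : Even (e i₀)) :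
    2 * (evenBox e).card = ∏ i, e i := by
  have halternating :
      ∑ c ∈ Fintype.piFinset (fun i => Finset.range (e i)), (-1 : ℤ) ^ (∑ i, c i) = 0 := by
    simp_rw [← Finset.prod_pow_eq_pow_sum]
    rw [← Finset.prod_univ_sum (fun i => Finset.range (e i)) (fun _ k => (-1 : ℤ) ^ k)]
    refine Finset.prod_eq_zero (Finset.mem_univ i₀) ?_
    rw [neg_one_geom_sum, if_pos h]
  have hsign (n : ℕ) : (-1 : ℤ) ^ n = 2 * (if Even n then 1 else 0) - 1 := by
    split_ifs with hn
    · rw [hn.neg_one_pow]; norm_num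
    · rw [(Nat.not_even_iff_odd.1 hn).neg_one_pow]; norm_num
  simp_rw [hsign] at halternating
  rw [Finset.sum_sub_distrib, ← Finset.mul_sum, Finset.sum_boole, Finset.sum_const,
    Fintype.card_piFinset] at halternating
  simp only [Finset.card_range, nsmul_eq_mul, mul_one] at halternating
  have hcard : (2 * (evenBox e).card : ℤ) = (∏ i, e i : ℕ) := by
    rw [evenBox]; linarith
  exact_mod_cast hcard

/-- The coefficients of the even polynomial `p` at the monomials in the box below `e`, after `p` has
been rewritten as `substPow e G q`: the coordinates of `p` modulo the `G i`. -/
noncomputable def evenCoords (hG : ∀ i, HasLeadingMonomial (G i) (Finsupp.single i (e i))) :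
    evenPoly ι R →ₗ[R] (evenBox e → R) :=
  LinearMap.pi fun c => lcoeff R (Finsupp.equivFunOnFinite.symm c.1) ∘ₗ
    (LinearEquiv.ofBijective (substPow e G) (substPow_bijective hG)).symm.toLinearMap ∘ₗ
    (evenPoly ι R).val.toLinearMap

theorem evenCoords_apply (hG : ∀ i, HasLeadingMonomial (G i) (Finsupp.single i (e i)))
    {q : MvPolynomial ι R} (hq : substPow e G q ∈ evenPoly ι R) (c : evenBox e) :
    evenCoords hG ⟨substPow e G q, hq⟩ c = coeff (Finsupp.equivFunOnFinite.symm c.1) q := by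
  change coeff _ ((LinearEquiv.ofBijective (substPow e G) (substPow_bijective hG)).symm
    (LinearEquiv.ofBijective (substPow e G) (substPow_bijective hG) q)) = _
  rw [LinearEquiv.symm_apply_apply]

theorem evenCoords_surjective (hG : ∀ i, HasLeadingMonomial (G i) (Finsupp.single i (e i)))
    (hparity : ∀ i, negVars ι R (G i) = (-1) ^ e i * G i) :
    Function.Surjective (evenCoords hG) := by
  intro b
  let q : MvPolynomial ι R := ∑ c : evenBox e, monomial (Finsupp.equivFunOnFinite.symm c.1) (b c)
  have hq : q ∈ evenPoly ι R := by
    refine Subalgebra.sum_mem _ fun c _ => monomial_mem_evenPoly ?_ _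
    simpa [Finsupp.degree_eq_sum] using (mem_evenBox.1 c.2).2
  refine ⟨⟨substPow e G q, (substPow_mem_evenPoly_iff hG hparity).2 hq⟩, funext fun c => ?_⟩
  simp only [evenCoords_apply, q, coeff_sum, coeff_monomial, EmbeddingLike.apply_eq_iff_eq,
    Subtype.coe_inj, Finset.sum_ite_eq', Finset.mem_univ, if_true]

theorem ker_evenCoords [IsAddTorsionFree R] (he : ∀ i, 0 < e i)
    (hG : ∀ i, HasLeadingMonomial (G i) (Finsupp.single i (e i)))
    (hparity : ∀ i, negVars ι R (G i) = (-1) ^ e i * G i) :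
    LinearMap.ker (evenCoords hG) =
      ((Ideal.span (Set.range G)).comap (evenPoly ι R).val).restrictScalars R := by
  ext ⟨p, hp⟩
  obtain ⟨q, rfl⟩ := (substPow_bijective hG).2 p
  have hq : q ∈ evenPoly ι R := (substPow_mem_evenPoly_iff hG hparity).1 hp
  rw [LinearMap.mem_ker, Submodule.restrictScalars_mem, Ideal.mem_comap, Subalgebra.coe_val,
    substPow_mem_span_iff he hG]
  constructor
  · intro hcoords c hc
    by_contra hne
    have hmem : (c : ι → ℕ) ∈ evenBox e :=
      mem_evenBox.2 ⟨hc, Finsupp.degree_eq_sum c ▸ even_degree_of_mem_evenPoly hq hne⟩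
    have hcoeff := congrFun hcoords ⟨c, hmem⟩
    rw [evenCoords_apply] at hcoeff
    exact hne (by simpa using hcoeff)
  · intro hcoeff
    ext c
    rw [evenCoords_apply]
    exact hcoeff _ (mem_evenBox.1 c.2).1

theorem finrank_evenPoly_quotient [Nontrivial R] [IsAddTorsionFree R] (he : ∀ i, 0 < e i)
    (hG : ∀ i, HasLeadingMonomial (G i) (Finsupp.single i (e i)))
    (hparity : ∀ i, negVars ι R (G i) = (-1) ^ e i * G i) :
    Module.finrank R (evenPoly ι R ⧸ (Ideal.span (Set.range G)).comap (evenPoly ι R).val) =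
      (evenBox e).card := by
  let J := (Ideal.span (Set.range G)).comap (evenPoly ι R).val
  let coords : (evenPoly ι R ⧸ J.restrictScalars R) ≃ₗ[R] (evenBox e → R) :=
    (Submodule.quotEquivOfEq _ _ (ker_evenCoords he hG hparity).symm).trans
      ((evenCoords hG).quotKerEquivOfSurjective (evenCoords_surjective hG hparity))
  rw [((Submodule.Quotient.restrictScalarsEquiv R J).symm.trans coords).finrank_eq,
    Module.finrank_fintype_fun_eq_card, Fintype.card_coe]

end System

theorem exists_algHom_evenPoly [Fintype ι] [DecidableEq ι] {e : ι → ℕ} {G : ι → MvPolynomial ι ℝ}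
    (he : ∀ i, 0 < e i) (hG : ∀ i, HasLeadingMonomial (G i) (Finsupp.single i (e i)))
    (hparity : ∀ i, negVars ι ℝ (G i) = (-1) ^ e i * G i) (hodd : Odd (evenBox e).card) :
    ∃ φ : evenPoly ι ℝ →ₐ[ℝ] ℝ, ∀ p : evenPoly ι ℝ,
      (p : MvPolynomial ι ℝ) ∈ Ideal.span (Set.range G) → φ p = 0 := by
  have hrank := finrank_evenPoly_quotient he hG hparity
  generalize hJ : (Ideal.span (Set.range G)).comap (evenPoly ι ℝ).val = J at hrank
  obtain ⟨ψ⟩ := exists_algHom_real_of_odd_finrank (A := evenPoly ι ℝ ⧸ J) (by rwa [hrank])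
  refine ⟨ψ.comp (Ideal.Quotient.mkₐ ℝ J), fun p hp => ?_⟩
  have hpJ : p ∈ J := hJ ▸ hp
  rw [AlgHom.comp_apply, Ideal.Quotient.mkₐ_eq_mk, Ideal.Quotient.eq_zero_iff_mem.2 hpJ, map_zero]

end Parity

/-! ### Real points of the even polynomials -/

section RealPoints

open MvPolynomial

/-- The even polynomial `x i * x j`. -/
noncomputable def quadMonomial {ι : Type*} (R : Type*) [CommRing R] (i j : ι) : evenPoly ι R :=
  ⟨X i * X j, mul_mem_evenPoly (negVars_X i) (negVars_X j)⟩

variable {ι : Type*}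

theorem monomial_mul_quadMonomial_pow {R : Type*} [CommRing R] [Fintype ι] {c : ι →₀ ℕ} {m : ℕ}
    (hc : c.degree = m + m) (a : R) (k : ι) :
    (⟨monomial c a, monomial_mem_evenPoly ⟨m, hc⟩ a⟩ : evenPoly ι R) * quadMonomial R k k ^ m =
      a • ∏ i, quadMonomial R i k ^ c i := by
  refine Subtype.ext ?_
  simp only [quadMonomial, MulMemClass.coe_mul, SubmonoidClass.coe_pow, SetLike.val_smul,
    SubmonoidClass.coe_finsetProd, mul_pow]
  rw [monomial_eq, Finsupp.prod_fintype _ _ fun _ => pow_zero _, smul_eq_C_mul,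
    Finset.prod_mul_distrib, Finset.prod_pow_eq_pow_sum, ← Finsupp.degree_eq_sum, hc, pow_add]
  ring

theorem algHom_evenPoly_ext {R A : Type*} [CommRing R] [IsAddTorsionFree R] [Semiring A]
    [Algebra R A] {φ ψ : evenPoly ι R →ₐ[R] A}
    (h : ∀ (c : ι →₀ ℕ) (hc : Even c.degree) (a : R),
      φ ⟨monomial c a, monomial_mem_evenPoly hc a⟩ = ψ ⟨monomial c a, monomial_mem_evenPoly hc a⟩) :
    φ = ψ := by
  ext p
  have heven (c : p.1.support) : Even c.1.degree :=
    even_degree_of_mem_evenPoly p.2 (mem_support_iff.1 c.2)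
  have hp : p = ∑ c : p.1.support,
      (⟨monomial c.1 (coeff c.1 p.1), monomial_mem_evenPoly (heven c) _⟩ : evenPoly ι R) := by
    refine Subtype.ext ?_
    rw [AddSubmonoidClass.coe_finsetSum,
      Finset.sum_coe_sort p.1.support fun c => monomial c (coeff c p.1)]
    exact p.1.as_sum
  rw [hp, map_sum, map_sum]
  exact Finset.sum_congr rfl fun c _ => h c.1 (heven c) _

variable {K : Type*} [Field K]

theorem algHom_monomial_of_even_degree [Fintype ι] (φ : evenPoly ι K →ₐ[K] K) {k : ι} {r : K}
    (hr : r ≠ 0) (hk : φ (quadMonomial K k k) = r * r) {c : ι →₀ ℕ} (hc : Even c.degree) (a : K) :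
    φ ⟨monomial c a, monomial_mem_evenPoly hc a⟩ = a * ∏ i, (φ (quadMonomial K i k) / r) ^ c i := by
  obtain ⟨m, hm⟩ := id hc
  have hφ := congrArg φ (monomial_mul_quadMonomial_pow hm a k)
  simp only [map_mul, map_pow, map_smul, map_prod, hk, smul_eq_mul] at hφ
  simp_rw [div_pow]
  rw [Finset.prod_div_distrib, Finset.prod_pow_eq_pow_sum, ← Finsupp.degree_eq_sum, hm, pow_add,
    ← mul_pow, mul_div_assoc', ← hφ, mul_div_cancel_right₀ _ (pow_ne_zero _ (mul_ne_zero hr hr))]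

theorem algHom_evenPoly_eq_eval [Finite ι] [IsAddTorsionFree K] (φ : evenPoly ι K →ₐ[K] K) {k : ι}
    {r : K} (hr : r ≠ 0) (hk : φ (quadMonomial K k k) = r * r) :
    ∃ x : ι → K, x k ≠ 0 ∧ ∀ p : evenPoly ι K, φ p = eval x p := by
  cases nonempty_fintype ι
  let x : ι → K := fun i => φ (quadMonomial K i k) / r
  have hφ : φ = (aeval x).comp (evenPoly ι K).val := algHom_evenPoly_ext fun c hc a => by
    rw [algHom_monomial_of_even_degree φ hr hk hc, AlgHom.comp_apply, Subalgebra.coe_val,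
      aeval_monomial, Finsupp.prod_fintype _ _ fun _ => pow_zero _, Algebra.algebraMap_self_apply]
  have hxk : x k = r := by
    simp only [x, hk, mul_div_cancel_right₀ r hr]
  exact ⟨x, hxk ▸ hr, fun p => DFunLike.congr_fun hφ p⟩

end RealPoints

/-! ### The Borsuk-Ulam theorem -/

section PerturbedSystem

open MvPolynomial

variable {d : ℕ} {R : Type*} [CommRing R]

/-- The system `x₀ ^ (2 * D) + t * (∑ xᵢ² - 1) = 0`, `xᵢ₊₁ ^ D + t * Fᵢ = 0`, whose zeros approach
common zeros of the `Fᵢ` on the unit sphere as `t` tends to infinity. -/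
noncomputable def perturbedSystem (F : Fin d → MvPolynomial (Fin (d + 1)) R) (D : ℕ) (t : R) :
    Fin (d + 1) → MvPolynomial (Fin (d + 1)) R :=
  Fin.cons (X 0 ^ (2 * D) + t • (∑ i, X i ^ 2 - 1)) fun i => X i.succ ^ D + t • F i

/-- The exponents of the leading monomials of `perturbedSystem`. -/
def perturbedDegree (d D : ℕ) : Fin (d + 1) → ℕ :=
  Fin.cons (2 * D) fun _ => D

theorem perturbedDegree_zero (D : ℕ) : perturbedDegree d D 0 = 2 * D := rfl

theorem perturbedDegree_succ (D : ℕ) (i : Fin d) : perturbedDegree d D i.succ = D := rfl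

theorem perturbedDegree_pos {D : ℕ} (hD : 0 < D) (i : Fin (d + 1)) : 0 < perturbedDegree d D i :=
  i.cases (by rw [perturbedDegree_zero]; lia) fun i => by rwa [perturbedDegree_succ]

theorem hasLeadingMonomial_perturbedSystem {F : Fin d → MvPolynomial (Fin (d + 1)) R} {D : ℕ}
    (hD : 1 < D) (hF : ∀ i, F i ∈ degLT _ R D) (t : R) (i : Fin (d + 1)) :
    HasLeadingMonomial (perturbedSystem F D t i) (Finsupp.single i (perturbedDegree d D i)) := by
  cases i using Fin.cases with
  | zero =>
    refine .X_pow_add _ _ (Submodule.smul_mem _ _ (sub_mem (sum_mem fun i _ => ?_) ?_))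
    · rw [X_pow_eq_monomial]
      exact monomial_mem_degLT (by rw [Finsupp.degree_single]; lia) _
    · exact monomial_mem_degLT (c := 0) (by rw [map_zero]; lia) 1
  | succ i => exact .X_pow_add _ _ (Submodule.smul_mem _ _ (hF i))

theorem negVars_perturbedSystem {F : Fin d → MvPolynomial (Fin (d + 1)) R}
    (hF : ∀ i, negVars _ R (F i) = -F i) {D : ℕ} (hD : Odd D) (t : R) (i : Fin (d + 1)) :
    negVars _ R (perturbedSystem F D t i) =
      (-1) ^ perturbedDegree d D i * perturbedSystem F D t i := by
  cases i using Fin.cases with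
  | zero =>
    simp only [perturbedSystem, perturbedDegree, Fin.cons_zero, map_add, map_sub, map_sum, map_smul,
      map_pow, map_one, negVars_X, even_two.neg_pow, (even_two_mul D).neg_pow, one_pow, one_mul]
  | succ i =>
    simp only [perturbedSystem, perturbedDegree, Fin.cons_succ, map_add, map_smul, map_pow, hF,
      negVars_X, hD.neg_pow, one_pow, smul_neg]
    ring

theorem odd_card_evenBox_perturbedDegree {D : ℕ} (hD : Odd D) :
    Odd (evenBox (perturbedDegree d D)).card := by
  have hcard := two_mul_card_evenBox (perturbedDegree d D) (i₀ := 0) (even_two_mul D)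
  rw [Fin.prod_univ_succ] at hcard
  simp only [perturbedDegree_zero, perturbedDegree_succ, Finset.prod_const, mul_assoc] at hcard
  rw [Nat.eq_of_mul_eq_mul_left two_pos hcard]
  exact hD.mul hD.pow

theorem exists_pos_of_pow_add_mul_eq_zero {y : Fin (d + 1) → ℝ} {D : ℕ} (hD : Odd D) {t : ℝ}
    (ht : 0 < t) (hy : y 0 ^ D + t * (∑ i, y i - 1) = 0) : ∃ k, 0 < y k := by
  by_contra! h
  have hpow : y 0 ^ D ≤ 0 := hD.pow_nonpos_iff.2 (h 0)
  have hsum : ∑ i, y i ≤ 0 := Finset.sum_nonpos fun i _ => h i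
  nlinarith

theorem exists_eval_perturbedSystem_eq_zero {F : Fin d → MvPolynomial (Fin (d + 1)) ℝ}
    (hF : ∀ i, negVars _ ℝ (F i) = -F i) {D : ℕ} (hD : Odd D) (hD' : 1 < D)
    (hdeg : ∀ i, F i ∈ degLT _ ℝ D) {t : ℝ} (ht : 0 < t) :
    ∃ x, ∀ i, eval x (perturbedSystem F D t i) = 0 := by
  set G := perturbedSystem F D t with hGdef
  have hparity (i) : negVars _ ℝ (G i) = (-1) ^ perturbedDegree d D i * G i :=
    negVars_perturbedSystem hF hD t i
  obtain ⟨φ, hφ⟩ := exists_algHom_evenPoly (G := G) (perturbedDegree_pos hD.pos)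
    (hasLeadingMonomial_perturbedSystem hD' hdeg t) hparity (odd_card_evenBox_perturbedDegree hD)
  have hmem (i) : G i ∈ Ideal.span (Set.range G) := Ideal.subset_span (Set.mem_range_self i)
  have heven : G 0 ∈ evenPoly _ ℝ := by
    rw [mem_evenPoly, hparity, perturbedDegree_zero, (even_two_mul D).neg_one_pow, one_mul]
  have hquad : φ (quadMonomial ℝ 0 0) ^ D + t * (∑ i, φ (quadMonomial ℝ i i) - 1) = 0 := by
    have hG : quadMonomial ℝ 0 0 ^ D + t • (∑ i, quadMonomial ℝ i i - 1) = ⟨G 0, heven⟩ := by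
      refine Subtype.ext ?_
      simp only [hGdef, perturbedSystem, quadMonomial, Fin.cons_zero, AddMemClass.coe_add,
        SubmonoidClass.coe_pow, SetLike.val_smul, AddSubgroupClass.coe_sub,
        AddSubmonoidClass.coe_finsetSum, OneMemClass.coe_one, ← pow_two, ← pow_mul]
    simpa only [map_add, map_pow, map_smul, map_sub, map_sum, map_one, smul_eq_mul] using
      (congrArg φ hG).trans (hφ _ (hmem 0))
  obtain ⟨k, hk⟩ := exists_pos_of_pow_add_mul_eq_zero (y := fun i => φ (quadMonomial ℝ i i))
    hD ht hquad
  obtain ⟨x, hxk, hx⟩ := algHom_evenPoly_eq_eval φ (Real.sqrt_pos.2 hk).ne'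
    (Real.mul_self_sqrt hk.le).symm
  refine ⟨x, Fin.cases ?_ fun i => ?_⟩
  · rw [← hφ ⟨G 0, heven⟩ (hmem 0), hx]
  · have hodd : negVars _ ℝ (G i.succ) = -G i.succ := by
      rw [hparity, perturbedDegree_succ, hD.neg_one_pow, neg_one_mul]
    have hmul := hφ ⟨X k * G i.succ, mul_mem_evenPoly (negVars_X k) hodd⟩
      (Ideal.mul_mem_left _ _ (hmem _))
    rw [hx, map_mul, eval_X] at hmul
    exact (mul_eq_zero.1 hmul).resolve_left hxk

end PerturbedSystem

section BorsukUlam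

open MvPolynomial

theorem exists_eq_zero_of_forall_exists_norm_lt {X E : Type*} [TopologicalSpace X]
    [NormedAddCommGroup E] {K : Set X} (hK : IsCompact K) {g : X → E} (hg : Continuous g)
    (h : ∀ ε > 0, ∃ x ∈ K, ‖g x‖ < ε) : ∃ x ∈ K, g x = 0 := by
  obtain ⟨y, hy, -⟩ := h 1 one_pos
  obtain ⟨x, hx, hmin⟩ := hK.exists_isMinOn ⟨y, hy⟩ hg.norm.continuousOn
  refine ⟨x, hx, ?_⟩
  by_contra hne
  obtain ⟨z, hz, hlt⟩ := h ‖g x‖ (norm_pos_iff.2 hne)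
  exact absurd (hmin hz) (not_le.2 hlt)

theorem abs_le_one_of_sum_sq_le_one {ι : Type*} [Fintype ι] {x : ι → ℝ} (h : ∑ i, x i ^ 2 ≤ 1)
    (i : ι) : |x i| ≤ 1 :=
  sq_le_one_iff_abs_le_one _ |>.1 <| (Finset.single_le_sum (f := fun i => x i ^ 2)
    (fun _ _ => sq_nonneg _) (Finset.mem_univ i)).trans h

theorem isCompact_sum_sq_eq_one {ι : Type*} [Fintype ι] :
    IsCompact {x : ι → ℝ | ∑ i, x i ^ 2 = 1} := by
  refine (isCompact_Icc (a := (-1 : ι → ℝ)) (b := 1)).of_isClosed_subset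
    (isClosed_eq (by fun_prop) continuous_const) fun x hx => ?_
  have habs (i : ι) := abs_le.1 (abs_le_one_of_sum_sq_le_one (x := x) hx.le i)
  exact ⟨fun i => (habs i).1, fun i => (habs i).2⟩

theorem exists_norm_sphere_eval_lt {d : ℕ} {F : Fin d → MvPolynomial (Fin (d + 1)) ℝ}
    (hF : ∀ i, negVars _ ℝ (F i) = -F i) {ε : ℝ} (hε : 0 < ε) :
    ∃ x ∈ Set.Icc (-1) 1, ‖(∑ i, x i ^ 2 - 1, fun i => eval x (F i))‖ < ε := by
  choose N hN using fun i => exists_mem_degLT (F i)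
  let D := 2 * (Finset.univ.sup N + 1) + 1
  obtain ⟨x, hx⟩ := exists_eval_perturbedSystem_eq_zero (D := D) (t := 2 / ε) hF ⟨_, rfl⟩ (by lia)
    (fun i => degLT_mono (by have := Finset.le_sup (f := N) (Finset.mem_univ i); lia) (hN i))
    (by positivity)
  have hsphere : x 0 ^ (2 * D) + 2 / ε * (∑ i, x i ^ 2 - 1) = 0 := by
    simpa [perturbedSystem, smul_eq_C_mul] using hx 0
  have hzero (i) : x (Fin.succ i) ^ D + 2 / ε * eval x (F i) = 0 := by
    simpa [perturbedSystem, smul_eq_C_mul] using hx i.succ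
  have hsum : ∑ i, x i ^ 2 ≤ 1 := by
    have hpow : 0 ≤ x 0 ^ (2 * D) := (even_two_mul _).pow_nonneg _
    have ht : 0 < 2 / ε := by positivity
    nlinarith
  have habs := abs_le_one_of_sum_sq_le_one hsum
  have hsmall {i n} {b : ℝ} (h : x i ^ n + 2 / ε * b = 0) : ‖b‖ < ε := by
    have hb : b = -(ε / 2) * x i ^ n := by field_simp at h ⊢; linarith
    rw [hb, norm_mul, norm_neg, Real.norm_of_nonneg (by positivity), norm_pow]
    have hpow : ‖x i‖ ^ n ≤ 1 := pow_le_one₀ (norm_nonneg _) (habs i)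
    nlinarith
  refine ⟨x, ⟨fun i => (abs_le.1 (habs i)).1, fun i => (abs_le.1 (habs i)).2⟩, ?_⟩
  exact max_lt (hsmall hsphere) ((pi_norm_lt_iff hε).2 fun i => hsmall (hzero i))

theorem borsukUlam_polynomial {d : ℕ} {F : Fin d → MvPolynomial (Fin (d + 1)) ℝ}
    (hF : ∀ i, negVars _ ℝ (F i) = -F i) :
    ∃ x : Fin (d + 1) → ℝ, ∑ i, x i ^ 2 = 1 ∧ ∀ i, eval x (F i) = 0 := by
  have hcont (i) : Continuous fun x => eval x (F i) := MvPolynomial.continuous_eval (F i)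
  obtain ⟨x, -, hx⟩ := exists_eq_zero_of_forall_exists_norm_lt (K := Set.Icc (-1) 1) isCompact_Icc
    (g := fun x => (∑ i, x i ^ 2 - 1, fun i => eval x (F i))) (by fun_prop)
    fun ε hε => exists_norm_sphere_eval_lt hF hε
  exact ⟨x, sub_eq_zero.1 (Prod.ext_iff.1 hx).1, congrFun (Prod.ext_iff.1 hx).2⟩

theorem exists_mvPolynomial_near {ι : Type*} {K : Set (ι → ℝ)} (hK : IsCompact K)
    {h : (ι → ℝ) → ℝ} (hh : Continuous h) {ε : ℝ} (hε : 0 < ε) :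
    ∃ p : MvPolynomial ι ℝ, ∀ x ∈ K, |eval x p - h x| < ε := by
  let coord : ι → C(ι → ℝ, ℝ) := fun i => ⟨fun x => x i, continuous_apply i⟩
  have hseparates :
      (aeval coord : MvPolynomial ι ℝ →ₐ[ℝ] C(ι → ℝ, ℝ)).range.SeparatesPoints := by
    intro x y hxy
    obtain ⟨i, hi⟩ := Function.ne_iff.1 hxy
    exact ⟨coord i, ⟨coord i, ⟨X i, aeval_X _ _⟩, rfl⟩, hi⟩
  obtain ⟨_, ⟨p, rfl⟩, hp⟩ :=
    ContinuousMap.exists_mem_subalgebra_near_continuous_of_isCompact_of_separatesPoints hseparates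
      ⟨h, hh⟩ hK hε
  have heval (x : ι → ℝ) : (aeval coord p) x = eval x p := by
    have hcomp : (ContinuousMap.evalAlgHom ℝ ℝ x).comp (aeval coord) = aeval x := by
      ext i
      simp [coord]
    simpa using DFunLike.congr_fun hcomp p
  exact ⟨p, fun x hx => heval x ▸ hp x hx⟩

theorem exists_odd_mvPolynomial_near {ι : Type*} {K : Set (ι → ℝ)} (hK : IsCompact K)
    (hneg : ∀ x ∈ K, -x ∈ K) {h : (ι → ℝ) → ℝ} (hh : Continuous h) (hodd : ∀ x, h (-x) = -h x)
    {ε : ℝ} (hε : 0 < ε) :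
    ∃ p : MvPolynomial ι ℝ, negVars ι ℝ p = -p ∧ ∀ x ∈ K, |eval x p - h x| < ε := by
  obtain ⟨p, hp⟩ := exists_mvPolynomial_near hK hh hε
  have hinvolutive : negVars ι ℝ (negVars ι ℝ p) = p := by
    have hcomp : (negVars ι ℝ).comp (negVars ι ℝ) = AlgHom.id ℝ _ := by
      ext i
      simp [negVars]
    exact DFunLike.congr_fun hcomp p
  refine ⟨(1 / 2 : ℝ) • (p - negVars ι ℝ p), ?_, fun x hx => ?_⟩
  · rw [map_smul, map_sub, hinvolutive, ← smul_neg, neg_sub]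
  · have hpos := abs_lt.1 (hp x hx)
    have hneg := abs_lt.1 (hp (-x) (hneg x hx))
    rw [hodd] at hneg
    rw [smul_eval, map_sub, eval_negVars, abs_lt]
    constructor <;> linarith

theorem borsukUlam_odd {d : ℕ} {h : (Fin (d + 1) → ℝ) → Fin d → ℝ} (hh : Continuous h)
    (hodd : ∀ x, h (-x) = -h x) : ∃ x : Fin (d + 1) → ℝ, ∑ i, x i ^ 2 = 1 ∧ h x = 0 := by
  refine exists_eq_zero_of_forall_exists_norm_lt isCompact_sum_sq_eq_one hh fun ε hε => ?_
  choose F hF hnear using fun i : Fin d => exists_odd_mvPolynomial_near isCompact_sum_sq_eq_one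
    (fun x hx => by simpa using hx) (h := fun x => h x i) (by fun_prop)
    (fun x => congrFun (hodd x) i) hε
  obtain ⟨x, hx, hzero⟩ := borsukUlam_polynomial hF
  refine ⟨x, hx, (pi_norm_lt_iff hε).2 fun i => ?_⟩
  simpa [hzero] using hnear i x hx

theorem one_le_sum_abs {ι : Type*} [Fintype ι] {x : ι → ℝ} (h : ∑ i, x i ^ 2 = 1) :
    1 ≤ ∑ i, |x i| := by
  rw [← h]
  refine Finset.sum_le_sum fun i _ => ?_
  rw [← sq_abs]
  exact pow_le_of_le_one (abs_nonneg _) (abs_le_one_of_sum_sq_le_one h.le i) two_ne_zero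

theorem exists_antipodal_eq_of_continuous {d : ℕ} {f : (Fin (d + 1) → ℝ) → Fin d → ℝ}
    (hf : Continuous f) : ∃ x : Fin (d + 1) → ℝ, ∑ i, |x i| = 1 ∧ f x = f (-x) := by
  -- Capping the scale at `1` keeps `x ↦ (scale x)⁻¹ • x` continuous at the origin.
  let scale : (Fin (d + 1) → ℝ) → ℝ := fun x => max (∑ i, |x i|) 1
  have hpos (x) : 0 < scale x := lt_max_of_lt_right one_pos
  have hscale : Continuous scale := by fun_prop
  have hnormalize : Continuous fun x => (scale x)⁻¹ • x :=
    (hscale.inv₀ fun x => (hpos x).ne').smul continuous_id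
  obtain ⟨x, hx, hzero⟩ := borsukUlam_odd
    (h := fun x => f ((scale x)⁻¹ • x) - f (-((scale x)⁻¹ • x)))
    ((hf.comp hnormalize).sub (hf.comp hnormalize.neg)) (fun x => by simp [scale])
  refine ⟨(scale x)⁻¹ • x, ?_, sub_eq_zero.1 hzero⟩
  have hsum : scale x = ∑ i, |x i| := max_eq_left (one_le_sum_abs hx)
  simp only [Pi.smul_apply, smul_eq_mul, abs_mul, abs_inv, abs_of_pos (hpos x)]
  rw [← Finset.mul_sum, ← hsum, inv_mul_cancel₀ (hpos x).ne']

end BorsukUlam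

/-! ### Running a stack machine inside a larger one -/

open Turing

section Iterate

/-- `n` steps of `f` lead from `a` to `b`; the proposition behind `StateTransition.EvalsTo`. -/
def StepsTo {α : Type*} (f : α → Option α) (n : ℕ) (a b : α) : Prop :=
  (flip bind f)^[n] (some a) = some b

variable {α β : Type*} {f : α → Option α} {g : β → Option β}

theorem StepsTo.refl (f : α → Option α) (a : α) : StepsTo f 0 a a := rfl

theorem StepsTo.eq {a b : α} (h : StepsTo f 0 a b) : a = b :=
  Option.some_injective _ h

theorem stepsTo_succ {n : ℕ} {a b : α} :
    StepsTo f (n + 1) a b ↔ ∃ c, f a = some c ∧ StepsTo f n c b := by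
  have hnone (n : ℕ) : (flip bind f)^[n] none = (none : Option α) :=
    Function.iterate_fixed (x := (none : Option α)) rfl n
  have hsome : (flip bind f) (some a) = f a := rfl
  rw [StepsTo, Function.iterate_succ_apply, hsome]
  cases hfa : f a with
  | none => simp only [hnone, reduceCtorEq, false_and, exists_false]
  | some c => simp [StepsTo]

theorem StepsTo.trans {m n : ℕ} {a b c : α} (h₁ : StepsTo f m a b) (h₂ : StepsTo f n b c) :
    StepsTo f (m + n) a c := by
  rw [StepsTo, add_comm, Function.iterate_add_apply, h₁, h₂]

theorem StepsTo.head {n : ℕ} {a b c : α} (h₁ : f a = some b) (h₂ : StepsTo f n b c) :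
    StepsTo f (n + 1) a c :=
  stepsTo_succ.2 ⟨b, h₁, h₂⟩

theorem StepsTo.simulate {r : α → β → Prop}
    (h : ∀ a b a', r a a' → f a = some b → ∃ b', g a' = some b' ∧ r b b') {n : ℕ} {a b : α}
    {a' : β} (hab : StepsTo f n a b) (hr : r a a') : ∃ b', StepsTo g n a' b' ∧ r b b' := by
  induction n generalizing a a' with
  | zero => exact ⟨a', StepsTo.refl g a', hab.eq ▸ hr⟩
  | succ n ih =>
    obtain ⟨c, hc, hcb⟩ := stepsTo_succ.1 hab
    obtain ⟨c', hc', hrc⟩ := h a c a' hr hc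
    obtain ⟨b', hb', hrb⟩ := ih hcb hrc
    exact ⟨b', hb'.head hc', hrb⟩

end Iterate

section Lift

/-- A way to run a machine with stacks `K`, labels `Λ` and states `σ` as part of a machine with
stacks `K'`, labels `Λ'` and states `σ'`. Where the small machine halts, the large one goes to
`exit`, or halts if `exit` is `none`. -/
structure MachineEmbedding (K K' Λ Λ' σ σ' : Type) where
  stack : K ↪ K'
  get : σ' → σ
  put : σ → σ'
  get_put : ∀ v, get (put v) = v
  label : Λ → Λ'
  exit : Option Λ'

namespace MachineEmbedding

variable {K K' Λ Λ' σ σ' : Type} (e : MachineEmbedding K K' Λ Λ' σ σ') {Γ : K' → Type}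

/-- A statement of the small machine as a statement of the large one. -/
def liftStmt : TM2.Stmt (fun k => Γ (e.stack k)) Λ σ → TM2.Stmt Γ Λ' σ'
  | .push k f q => .push (e.stack k) (fun s => f (e.get s)) (liftStmt q)
  | .peek k f q => .peek (e.stack k) (fun s o => e.put (f (e.get s) o)) (liftStmt q)
  | .pop k f q => .pop (e.stack k) (fun s o => e.put (f (e.get s) o)) (liftStmt q)
  | .load f q => .load (fun s => e.put (f (e.get s))) (liftStmt q)
  | .branch p q r => .branch (fun s => p (e.get s)) (liftStmt q) (liftStmt r)
  | .goto l => .goto fun s => e.label (l (e.get s))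
  | .halt => e.exit.elim .halt fun l => .goto fun _ => l

/-- The stacks `S'` of the large machine hold `S`, and agree with `R` outside the small machine. -/
structure StacksRel (R : ∀ k, List (Γ k)) (S : ∀ k, List (Γ (e.stack k))) (S' : ∀ k, List (Γ k)) :
    Prop where
  stack : ∀ k, S' (e.stack k) = S k
  other : ∀ k' ∉ Set.range e.stack, S' k' = R k'

/-- The configuration `c'` of the large machine represents the configuration `c`. -/
structure CfgRel (R : ∀ k, List (Γ k)) (c : TM2.Cfg (fun k => Γ (e.stack k)) Λ σ)
    (c' : TM2.Cfg Γ Λ' σ') : Prop where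
  label : c'.l = c.l.elim e.exit (some ∘ e.label)
  var : c'.var = e.put c.var
  rel : e.StacksRel R c.stk c'.stk

variable {e} {R : ∀ k, List (Γ k)} {S : ∀ k, List (Γ (e.stack k))} {S' : ∀ k, List (Γ k)}

theorem StacksRel.unique {S'' : ∀ k, List (Γ k)} (h : e.StacksRel R S S')
    (h' : e.StacksRel R S S'') : S' = S'' := by
  funext k'
  by_cases hk' : k' ∈ Set.range e.stack
  · obtain ⟨k, rfl⟩ := hk'
    rw [h.stack, h'.stack]
  · rw [h.other k' hk', h'.other k' hk']

variable [DecidableEq K] [DecidableEq K']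

theorem StacksRel.update (h : e.StacksRel R S S') (k : K) (L : List (Γ (e.stack k))) :
    e.StacksRel R (Function.update S k L) (Function.update S' (e.stack k) L) where
  stack j := by
    rcases eq_or_ne j k with rfl | hjk
    · rw [Function.update_self, Function.update_self]
    · rw [Function.update_of_ne hjk, Function.update_of_ne (e.stack.injective.ne hjk), h.stack]
  other k' hk' := by
    rw [Function.update_of_ne (fun hkk' => hk' ⟨k, hkk'.symm⟩), h.other k' hk']

theorem cfgRel_stepAux (q : TM2.Stmt (fun k => Γ (e.stack k)) Λ σ) (v : σ)
    (h : e.StacksRel R S S') :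
    e.CfgRel R (TM2.stepAux q v S) (TM2.stepAux (e.liftStmt q) (e.put v) S') := by
  induction q generalizing v S S' with
  | push k f q ih =>
    simp only [liftStmt, TM2.stepAux, e.get_put, h.stack]
    exact ih _ (h.update k _)
  | peek k f q ih =>
    simp only [liftStmt, TM2.stepAux, e.get_put, h.stack]
    exact ih _ h
  | pop k f q ih =>
    simp only [liftStmt, TM2.stepAux, e.get_put, h.stack]
    exact ih _ (h.update k _)
  | load f q ih =>
    simp only [liftStmt, TM2.stepAux, e.get_put]
    exact ih _ h
  | branch p q r ihq ihr =>
    simp only [liftStmt, TM2.stepAux, e.get_put]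
    cases p v
    · exact ihr _ h
    · exact ihq _ h
  | goto l =>
    simp only [liftStmt, TM2.stepAux, e.get_put]
    exact ⟨rfl, rfl, h⟩
  | halt =>
    rw [liftStmt]
    cases hexit : e.exit <;> exact ⟨hexit.symm, rfl, h⟩

variable {m : Λ → TM2.Stmt (fun k => Γ (e.stack k)) Λ σ} {m' : Λ' → TM2.Stmt Γ Λ' σ'}

theorem CfgRel.step (hm : ∀ l, m' (e.label l) = e.liftStmt (m l))
    (a b : TM2.Cfg (fun k => Γ (e.stack k)) Λ σ) (a' : TM2.Cfg Γ Λ' σ')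
    (h : e.CfgRel R a a') (hab : TM2.step m a = some b) :
    ∃ b', TM2.step m' a' = some b' ∧ e.CfgRel R b b' := by
  obtain ⟨_ | l, v, S⟩ := a
  · nomatch hab
  · obtain ⟨l', v', S'⟩ := a'
    obtain ⟨rfl, rfl, hstacks⟩ := h
    obtain rfl := Option.some_injective _ hab
    exact ⟨_, rfl, hm l ▸ cfgRel_stepAux (m l) v hstacks⟩

theorem stepsTo (hm : ∀ l, m' (e.label l) = e.liftStmt (m l)) {n : ℕ} {l₁ l₂ : Option Λ}
    {v₁ v₂ : σ} {S₁ S₂ : ∀ k, List (Γ (e.stack k))} {S₁' S₂' : ∀ k, List (Γ k)}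
    (h : StepsTo (TM2.step m) n ⟨l₁, v₁, S₁⟩ ⟨l₂, v₂, S₂⟩) (h₁ : e.StacksRel R S₁ S₁')
    (h₂ : e.StacksRel R S₂ S₂') :
    StepsTo (TM2.step m') n ⟨l₁.elim e.exit (some ∘ e.label), e.put v₁, S₁'⟩
      ⟨l₂.elim e.exit (some ∘ e.label), e.put v₂, S₂'⟩ := by
  obtain ⟨⟨l', v', S'⟩, hsteps, hlabel, hvar, hstacks⟩ :=
    h.simulate (CfgRel.step hm) (a' := ⟨_, _, S₁'⟩) ⟨rfl, rfl, h₁⟩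
  dsimp only at hlabel hvar hstacks
  rwa [hlabel, hvar, hstacks.unique h₂] at hsteps

end MachineEmbedding

end Lift

section Length

variable {K : Type} {Γ : K → Type} {Λ σ : Type}

/-- A bound on the number of symbols that a statement pushes. -/
def pushBound : TM2.Stmt Γ Λ σ → ℕ
  | .push _ _ q => pushBound q + 1
  | .peek _ _ q => pushBound q
  | .pop _ _ q => pushBound q
  | .load _ q => pushBound q
  | .branch _ q r => pushBound q + pushBound r
  | .goto _ => 0
  | .halt => 0

variable [DecidableEq K]

theorem length_stepAux_le (q : TM2.Stmt Γ Λ σ) (k : K) (v : σ) (S : ∀ k, List (Γ k)) :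
    ((TM2.stepAux q v S).stk k).length ≤ (S k).length + pushBound q := by
  induction q generalizing v S with
  | push j f q ih =>
    refine (ih _ _).trans ?_
    rcases eq_or_ne k j with rfl | hkj
    · rw [Function.update_self, List.length_cons, pushBound]
      lia
    · rw [Function.update_of_ne hkj, pushBound]
      lia
  | pop j f q ih =>
    refine (ih _ _).trans (Nat.add_le_add_right ?_ _)
    rcases eq_or_ne k j with rfl | hkj
    · rw [Function.update_self, List.length_tail]
      lia
    · rw [Function.update_of_ne hkj]
  | peek _ _ _ ih => exact ih _ _
  | load _ _ ih => exact ih _ _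
  | branch p q r ihq ihr =>
    rw [TM2.stepAux, pushBound]
    cases p v
    · exact (ihr v S).trans (by lia)
    · exact (ihq v S).trans (by lia)
  | goto l => exact le_rfl
  | halt => exact le_rfl

theorem StepsTo.length_stk_le {m : Λ → TM2.Stmt Γ Λ σ} {C : ℕ} (hC : ∀ l, pushBound (m l) ≤ C)
    (k : K) {n : ℕ} {a b : TM2.Cfg Γ Λ σ} (hab : StepsTo (TM2.step m) n a b) :
    (b.stk k).length ≤ (a.stk k).length + C * n := by
  induction n generalizing a with
  | zero => rw [hab.eq, mul_zero, add_zero]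
  | succ n ih =>
    obtain ⟨c, hc, hcb⟩ := stepsTo_succ.1 hab
    obtain ⟨_ | l, v, S⟩ := a
    · nomatch hc
    · obtain rfl := Option.some_injective _ hc
      have hstep := (length_stepAux_le (m l) k v S).trans (Nat.add_le_add_left (hC l) _)
      calc (b.stk k).length ≤ ((TM2.stepAux (m l) v S).stk k).length + C * n := ih hcb
        _ ≤ (S k).length + C * (n + 1) := by rw [mul_add_one]; lia

end Length

/-! ### Composition of polynomial-time machines -/

theorem initList_eq (tm : FinTM2) (s : List (tm.Γ tm.k₀)) :
    initList tm s = ⟨some tm.main, tm.initialState, Function.update (fun _ => []) tm.k₀ s⟩ := by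
  refine congrArg (TM2.Cfg.mk _ _) (funext fun k => ?_)
  rcases eq_or_ne k tm.k₀ with rfl | hk <;> simp [*]

theorem haltList_eq (tm : FinTM2) (s : List (tm.Γ tm.k₁)) :
    haltList tm s = ⟨none, tm.initialState, Function.update (fun _ => []) tm.k₁ s⟩ := by
  refine congrArg (TM2.Cfg.mk _ _) (funext fun k => ?_)
  rcases eq_or_ne k tm.k₁ with rfl | hk <;> simp [*]

theorem polyTime_iff {α β Γ Δ : Type} {ea : α → List Γ} {eb : β → List Δ} {f : α → β} :
    PolyTime ea eb f ↔ ∃ (tm : FinTM2) (i : tm.Γ tm.k₀ ≃ Γ) (o : tm.Γ tm.k₁ ≃ Δ)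
      (t : Polynomial ℕ), ∀ a, ∃ n ≤ t.eval (ea a).length, StepsTo tm.step n
        (initList tm ((ea a).map i.symm)) (haltList tm ((eb (f a)).map o.symm)) := by
  constructor
  · rintro ⟨⟨tm, i, o⟩, t, h⟩
    exact ⟨tm, i, o, t, fun a => ⟨(h a).steps, (h a).steps_le_m, (h a).evals_in_steps⟩⟩
  · rintro ⟨tm, i, o, t, h⟩
    choose n hn hsteps using h
    exact ⟨⟨tm, i, o⟩, t, fun a => ⟨⟨n a, hsteps a⟩, hn a⟩⟩

theorem exists_pushBound_le (tm : FinTM2) : ∃ C, ∀ l, pushBound (tm.m l) ≤ C :=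
  letI := tm.ΛFin
  ⟨Finset.univ.sup fun l => pushBound (tm.m l), fun l =>
    Finset.le_sup (f := fun l => pushBound (tm.m l)) (Finset.mem_univ l)⟩

theorem length_output_le {tm : FinTM2} {C : ℕ} (hC : ∀ l, pushBound (tm.m l) ≤ C) {n : ℕ}
    {s : List (tm.Γ tm.k₀)} {u : List (tm.Γ tm.k₁)}
    (h : StepsTo tm.step n (initList tm s) (haltList tm u)) : u.length ≤ s.length + C * n := by
  have hlength := StepsTo.length_stk_le hC tm.k₁ h
  simp only [haltList_eq, initList_eq, Function.update_self] at hlength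
  refine hlength.trans (Nat.add_le_add_right ?_ _)
  by_cases hk : tm.k₁ = tm.k₀
  · rw [hk, Function.update_self]
  · simp [Function.update_of_ne hk]

section Comp

variable (M₁ M₂ : FinTM2)

/-- Stacks of the composed machine: those of both machines and one more for copying. -/
abbrev CompΓ : M₁.K ⊕ M₂.K ⊕ Unit → Type
  | .inl k => M₁.Γ k
  | .inr (.inl k) => M₂.Γ k
  | .inr (.inr _) => M₂.Γ M₂.k₀

/-- Labels of the composed machine: those of both machines and two for copying, `false` while the
output of the first machine is moved to the extra stack and `true` while the extra stack is moved to
the input of the second machine. Each move reverses the order. -/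
abbrev CompΛ : Type := M₁.Λ ⊕ M₂.Λ ⊕ Bool

/-- States of the composed machine: those of both machines and the symbol being copied. -/
abbrev Compσ : Type := M₁.σ × M₂.σ × Option (M₂.Γ M₂.k₀)

/-- The first machine inside the composed one; it hands over to the copying. -/
def compFst : MachineEmbedding M₁.K (M₁.K ⊕ M₂.K ⊕ Unit) M₁.Λ (CompΛ M₁ M₂) M₁.σ (Compσ M₁ M₂) where
  stack := .inl
  get := Prod.fst
  put v := (v, M₂.initialState, none)
  get_put _ := rfl
  label := Sum.inl
  exit := some (.inr (.inr false))

/-- The second machine inside the composed one. -/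
def compSnd : MachineEmbedding M₂.K (M₁.K ⊕ M₂.K ⊕ Unit) M₂.Λ (CompΛ M₁ M₂) M₂.σ (Compσ M₁ M₂) where
  stack := Function.Embedding.inl.trans .inr
  get s := s.2.1
  put v := (M₁.initialState, v, none)
  get_put _ := rfl
  label l := .inr (.inl l)
  exit := none

variable (tr : M₁.Γ M₁.k₁ → M₂.Γ M₂.k₀) (junk : M₂.Γ M₂.k₀)

/-- The program of the composed machine. The symbol `junk` is never pushed. -/
def compProg : CompΛ M₁ M₂ → TM2.Stmt (CompΓ M₁ M₂) (CompΛ M₁ M₂) (Compσ M₁ M₂)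
  | .inl l => (compFst M₁ M₂).liftStmt (M₁.m l)
  | .inr (.inl l) => (compSnd M₁ M₂).liftStmt (M₂.m l)
  | .inr (.inr false) => .pop (.inl M₁.k₁) (fun s o => (s.1, s.2.1, o.map tr)) <|
      .branch (fun s => s.2.2.isSome)
        (.push (.inr (.inr ())) (fun s => s.2.2.getD junk) <| .goto fun _ => .inr (.inr false))
        (.goto fun _ => .inr (.inr true))
  | .inr (.inr true) => .pop (.inr (.inr ())) (fun s o => (s.1, s.2.1, o)) <|
      .branch (fun s => s.2.2.isSome)
        (.push (.inr (.inl M₂.k₀)) (fun s => s.2.2.getD junk) <| .goto fun _ => .inr (.inr true))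
        (.goto fun _ => .inr (.inl M₂.main))

/-- The machine that runs `M₁` and then `M₂` on the output of `M₁`. -/
def compMachine : FinTM2 :=
  letI := M₁.kFin
  letI := M₂.kFin
  letI := M₁.ΛFin
  letI := M₂.ΛFin
  letI := M₁.σFin
  letI := M₂.σFin
  letI := M₂.Γk₀Fin
  letI : Fintype (CompΓ M₁ M₂ (.inl M₁.k₀)) := M₁.Γk₀Fin
  { K := M₁.K ⊕ M₂.K ⊕ Unit
    k₀ := .inl M₁.k₀
    k₁ := .inr (.inl M₂.k₁)
    Γ := CompΓ M₁ M₂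
    Λ := CompΛ M₁ M₂
    main := .inl M₁.main
    σ := Compσ M₁ M₂
    initialState := (M₁.initialState, M₂.initialState, none)
    m := compProg M₁ M₂ tr junk }

/-- Stacks while the output of the first machine is copied: `A` is left of this output, `B` is the
part of the input of the second machine that is complete, `T` is on the extra stack. -/
def copyStk (A : List (M₁.Γ M₁.k₁)) (B T : List (M₂.Γ M₂.k₀)) : ∀ k, List (CompΓ M₁ M₂ k)
  | .inl k => Function.update (β := fun k => List (M₁.Γ k)) (fun _ => []) M₁.k₁ A k
  | .inr (.inl k) => Function.update (β := fun k => List (M₂.Γ k)) (fun _ => []) M₂.k₀ B k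
  | .inr (.inr _) => T

variable {M₁ M₂ tr junk}

theorem copyStk_output (A : List (M₁.Γ M₁.k₁)) (B T : List (M₂.Γ M₂.k₀)) :
    copyStk M₁ M₂ A B T (.inl M₁.k₁) = A := by
  simp [copyStk]

theorem copyStk_input (A : List (M₁.Γ M₁.k₁)) (B T : List (M₂.Γ M₂.k₀)) :
    copyStk M₁ M₂ A B T (.inr (.inl M₂.k₀)) = B := by
  simp [copyStk]

theorem copyStk_extra (A : List (M₁.Γ M₁.k₁)) (B T : List (M₂.Γ M₂.k₀)) :
    copyStk M₁ M₂ A B T (.inr (.inr ())) = T := rfl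

theorem update_copyStk_output (A A' : List (M₁.Γ M₁.k₁)) (B T : List (M₂.Γ M₂.k₀)) :
    Function.update (copyStk M₁ M₂ A B T) (.inl M₁.k₁) A' = copyStk M₁ M₂ A' B T := by
  funext k
  rcases k with k | k | k
  · rcases eq_or_ne k M₁.k₁ with rfl | hk <;> simp [copyStk, *]
  all_goals simp [copyStk]

theorem update_copyStk_input (A : List (M₁.Γ M₁.k₁)) (B B' T : List (M₂.Γ M₂.k₀)) :
    Function.update (copyStk M₁ M₂ A B T) (.inr (.inl M₂.k₀)) B' = copyStk M₁ M₂ A B' T := by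
  funext k
  rcases k with k | k | k
  · simp [copyStk]
  · rcases eq_or_ne k M₂.k₀ with rfl | hk <;> simp [copyStk, *]
  · simp [copyStk]

theorem update_copyStk_extra (A : List (M₁.Γ M₁.k₁)) (B T T' : List (M₂.Γ M₂.k₀)) :
    Function.update (copyStk M₁ M₂ A B T) (.inr (.inr ())) T' = copyStk M₁ M₂ A B T' := by
  funext k
  rcases k with k | k | k <;> simp [copyStk]

theorem stepsTo_copy_output (A : List (M₁.Γ M₁.k₁)) (T : List (M₂.Γ M₂.k₀))
    (o : Option (M₂.Γ M₂.k₀)) :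
    StepsTo (TM2.step (compProg M₁ M₂ tr junk)) (A.length + 1)
      ⟨some (.inr (.inr false)), (M₁.initialState, M₂.initialState, o), copyStk M₁ M₂ A [] T⟩
      ⟨some (.inr (.inr true)), (M₁.initialState, M₂.initialState, none),
        copyStk M₁ M₂ [] [] ((A.map tr).reverse ++ T)⟩ := by
  induction A generalizing T o with
  | nil =>
    refine (StepsTo.refl _ _).head ?_
    simp [TM2.step, compProg, copyStk_output, update_copyStk_output]
  | cons a A ih =>
    rw [List.map_cons, List.reverse_cons, List.append_assoc]
    refine StepsTo.head ?_ (ih (tr a :: T) (some (tr a)))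
    simp [TM2.step, compProg, copyStk_output, copyStk_extra, update_copyStk_output,
      update_copyStk_extra]

theorem stepsTo_copy_input (T B : List (M₂.Γ M₂.k₀)) (o : Option (M₂.Γ M₂.k₀)) :
    StepsTo (TM2.step (compProg M₁ M₂ tr junk)) (T.length + 1)
      ⟨some (.inr (.inr true)), (M₁.initialState, M₂.initialState, o), copyStk M₁ M₂ [] B T⟩
      ⟨some (.inr (.inl M₂.main)), (M₁.initialState, M₂.initialState, none),
        copyStk M₁ M₂ [] (T.reverse ++ B) []⟩ := by
  induction T generalizing B o with
  | nil =>
    refine (StepsTo.refl _ _).head ?_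
    simp [TM2.step, compProg, copyStk_extra, update_copyStk_extra]
  | cons a T ih =>
    rw [List.reverse_cons, List.append_assoc]
    refine StepsTo.head ?_ (ih (a :: B) (some a))
    simp [TM2.step, compProg, copyStk_input, copyStk_extra, update_copyStk_input,
      update_copyStk_extra]

theorem stepsTo_compFst {s : List (M₁.Γ M₁.k₀)} {u : List (M₁.Γ M₁.k₁)} {n : ℕ}
    (h : StepsTo M₁.step n (initList M₁ s) (haltList M₁ u)) :
    StepsTo (TM2.step (compProg M₁ M₂ tr junk)) n
      ⟨some (.inl M₁.main), (M₁.initialState, M₂.initialState, none),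
        Function.update (fun _ => []) (.inl M₁.k₀) s⟩
      ⟨some (.inr (.inr false)), (M₁.initialState, M₂.initialState, none),
        copyStk M₁ M₂ u [] []⟩ := by
  rw [initList_eq, haltList_eq] at h
  refine (compFst M₁ M₂).stepsTo (Γ := CompΓ M₁ M₂) (R := fun _ => []) (fun _ => rfl) h
    (.update (e := compFst M₁ M₂) (Γ := CompΓ M₁ M₂) (S := fun _ => []) (S' := fun _ => [])
      ⟨fun _ => rfl, fun _ _ => rfl⟩ M₁.k₀ s)
    ⟨fun _ => rfl, fun k hk => ?_⟩
  rcases k with k | k | k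
  · exact (hk ⟨k, rfl⟩).elim
  all_goals simp [copyStk]

theorem stepsTo_compSnd {s : List (M₂.Γ M₂.k₀)} {u : List (M₂.Γ M₂.k₁)} {n : ℕ}
    (h : StepsTo M₂.step n (initList M₂ s) (haltList M₂ u)) :
    StepsTo (TM2.step (compProg M₁ M₂ tr junk)) n
      ⟨some (.inr (.inl M₂.main)), (M₁.initialState, M₂.initialState, none), copyStk M₁ M₂ [] s []⟩
      ⟨none, (M₁.initialState, M₂.initialState, none),
        Function.update (fun _ => []) (.inr (.inl M₂.k₁)) u⟩ := by
  rw [initList_eq, haltList_eq] at h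
  refine (compSnd M₁ M₂).stepsTo (Γ := CompΓ M₁ M₂) (R := fun _ => []) (fun _ => rfl) h
    ⟨fun _ => rfl, fun k hk => ?_⟩
    (.update (e := compSnd M₁ M₂) (Γ := CompΓ M₁ M₂) (S := fun _ => []) (S' := fun _ => [])
      ⟨fun _ => rfl, fun _ _ => rfl⟩ M₂.k₁ u)
  rcases k with k | k | k
  · simp [copyStk]
  · exact (hk ⟨k, rfl⟩).elim
  · rfl

theorem stepsTo_compMachine {s : List (M₁.Γ M₁.k₀)} {u : List (M₁.Γ M₁.k₁)}
    {v : List (M₂.Γ M₂.k₁)} {n₁ n₂ : ℕ}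
    (h₁ : StepsTo M₁.step n₁ (initList M₁ s) (haltList M₁ u))
    (h₂ : StepsTo M₂.step n₂ (initList M₂ (u.map tr)) (haltList M₂ v)) :
    StepsTo (compMachine M₁ M₂ tr junk).step (n₁ + (u.length + 1) + (u.length + 1) + n₂)
      (initList (compMachine M₁ M₂ tr junk) s) (haltList (compMachine M₁ M₂ tr junk) v) := by
  have hout := stepsTo_copy_output (tr := tr) (junk := junk) u [] none
  have hin := stepsTo_copy_input (M₁ := M₁) (tr := tr) (junk := junk) (u.map tr).reverse [] none
  simp only [List.append_nil, List.length_reverse, List.length_map, List.reverse_reverse]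
    at hout hin
  have hinit := initList_eq (compMachine M₁ M₂ tr junk) s
  have hhalt := haltList_eq (compMachine M₁ M₂ tr junk) v
  refine (congrArg₂ (StepsTo (compMachine M₁ M₂ tr junk).step _) hinit hhalt).mpr ?_
  exact (((stepsTo_compFst h₁).trans hout).trans hin).trans (stepsTo_compSnd h₂)

end Comp

theorem monotone_polynomial_eval (p : Polynomial ℕ) : Monotone p.eval := by
  intro a b hab
  simp only [Polynomial.eval_eq_sum, Polynomial.sum]
  gcongr

theorem PolyTime.comp {α β γ Γ Δ Θ : Type} [Inhabited Δ] {ea : α → List Γ} {eb : β → List Δ}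
    {ec : γ → List Θ} {f : α → β} {g : β → γ} (hg : PolyTime eb ec g) (hf : PolyTime ea eb f) :
    PolyTime ea ec (g ∘ f) := by
  obtain ⟨M₁, i₁, o₁, t₁, hM₁⟩ := polyTime_iff.1 hf
  obtain ⟨M₂, i₂, o₂, t₂, hM₂⟩ := polyTime_iff.1 hg
  obtain ⟨C, hC⟩ := exists_pushBound_le M₁
  let len : Polynomial ℕ := Polynomial.X + Polynomial.C C * t₁
  refine polyTime_iff.2 ⟨compMachine M₁ M₂ (fun a => i₂.symm (o₁ a)) (i₂.symm default), i₁, o₂,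
    t₁ + 2 * (len + 1) + t₂.comp len, fun a => ?_⟩
  obtain ⟨n₁, hn₁, hsteps₁⟩ := hM₁ a
  obtain ⟨n₂, hn₂, hsteps₂⟩ := hM₂ (f a)
  have hlen : (eb (f a)).length ≤ len.eval (ea a).length := by
    have hC' : C * n₁ ≤ C * t₁.eval (ea a).length := by gcongr
    have houtput := length_output_le hC hsteps₁
    simp only [List.length_map] at houtput
    simpa [len] using houtput.trans (by gcongr)
  have htr : (eb (f a)).map i₂.symm =
      ((eb (f a)).map o₁.symm).map fun a => i₂.symm (o₁ a) := by
    simp [Function.comp_def]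
  rw [htr] at hsteps₂
  refine ⟨_, ?_, stepsTo_compMachine hsteps₁ hsteps₂⟩
  have hn₂' := hn₂.trans (monotone_polynomial_eval t₂ hlen)
  simp only [List.length_map, Polynomial.eval_add, Polynomial.eval_mul, Polynomial.eval_ofNat,
    Polynomial.eval_one, Polynomial.eval_comp]
  lia

/-! ### A programming language for stack machines -/

/-- Programs that work on stacks `K` of symbols `A`. The program `loop k body again` pops a symbol
of stack `k` (`none` if the stack is empty), runs the `body` for this symbol, and repeats this if
`again` says so for this symbol. -/
inductive Prog (K A : Type) : Type
  | skip
  | push (k : K) (a : A)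
  | seq (p q : Prog K A)
  | loop (k : K) (body : Option A → Prog K A) (again : Option A → Bool)

section Prog

variable {K A : Type}

/-- `Run p s n s'`: the program `p` transforms the stacks `s` into `s'` in `n` steps. -/
inductive Run [DecidableEq K] : Prog K A → (K → List A) → ℕ → (K → List A) → Prop
  | skip (s) : Run .skip s 0 s
  | push (k a s) : Run (.push k a) s 1 (Function.update s k (a :: s k))
  | seq {p q s s' s'' m n} : Run p s m s' → Run q s' n s'' → Run (.seq p q) s (m + n) s''
  | last {k body again s s' n} : again (s k).head? = false →
      Run (body (s k).head?) (Function.update s k (s k).tail) n s' →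
      Run (.loop k body again) s (n + 1) s'
  | next {k body again s s' s'' m n} : again (s k).head? = true →
      Run (body (s k).head?) (Function.update s k (s k).tail) m s' →
      Run (.loop k body again) s' n s'' → Run (.loop k body again) s (m + n + 1) s''

/-- Elementary instructions with their successors. -/
inductive Instr (K A L : Type) : Type
  | push (k : K) (a : A) (l : L)
  | pop (k : K) (l : Option A → L)

namespace Instr

variable {L L' L'' : Type}

/-- Rename the successors. -/
def map (f : L → L') : Instr K A L → Instr K A L'
  | push k a l => push k a (f l)
  | pop k l => pop k fun o => f (l o)

theorem map_id (i : Instr K A L) : i.map id = i := by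
  cases i <;> rfl

theorem map_map (f : L → L') (g : L' → L'') (i : Instr K A L) :
    (i.map f).map g = i.map (g ∘ f) := by
  cases i <;> rfl

/-- An instruction as a statement of a stack machine whose state is the symbol popped last. -/
def toStmt : Instr K A L → TM2.Stmt (fun _ : K => A) L (Option A)
  | push k a l => .push k (fun _ => a) (.goto fun _ => l)
  | pop k l => .pop k (fun _ o => o) (.goto l)

end Instr

namespace Prog

/-- The labels of a compiled program. -/
def Lab : Prog K A → Type
  | skip => Empty
  | push _ _ => Unit
  | seq p q => p.Lab ⊕ q.Lab
  | loop _ body _ => Option (Σ o : Option A, (body o).Lab)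

theorem finite_lab [Finite A] (p : Prog K A) : Finite p.Lab := by
  induction p with
  | skip => exact inferInstanceAs (Finite Empty)
  | push => exact inferInstanceAs (Finite Unit)
  | seq p q => exact inferInstanceAs (Finite (p.Lab ⊕ q.Lab))
  | loop _ body _ => exact inferInstanceAs (Finite (Option (Σ o : Option A, (body o).Lab)))

/-- The label at which a compiled program starts, `none` if there is nothing to do. -/
def entry : (p : Prog K A) → Option p.Lab
  | skip => none
  | push _ _ => some ()
  | seq p q => p.entry.elim (q.entry.map Sum.inr) (fun l => some (Sum.inl l))
  | loop _ _ _ => some none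

/-- The code of a compiled program, where `none` is the exit. -/
def code : (p : Prog K A) → p.Lab → Instr K A (Option p.Lab)
  | skip, l => nomatch l
  | push k a, _ => .push k a none
  | seq p q, .inl l =>
    (p.code l).map fun t => t.elim (q.entry.map Sum.inr) (fun l => some (Sum.inl l))
  | seq _ q, .inr l => (q.code l).map (Option.map Sum.inr)
  | loop k body again, none => .pop k fun o =>
      (body o).entry.elim (if again o then some none else none) fun l => some (some ⟨o, l⟩)
  | loop _ body again, some ⟨o, l⟩ => ((body o).code l).map fun t =>
      t.elim (if again o then some none else none) fun l => some (some ⟨o, l⟩)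

/-- The machine code `M` contains the code of `p`, at the labels `emb`, with exit `ret`. -/
def IsCompiledAt {L : Type} (M : L → TM2.Stmt (fun _ : K => A) L (Option A)) (p : Prog K A)
    (ret : L) (emb : p.Lab → L) : Prop :=
  ∀ l, M (emb l) = ((p.code l).map fun t => t.elim ret emb).toStmt

variable {L : Type} {M : L → TM2.Stmt (fun _ : K => A) L (Option A)} {ret : L}

theorem entry_seq_elim (p q : Prog K A) (emb : (seq p q).Lab → L) :
    (seq p q).entry.elim ret emb =
      p.entry.elim (q.entry.elim ret (emb ∘ Sum.inr)) (emb ∘ Sum.inl) := by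
  rw [entry]
  cases p.entry <;> cases q.entry <;> rfl

theorem IsCompiledAt.seq_left {p q : Prog K A} {emb : (seq p q).Lab → L}
    (h : IsCompiledAt M (seq p q) ret emb) :
    IsCompiledAt M p (q.entry.elim ret (emb ∘ Sum.inr)) (emb ∘ Sum.inl) := by
  intro l
  refine (h (Sum.inl l)).trans ?_
  simp only [code, Instr.map_map]
  congr 2
  funext t
  cases t <;> cases q.entry <;> rfl

theorem IsCompiledAt.seq_right {p q : Prog K A} {emb : (seq p q).Lab → L}
    (h : IsCompiledAt M (seq p q) ret emb) : IsCompiledAt M q ret (emb ∘ Sum.inr) := by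
  intro l
  refine (h (Sum.inr l)).trans ?_
  simp only [code, Instr.map_map]
  congr 2
  funext t
  cases t <;> rfl

section Loop

variable {k : K} {body : Option A → Prog K A} {again : Option A → Bool}
  {emb : (loop k body again).Lab → L}

theorem IsCompiledAt.loop_body (h : IsCompiledAt M (loop k body again) ret emb) (o : Option A) :
    IsCompiledAt M (body o) (if again o then emb none else ret) fun l => emb (some ⟨o, l⟩) := by
  intro l
  refine (h (some ⟨o, l⟩)).trans ?_
  simp only [code, Instr.map_map]
  congr 2
  funext t
  cases t <;> cases again o <;> rfl

theorem IsCompiledAt.step_loop [DecidableEq K] (h : IsCompiledAt M (loop k body again) ret emb)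
    (v : Option A) (s : K → List A) :
    TM2.step M ⟨some (emb none), v, s⟩ = some
      ⟨some ((body (s k).head?).entry.elim (if again (s k).head? then emb none else ret)
        fun l => emb (some ⟨_, l⟩)), (s k).head?, Function.update s k (s k).tail⟩ := by
  refine (congrArg (fun q => some (TM2.stepAux q v s)) (h none)).trans ?_
  simp only [code, Instr.map, Instr.toStmt, TM2.stepAux]
  congr 3
  cases (body (s k).head?).entry <;> cases again (s k).head? <;> rfl

end Loop

end Prog

theorem Run.stepsTo [DecidableEq K] {L : Type} {M : L → TM2.Stmt (fun _ : K => A) L (Option A)}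
    {p : Prog K A} {s s' : K → List A} {n : ℕ} (h : Run p s n s') (ret : L) (emb : p.Lab → L)
    (hM : p.IsCompiledAt M ret emb) (v : Option A) : ∃ v',
      StepsTo (TM2.step M) n ⟨some (p.entry.elim ret emb), v, s⟩ ⟨some ret, v', s'⟩ := by
  induction h generalizing ret v with
  | skip s => exact ⟨v, StepsTo.refl _ _⟩
  | push k a s =>
    exact ⟨v, (StepsTo.refl _ _).head (congrArg (fun q => some (TM2.stepAux q v s)) (hM ()))⟩
  | seq _ _ ihp ihq =>
    obtain ⟨v₁, hsteps₁⟩ := ihp _ _ hM.seq_left v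
    obtain ⟨v₂, hsteps₂⟩ := ihq _ _ hM.seq_right v₁
    rw [Prog.entry_seq_elim]
    exact ⟨v₂, hsteps₁.trans hsteps₂⟩
  | @last k _ _ s _ _ hagain _ ih =>
    have hstep := hM.step_loop v s
    have hbody := hM.loop_body (s k).head?
    simp only [hagain] at hstep hbody
    obtain ⟨v', hsteps⟩ := ih _ _ hbody (s k).head?
    exact ⟨v', hsteps.head hstep⟩
  | @next k _ _ s _ _ _ _ hagain _ _ ih ih' =>
    have hstep := hM.step_loop v s
    have hbody := hM.loop_body (s k).head?
    simp only [hagain] at hstep hbody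
    obtain ⟨v₁, hsteps₁⟩ := ih _ _ hbody (s k).head?
    obtain ⟨v₂, hsteps₂⟩ := ih' _ _ hM v₁
    exact ⟨v₂, (hsteps₁.trans hsteps₂).head hstep⟩

/-- The code of a compiled program as a machine, which resets its internal state at the end. -/
def progCode (p : Prog K A) : Option p.Lab → TM2.Stmt (fun _ : K => A) (Option p.Lab) (Option A)
  | none => .load (fun _ => none) .halt
  | some l => (p.code l).toStmt

theorem isCompiledAt_progCode (p : Prog K A) : p.IsCompiledAt (progCode p) none some := by
  intro l
  rw [progCode, ← Instr.map_id (p.code l), Instr.map_map]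
  congr 2
  funext t
  cases t <;> rfl

/-- The machine that executes a program. -/
noncomputable def progMachine [DecidableEq K] [Fintype K] [Fintype A] (p : Prog K A) (k₀ k₁ : K) :
    FinTM2 :=
  letI := p.finite_lab
  letI := Fintype.ofFinite p.Lab
  letI : Fintype ((fun _ : K => A) k₀) := inferInstanceAs (Fintype A)
  { K := K
    k₀ := k₀
    k₁ := k₁
    Γ := fun _ => A
    Λ := Option p.Lab
    main := p.entry
    σ := Option A
    initialState := none
    m := progCode p }

theorem Run.stepsTo_progMachine [DecidableEq K] [Fintype K] [Fintype A] {p : Prog K A} {k₀ k₁ : K}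
    {u v : List A} {n : ℕ}
    (h : Run p (Function.update (fun _ => []) k₀ u) n (Function.update (fun _ => []) k₁ v)) :
    StepsTo (progMachine p k₀ k₁).step (n + 1) (initList (progMachine p k₀ k₁) u)
      (haltList (progMachine p k₀ k₁) v) := by
  obtain ⟨o, hsteps⟩ := h.stepsTo none some (isCompiledAt_progCode p) none
  have helim : p.entry.elim none some = p.entry := by cases p.entry <;> rfl
  rw [helim] at hsteps
  have hinit := initList_eq (progMachine p k₀ k₁) u
  have hhalt := haltList_eq (progMachine p k₀ k₁) v
  refine (congrArg₂ (StepsTo (progMachine p k₀ k₁).step _) hinit hhalt).mpr ?_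
  exact hsteps.trans ((StepsTo.refl _ _).head rfl)

theorem PolyTime.of_run [DecidableEq K] [Finite K] [Finite A] {α β : Type} {ea : α → List A}
    {eb : β → List A} {f : α → β} (p : Prog K A) (k₀ k₁ : K) (time : Polynomial ℕ)
    (h : ∀ a, ∃ n ≤ time.eval (ea a).length, Run p (Function.update (fun _ => []) k₀ (ea a)) n
      (Function.update (fun _ => []) k₁ (eb (f a)))) : PolyTime ea eb f := by
  have := Fintype.ofFinite K
  have := Fintype.ofFinite A
  refine polyTime_iff.2 ⟨progMachine p k₀ k₁, .refl A, .refl A, time + 1, fun a => ?_⟩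
  obtain ⟨n, hn, hrun⟩ := h a
  refine ⟨n + 1, by simpa using hn, ?_⟩
  have hid (l : List A) : l.map (Equiv.refl A).symm = l := l.map_id
  have hsteps := hrun.stepsTo_progMachine
  rw [← hid (ea a), ← hid (eb (f a))] at hsteps
  exact hsteps

end Prog

/-! ### The formula of an instance -/

namespace Term

variable {V W : Type}

/-- Substitution of variables for variables. -/
def map (f : V → W) : Term V → Term W
  | var a => var (f a)
  | const z => const z
  | add s t => add (s.map f) (t.map f)
  | sub s t => sub (s.map f) (t.map f)
  | mul s t => mul (s.map f) (t.map f)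

theorem eval_map (f : V → W) (v : W → ℝ) (t : Term V) : (t.map f).eval v = t.eval (v ∘ f) := by
  induction t <;> simp_all [map, eval]

theorem enc_map (f : V → W) (e : W → List Sym) (t : Term V) :
    (t.map f).enc e = t.enc (e ∘ f) := by
  induction t <;> simp_all [map, enc]

/-- All variables of the term satisfy `P`. -/
def All (P : V → Prop) : Term V → Prop
  | var a => P a
  | const _ => True
  | add s t => s.All P ∧ t.All P
  | sub s t => s.All P ∧ t.All P
  | mul s t => s.All P ∧ t.All P

theorem enc_congr {e e' : V → List Sym} (t : Term V) (h : t.All fun a => e a = e' a) :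
    t.enc e = t.enc e' := by
  induction t <;> simp_all [All, enc]

end Term

namespace QF

variable {V W : Type}

/-- Substitution of variables for variables. -/
def map (f : V → W) : QF V → QF W
  | lt s t => lt (s.map f) (t.map f)
  | le s t => le (s.map f) (t.map f)
  | eq s t => eq (s.map f) (t.map f)
  | ge s t => ge (s.map f) (t.map f)
  | gt s t => gt (s.map f) (t.map f)
  | and p q => and (p.map f) (q.map f)
  | or p q => or (p.map f) (q.map f)
  | not p => not (p.map f)

theorem holds_map (f : V → W) (v : W → ℝ) (q : QF V) : (q.map f).Holds v ↔ q.Holds (v ∘ f) := by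
  induction q <;> simp_all [map, Holds, Term.eval_map]

theorem enc_map (f : V → W) (e : W → List Sym) (q : QF V) : (q.map f).enc e = q.enc (e ∘ f) := by
  induction q <;> simp_all [map, enc, Term.enc_map]

/-- All variables of the formula satisfy `P`. -/
def All (P : V → Prop) : QF V → Prop
  | lt s t => s.All P ∧ t.All P
  | le s t => s.All P ∧ t.All P
  | eq s t => s.All P ∧ t.All P
  | ge s t => s.All P ∧ t.All P
  | gt s t => s.All P ∧ t.All P
  | and p q => p.All P ∧ q.All P
  | or p q => p.All P ∧ q.All P
  | not p => p.All P

theorem enc_congr {e e' : V → List Sym} (q : QF V) (h : q.All fun a => e a = e' a) :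
    q.enc e = q.enc e' := by
  induction q with
  | lt s t | le s t | eq s t | ge s t | gt s t =>
    simp only [enc, s.enc_congr h.1, t.enc_congr h.2]
  | and p q hp hq | or p q hp hq => simp only [enc, hp h.1, hq h.2]
  | not p hp => simp only [enc, hp h]

/-- A valid formula. -/
def verum : QF V := eq (.const 0) (.const 0)

/-- The conjunction of a list of formulas. -/
def conj (l : List (QF V)) : QF V := l.foldr and verum

theorem holds_conj (v : V → ℝ) (l : List (QF V)) : (conj l).Holds v ↔ ∀ q ∈ l, q.Holds v := by
  induction l with
  | nil => simp [conj, verum, Holds]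
  | cons q l ih =>
    rw [List.forall_mem_cons, ← ih]
    rfl

theorem enc_conj (e : V → List Sym) (l : List (QF V)) :
    (conj l).enc e = (l.flatMap fun q => Sym.and :: q.enc e) ++ verum.enc e := by
  induction l with
  | nil => rfl
  | cons q l ih =>
    have : (conj (q :: l)).enc e = Sym.and :: (q.enc e ++ (conj l).enc e) := rfl
    rw [this, ih, List.flatMap_cons, List.cons_append, List.cons_append, List.append_assoc]

end QF

/-- The places of a row of bound variables. Row `i` holds the values of input node `i` on `x` and
on `-x`, the number `|x i|` and the sum of `|x l|` over `l < i`; row `j` also holds the outputs of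
gate `j` on `x` and on `-x`, its operands on both inputs, and its rational constant. The flag is
`true` for the input `-x`. -/
inductive Entry : Type
  | input (σ : Bool)
  | abs
  | partialSum
  | out (σ : Bool)
  | left (σ : Bool)
  | right (σ : Bool)
  | coef

/-- The number of entries of a row. -/
def rowWidth : ℕ := 11

instance : NeZero rowWidth := ⟨by decide⟩

/-- The position of an entry in its row. -/
def Entry.index : Entry → ℕ
  | input σ => σ.toNat
  | abs => 2
  | partialSum => 3
  | out σ => 4 + σ.toNat
  | left σ => 6 + σ.toNat
  | right σ => 8 + σ.toNat
  | coef => 10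

theorem Entry.index_lt (e : Entry) : e.index < rowWidth := by
  cases e with
  | input σ | out σ | left σ | right σ => cases σ <;> decide
  | abs | partialSum | coef => decide

theorem Entry.index_injective : Function.Injective Entry.index := by
  rintro (_ | _ | _ | _ | _ | _ | _) (_ | _ | _ | _ | _ | _ | _) h <;>
    grind [Entry.index, Bool.toNat]

/-- The number of the bound variable for entry `e` of row `j`. -/
def cellIndex (j : ℕ) (e : Entry) : ℕ := rowWidth * j + e.index

theorem cellIndex_lt {N j : ℕ} (hj : j ≤ N) (e : Entry) : cellIndex j e < rowWidth * (N + 1) :=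
  calc rowWidth * j + e.index < rowWidth * (j + 1) := Nat.add_lt_add_left e.index_lt _
    _ ≤ rowWidth * (N + 1) := Nat.mul_le_mul_left _ (Nat.succ_le_succ hj)

theorem cellIndex_injective : Function.Injective fun p : ℕ × Entry => cellIndex p.1 p.2 := by
  rintro ⟨j, e⟩ ⟨j', e'⟩ h
  have hrow (i : ℕ) (f : Entry) : cellIndex i f / rowWidth = i := by
    rw [cellIndex, Nat.mul_add_div (by decide), Nat.div_eq_of_lt f.index_lt, add_zero]
  obtain rfl : j = j' := by rw [← hrow j e, ← hrow j' e']; exact congrArg (· / rowWidth) h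
  exact congrArg (Prod.mk j) (Entry.index_injective (Nat.add_left_cancel h))

/-- The bound variables of the formula: the entries of the rows `0`, …, `N`. -/
abbrev Cell (N : ℕ) : Type := Fin (rowWidth * (N + 1))

/-- Entry `e` of row `j`, for `j ≤ N`; the index wraps around for other rows. -/
def cellVar (N j : ℕ) (e : Entry) : Cell N := Fin.ofNat _ (cellIndex j e)

theorem val_cellVar {N j : ℕ} (hj : j ≤ N) (e : Entry) :
    (cellVar N j e : ℕ) = cellIndex j e :=
  Nat.mod_eq_of_lt (cellIndex_lt hj e)

/-- The rows to which a formula template refers: the row in hand and the row of an operand. -/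
inductive Counter : Type
  | cur
  | arg
  deriving DecidableEq

/-- The assignment of `j` to the row in hand and `r` to the row of the operand. -/
def counters (j r : ℕ) : Counter → ℕ
  | .cur => j
  | .arg => r

/-- Variables of formula templates: a free variable, an entry of the row given by a counter, or an
entry of the row after the row in hand. -/
inductive Hole : Type
  | free
  | cell (κ : Counter) (e : Entry)
  | next (e : Entry)

/-- The variable at a place of a template, from the free variable `y` and the rows `c`. -/
def Hole.var {V : Type} {N : ℕ} (y : V ⊕ Cell N) (c : Counter → ℕ) : Hole → V ⊕ Cell N
  | free => y
  | cell κ e => Sum.inr (cellVar N (c κ) e)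
  | next e => Sum.inr (cellVar N (c .cur + 1) e)

namespace Template

/-- An entry of the row in hand. -/
abbrev own (e : Entry) : Term Hole := .var (.cell .cur e)

/-- An entry of the row of the operand. -/
abbrev other (e : Entry) : Term Hole := .var (.cell .arg e)

/-- The constraints `r` for both of the inputs `x` and `-x`. -/
def twice (r : Bool → QF Hole) : QF Hole := .and (r false) (r true)

/-- The constraints for the entries of an input node. -/
def input : QF Hole :=
  .and (.eq (own (.input false)) (.var .free)) <|
  .and (.eq (own (.input true)) (.sub (.const 0) (.var .free))) <|
  .and (.ge (own .abs) (.const 0)) <|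
  .and (.eq (.mul (own .abs) (own .abs)) (.mul (own (.input false)) (own (.input false)))) <|
  .eq (.var (.next .partialSum)) (.add (own .partialSum) (own .abs))

/-- The partial sum of the row in hand is `z`. -/
def sumIs (z : ℤ) : QF Hole := .eq (own .partialSum) (.const z)

/-- The entries `e` of the row in hand copy the entries `e'` of the row of the operand. -/
def operand (e e' : Bool → Entry) : QF Hole := twice fun σ => .eq (own (e σ)) (other (e' σ))

/-- An output node, with values in the entries `e`, has the same value on `x` and on `-x`. -/
def output (e : Bool → Entry) : QF Hole := .eq (other (e false)) (other (e true))

/-- The output of a gate that computes the term `t` from its operands and its constant. -/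
def outputIs (t : Bool → Term Hole) : QF Hole := twice fun σ => .eq (own (.out σ)) (t σ)

/-- The output of a gate is one of its operands and stands in the relation `r` to both. -/
def selects (r : Term Hole → Term Hole → QF Hole) : QF Hole := twice fun σ =>
  .and (r (own (.out σ)) (own (.left σ))) <| .and (r (own (.out σ)) (own (.right σ))) <|
  .or (.eq (own (.out σ)) (own (.left σ))) (.eq (own (.out σ)) (own (.right σ)))

end Template

namespace Gate

variable {V : Type}

/-- The rational constant of a gate. -/
def scalar : Gate V → Option ℚ
  | const ζ | smul ζ _ => some ζ
  | _ => none

/-- The first operand of an arithmetic gate. -/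
def leftOperand : Gate V → Option V
  | add a _ | sub a _ | smul _ a | mul a _ | max a _ | min a _ => some a
  | _ => none

/-- The second operand of an arithmetic gate. -/
def rightOperand : Gate V → Option V
  | add _ b | sub _ b | mul _ b | max _ b | min _ b => some b
  | _ => none

open Template in
/-- The relation between the output, the operands and the constant of an arithmetic gate. -/
def template : Gate V → QF Hole
  | const _ => outputIs fun _ => own .coef
  | add _ _ => outputIs fun σ => .add (own (.left σ)) (own (.right σ))
  | sub _ _ => outputIs fun σ => .sub (own (.left σ)) (own (.right σ))
  | smul _ _ => outputIs fun σ => .mul (own (.left σ)) (own .coef)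
  | mul _ _ => outputIs fun σ => .mul (own (.left σ)) (own (.right σ))
  | max _ _ => selects .ge
  | min _ _ => selects .le
  | pos _ => .verum

end Gate

section Formula

variable {n k : ℕ}

/-- The row of a node. -/
def nodeRow : Fin n ⊕ Fin k → ℕ
  | Sum.inl i => i
  | Sum.inr j => j

/-- The entry in its row of the value of a node on `x` or `-x`. -/
def nodeEntry : Fin n ⊕ Fin k → Bool → Entry
  | Sum.inl _ => .input
  | Sum.inr _ => .out

/-- The instance of a template without free variables for the rows `j` and `r`. -/
def inst (n N j r : ℕ) (q : QF Hole) : QF (Fin n ⊕ Cell N) :=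
  q.map (Hole.var (Sum.inr 0) (counters j r))

/-- The constraints for input node `i`. -/
def inputFormula (N : ℕ) (i : Fin n) : QF (Fin n ⊕ Cell N) :=
  Template.input.map (Hole.var (Sum.inl i) (counters i 0))

/-- The entries `e` of row `j` are the values of node `a`. -/
def operandFormula (N j : ℕ) (e : Bool → Entry) (a : Fin n ⊕ Fin k) : QF (Fin n ⊕ Cell N) :=
  inst n N j (nodeRow a) (Template.operand e (nodeEntry a))

/-- Node `a` has the same value on `x` and on `-x`. -/
def outputFormula (N : ℕ) (a : Fin n ⊕ Fin k) : QF (Fin n ⊕ Cell N) :=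
  inst n N 0 (nodeRow a) (Template.output (nodeEntry a))

/-- The constant of gate `j` is `ζ`, with the denominator cleared. -/
def scalarFormula (n N j : ℕ) (ζ : ℚ) : QF (Fin n ⊕ Cell N) :=
  .eq (.const ζ.num) (.mul (.var (.inr (cellVar N j .coef))) (.const ζ.den))

/-- The constraints for gate `j`. -/
def gateFormulas (N j : ℕ) (g : Gate (Fin n ⊕ Fin k)) : List (QF (Fin n ⊕ Cell N)) :=
  g.scalar.toList.map (scalarFormula n N j) ++
    (g.leftOperand.toList.map (operandFormula N j .left) ++
      (g.rightOperand.toList.map (operandFormula N j .right) ++ [inst n N j 0 g.template]))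

/-- The constraints which say that `x` lies on the unit sphere of the `L₁` norm, from the last row
to the first. -/
def inputFormulas (n N : ℕ) : List (QF (Fin n ⊕ Cell N)) :=
  inst n N n 0 (Template.sumIs 1) :: ((List.ofFn (inputFormula N)).reverse ++
    [inst n N 0 0 (Template.sumIs 0)])

end Formula

namespace Circuit

variable {n m : ℕ}

/-- The constraints of all nodes and the output constraints of a circuit. -/
def antipodalConstraints (c : Circuit n m) : List (QF (Fin n ⊕ Cell (n + c.size))) :=
  inputFormulas n (n + c.size) ++
    ((List.ofFn c.gate).zipIdx.flatMap (fun p => gateFormulas (n + c.size) p.2 p.1) ++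
      (List.ofFn c.out).map (outputFormula (n + c.size)))

/-- The existential formula which says that `x` lies on the unit sphere of the `L₁` norm and `c` has
the same value at `x` and `-x`. -/
def antipodalFormula (c : Circuit n m) : ExFormula n where
  bound := rowWidth * (n + c.size + 1)
  body := QF.conj c.antipodalConstraints

end Circuit

section Semantics

variable {n k N : ℕ}

/-- The value of entry `e` of row `j`. -/
def cell (z : Cell N → ℝ) (j : ℕ) (e : Entry) : ℝ := z (cellVar N j e)

theorem exists_cell_eq (N : ℕ) (w : ℕ → Entry → ℝ) :
    ∃ z : Cell N → ℝ, ∀ j ≤ N, ∀ e, cell z j e = w j e := by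
  refine ⟨fun t => Function.extend (fun p : ℕ × Entry => cellIndex p.1 p.2)
    (fun p => w p.1 p.2) 0 t, fun j hj e => ?_⟩
  rw [cell, val_cellVar hj]
  exact cellIndex_injective.extend_apply _ _ (j, e)

/-- The value of node `a` on the input `x` or, if `σ` is `true`, on `-x`. -/
def nodeVal (z : Cell N → ℝ) (σ : Bool) (a : Fin n ⊕ Fin k) : ℝ :=
  cell z (nodeRow a) (nodeEntry a σ)

/-- The value at a place of a template, from the value `y` of the free variable and the rows `c`. -/
def Hole.val (y : ℝ) (z : Cell N → ℝ) (c : Counter → ℕ) : Hole → ℝ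
  | free => y
  | .cell κ e => BorsukUlamETR.cell z (c κ) e
  | next e => BorsukUlamETR.cell z (c .cur + 1) e

theorem holds_map_holeVar {V : Type} (x : V → ℝ) (z : Cell N → ℝ) (y : V ⊕ Cell N)
    (c : Counter → ℕ) (q : QF Hole) :
    (q.map (Hole.var y c)).Holds (Sum.elim x z) ↔ q.Holds (Hole.val (Sum.elim x z y) z c) := by
  have : Sum.elim x z ∘ Hole.var y c = Hole.val (Sum.elim x z y) z c := by
    funext h
    cases h <;> rfl
  rw [QF.holds_map, this]

theorem holds_twice (r : Bool → QF Hole) (v : Hole → ℝ) :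
    (Template.twice r).Holds v ↔ ∀ σ, (r σ).Holds v :=
  Bool.forall_bool (p := fun σ => (r σ).Holds v) |>.symm

variable (x : Fin n → ℝ) (z : Cell N → ℝ) (j : ℕ)

theorem holds_sumIs (t : ℤ) :
    (inst n N j 0 (Template.sumIs t)).Holds (Sum.elim x z) ↔ cell z j .partialSum = t :=
  holds_map_holeVar ..

theorem holds_inputFormula (i : Fin n) : (inputFormula N i).Holds (Sum.elim x z) ↔
    cell z i (.input false) = x i ∧ cell z i (.input true) = -x i ∧ cell z i .abs = |x i| ∧
      cell z (i + 1) .partialSum = cell z i .partialSum + cell z i .abs := by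
  rw [inputFormula, holds_map_holeVar]
  simp only [Template.input, QF.Holds, Term.eval, Hole.val, counters, Int.cast_zero, zero_sub,
    Sum.elim_inl]
  refine and_congr_right fun hx => and_congr_right fun _ => ?_
  rw [← and_assoc, hx]
  refine and_congr_left fun _ => ⟨fun ⟨hnonneg, hsq⟩ => ?_, fun h => h ▸ ?_⟩
  · rw [← abs_of_nonneg hnonneg]
    exact abs_eq_abs.2 (mul_self_eq_mul_self_iff.1 hsq)
  · exact ⟨abs_nonneg _, abs_mul_abs_self _⟩

theorem holds_operandFormula (e : Bool → Entry) (a : Fin n ⊕ Fin k) :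
    (operandFormula N j e a).Holds (Sum.elim x z) ↔ ∀ σ, cell z j (e σ) = nodeVal z σ a :=
  (holds_map_holeVar ..).trans (holds_twice ..)

theorem holds_outputFormula (a : Fin n ⊕ Fin k) :
    (outputFormula N a).Holds (Sum.elim x z) ↔ nodeVal z false a = nodeVal z true a :=
  holds_map_holeVar ..

theorem holds_scalarFormula (ζ : ℚ) :
    (scalarFormula n N j ζ).Holds (Sum.elim x z) ↔ cell z j .coef = ζ := by
  have hden : (ζ.den : ℝ) ≠ 0 := Nat.cast_ne_zero.2 ζ.den_nz
  rw [Rat.cast_def, eq_div_iff hden, eq_comm, ← Int.cast_natCast ζ.den]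
  rfl

theorem eq_max_iff {v p q : ℝ} : v = max p q ↔ v ≥ p ∧ v ≥ q ∧ (v = p ∨ v = q) := by
  grind

theorem eq_min_iff {v p q : ℝ} : v = min p q ↔ v ≤ p ∧ v ≤ q ∧ (v = p ∨ v = q) := by
  grind

theorem holds_gateFormulas_iff {g : Gate (Fin n ⊕ Fin k)} (hg : g.IsArithmetic) :
    (∀ q ∈ gateFormulas N j g, q.Holds (Sum.elim x z)) ↔
      (∀ ζ ∈ g.scalar, cell z j .coef = ζ) ∧
      (∀ a ∈ g.leftOperand, ∀ σ, cell z j (.left σ) = nodeVal z σ a) ∧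
      (∀ a ∈ g.rightOperand, ∀ σ, cell z j (.right σ) = nodeVal z σ a) ∧
      ∀ σ, cell z j (.out σ) = g.eval (nodeVal z σ) := by
  simp only [gateFormulas, List.forall_mem_append, List.forall_mem_map, Option.mem_toList,
    List.forall_mem_singleton, holds_scalarFormula, holds_operandFormula, inst, holds_map_holeVar]
  refine and_congr_right fun hs => and_congr_right fun hl => and_congr_right fun hr => ?_
  cases g with
  | pos => exact hg.elim
  | const | add | sub | smul | mul | max | min =>
    simp only [Gate.scalar, Gate.leftOperand, Gate.rightOperand, Option.some.injEq,
      forall_eq', reduceCtorEq, false_implies, implies_true] at hs hl hr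
    simp only [Gate.template, Template.outputIs, Template.selects, holds_twice, QF.Holds,
      Term.eval, Hole.val, counters, ← eq_max_iff, ← eq_min_iff, hs, hl, hr, Gate.eval]

end Semantics

theorem Gate.continuous_eval {V X : Type} [TopologicalSpace X]
    {v : X → V → ℝ} {g : Gate V} (hg : g.IsArithmetic)
    (hv : ∀ a ∈ g.operands, Continuous fun x => v x a) : Continuous fun x => g.eval (v x) := by
  cases g with
  | pos a => exact hg.elim
  | const ζ => exact continuous_const
  | smul ζ a => exact (hv a (by simp [Gate.operands])).mul continuous_const
  | add a b | sub a b | mul a b | max a b | min a b =>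
    have ha := hv a (by simp [Gate.operands])
    have hb := hv b (by simp [Gate.operands])
    simp only [Gate.eval]
    fun_prop

namespace Circuit

variable {n m : ℕ}

theorem value_isValuation (c : Circuit n m) (x : Fin n → ℝ) : c.IsValuation x (c.value x) :=
  (c.existsUnique_isValuation x).choose_spec.1

theorem IsValuation.eq_value {c : Circuit n m} {x : Fin n → ℝ} {v : Fin n ⊕ Fin c.size → ℝ}
    (h : c.IsValuation x v) : v = c.value x :=
  (c.existsUnique_isValuation x).unique h (c.value_isValuation x)

/-- The input `x` or, if the flag is `true`, its antipode `-x`. -/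
def signed (x : Fin n → ℝ) : Bool → Fin n → ℝ
  | false => x
  | true => -x

theorem holds_antipodalConstraints_iff (c : Circuit n m) (x : Fin n → ℝ)
    (z : Cell (n + c.size) → ℝ) :
    (∀ q ∈ c.antipodalConstraints, q.Holds (Sum.elim x z)) ↔
      (cell z n .partialSum = 1 ∧
        (∀ i, (inputFormula (n + c.size) i).Holds (Sum.elim x z)) ∧
        cell z 0 .partialSum = 0) ∧
      (∀ j : Fin c.size, ∀ q ∈ gateFormulas (n + c.size) j (c.gate j),
        q.Holds (Sum.elim x z)) ∧
      ∀ i, nodeVal z false (c.out i) = nodeVal z true (c.out i) := by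
  have hgates : (List.ofFn c.gate).zipIdx = List.ofFn fun j => (c.gate j, (j : ℕ)) :=
    List.ext_getElem (by simp) (by simp)
  simp only [antipodalConstraints, inputFormulas, List.cons_append, List.forall_mem_cons,
    List.forall_mem_append, List.mem_reverse, List.forall_mem_map, List.forall_mem_flatMap,
    hgates, List.forall_mem_ofFn_iff, List.not_mem_nil, false_implies, implies_true, true_and,
    holds_sumIs, holds_outputFormula, Int.cast_one, Int.cast_zero, and_assoc]

theorem partialSum_eq_sum {c : Circuit n m} {x : Fin n → ℝ} {z : Cell (n + c.size) → ℝ}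
    (hzero : cell z 0 .partialSum = 0)
    (hinput : ∀ i, (inputFormula (n + c.size) i).Holds (Sum.elim x z)) :
    cell z n .partialSum = ∑ i, |x i| := by
  simp only [holds_inputFormula] at hinput
  have hstep : ∀ l ≤ n, cell z l .partialSum = ∑ i ∈ Finset.range l, cell z i .abs := by
    intro l hl
    induction l with
    | zero => simpa using hzero
    | succ l ih =>
      rw [Finset.sum_range_succ, ← ih (by omega)]
      exact (hinput ⟨l, hl⟩).2.2.2
  rw [hstep n le_rfl, ← Fin.sum_univ_eq_sum_range (fun i => cell z i .abs) n]
  exact Finset.sum_congr rfl fun i _ => (hinput i).2.2.1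

theorem nodeVal_eq_value {c : Circuit n m} (hc : c.IsArithmetic) {x : Fin n → ℝ}
    {z : Cell (n + c.size) → ℝ}
    (hinput : ∀ i, (inputFormula (n + c.size) i).Holds (Sum.elim x z))
    (hgate : ∀ j : Fin c.size, ∀ q ∈ gateFormulas (n + c.size) j (c.gate j),
      q.Holds (Sum.elim x z))
    (σ : Bool) : nodeVal z σ = c.value (signed x σ) := by
  simp only [holds_inputFormula] at hinput
  refine IsValuation.eq_value ⟨fun i => ?_, fun j =>
    ((holds_gateFormulas_iff x z j (hc j)).1 (hgate j)).2.2.2 σ⟩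
  cases σ with
  | false => exact (hinput i).1
  | true => exact (hinput i).2.1

/-- The values of the bound variables which witness the formula. Only the partial sums are used in
rows beyond those of the nodes. -/
noncomputable def witness (c : Circuit n m) (x : Fin n → ℝ) (j : ℕ) : Entry → ℝ
  | .input σ => if h : j < n then signed x σ ⟨j, h⟩ else 0
  | .abs => if h : j < n then |x ⟨j, h⟩| else 0
  | .partialSum => ∑ i ∈ Finset.range j, if h : i < n then |x ⟨i, h⟩| else 0
  | .out σ => if h : j < c.size then c.value (signed x σ) (.inr ⟨j, h⟩) else 0
  | .left σ =>
    if h : j < c.size then (c.gate ⟨j, h⟩).leftOperand.elim 0 (c.value (signed x σ)) else 0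
  | .right σ =>
    if h : j < c.size then (c.gate ⟨j, h⟩).rightOperand.elim 0 (c.value (signed x σ)) else 0
  | .coef => if h : j < c.size then (c.gate ⟨j, h⟩).scalar.elim 0 (↑) else 0

section Witness

variable {c : Circuit n m} {x : Fin n → ℝ} {z : Cell (n + c.size) → ℝ}

theorem nodeVal_of_cell_eq_witness
    (hz : ∀ j ≤ n + c.size, ∀ e, cell z j e = c.witness x j e) (σ : Bool) :
    nodeVal z σ = c.value (signed x σ) := by
  funext a
  cases a with
  | inl i =>
    rw [(c.value_isValuation _).1]
    simp [nodeVal, nodeRow, nodeEntry, hz i (by omega), witness]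
  | inr j => simp [nodeVal, nodeRow, nodeEntry, hz j (by omega), witness]

theorem holds_inputFormula_of_cell_eq_witness
    (hz : ∀ j ≤ n + c.size, ∀ e, cell z j e = c.witness x j e) (i : Fin n) :
    (inputFormula (n + c.size) i).Holds (Sum.elim x z) := by
  rw [holds_inputFormula]
  simp [hz i (by omega), hz (i + 1) (by omega), witness, signed, Finset.sum_range_succ]

theorem holds_gateFormulas_of_cell_eq_witness
    (hz : ∀ j ≤ n + c.size, ∀ e, cell z j e = c.witness x j e) (hc : c.IsArithmetic)
    (j : Fin c.size) :
    ∀ q ∈ gateFormulas (n + c.size) j (c.gate j), q.Holds (Sum.elim x z) := by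
  rw [holds_gateFormulas_iff x z j (hc j)]
  simp only [nodeVal_of_cell_eq_witness hz, hz j (by omega), witness, j.isLt, dif_pos]
  refine ⟨fun ζ hζ => ?_, fun a ha σ => ?_, fun a ha σ => ?_, fun σ => ?_⟩
  · rw [Option.mem_def.1 hζ, Option.elim_some]
  · rw [Option.mem_def.1 ha, Option.elim_some]
  · rw [Option.mem_def.1 ha, Option.elim_some]
  · exact (c.value_isValuation _).2 j

end Witness

theorem antipodalFormula_holds_iff (c : Circuit n m) (hc : c.IsArithmetic) (x : Fin n → ℝ) :
    c.antipodalFormula.Holds x ↔ ∑ i, |x i| = 1 ∧ c.eval x = c.eval (-x) := by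
  simp only [ExFormula.Holds, antipodalFormula, QF.holds_conj]
  constructor
  · rintro ⟨z, hz⟩
    obtain ⟨⟨hone, hinput, hzero⟩, hgate, hout⟩ := (c.holds_antipodalConstraints_iff x z).1 hz
    refine ⟨(partialSum_eq_sum hzero hinput).symm.trans hone, funext fun i => ?_⟩
    have houti := hout i
    rwa [nodeVal_eq_value hc hinput hgate, nodeVal_eq_value hc hinput hgate] at houti
  · rintro ⟨hsum, heval⟩
    obtain ⟨z, hz⟩ := exists_cell_eq (n + c.size) (c.witness x)
    have hinput := holds_inputFormula_of_cell_eq_witness hz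
    have hzero : cell z 0 .partialSum = 0 := by simp [hz, witness]
    refine ⟨z, (c.holds_antipodalConstraints_iff x z).2 ⟨⟨?_, hinput, hzero⟩,
      holds_gateFormulas_of_cell_eq_witness hz hc, fun i => ?_⟩⟩
    · exact (partialSum_eq_sum hzero hinput).trans hsum
    · rw [nodeVal_of_cell_eq_witness hz, nodeVal_of_cell_eq_witness hz]
      exact congrFun heval i

theorem continuous_value {c : Circuit n m} (hc : c.IsArithmetic) (a : Fin n ⊕ Fin c.size) :
    Continuous fun x => c.value x a := by
  have hinput (i : Fin n) : Continuous fun x => c.value x (.inl i) := by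
    simp_rw [(c.value_isValuation _).1]
    exact continuous_apply i
  cases a with
  | inl i => exact hinput i
  | inr j =>
    induction j using c.wellFounded.induction with
    | _ j ih =>
      simp_rw [(c.value_isValuation _).2]
      refine Gate.continuous_eval (hc j) fun a ha => ?_
      cases a with
      | inl i => exact hinput i
      | inr l => exact ih l ha

theorem continuous_eval {c : Circuit n m} (hc : c.IsArithmetic) : Continuous c.eval :=
  continuous_pi fun i => continuous_value hc (c.out i)

end Circuit

/-! ### Running times of programs -/

section Runs

variable {K A : Type} [DecidableEq K]

/-- The program `p` transforms the stacks `s` into `s'` in at most `T` steps. -/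
def Runs (p : Prog K A) (s s' : K → List A) (T : ℕ) : Prop := ∃ n ≤ T, Run p s n s'

theorem Runs.mono {p : Prog K A} {s s' : K → List A} {T T' : ℕ} (h : Runs p s s' T) (hT : T ≤ T') :
    Runs p s s' T' :=
  h.imp fun _ h => ⟨h.1.trans hT, h.2⟩

theorem Runs.skip (s : K → List A) : Runs .skip s s 0 := ⟨0, le_rfl, .skip s⟩

theorem Runs.push (k : K) (a : A) (s : K → List A) :
    Runs (.push k a) s (Function.update s k (a :: s k)) 1 := ⟨1, le_rfl, .push k a s⟩

theorem Runs.seq {p q : Prog K A} {s s' s'' : K → List A} {T T' : ℕ} (hp : Runs p s s' T)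
    (hq : Runs q s' s'' T') : Runs (.seq p q) s s'' (T + T') := by
  obtain ⟨m, hm, hp⟩ := hp
  obtain ⟨n, hn, hq⟩ := hq
  exact ⟨m + n, Nat.add_le_add hm hn, hp.seq hq⟩

theorem Runs.last {k : K} {body : Option A → Prog K A} {again : Option A → Bool}
    {s s' : K → List A} {T : ℕ} (hagain : again (s k).head? = false)
    (hbody : Runs (body (s k).head?) (Function.update s k (s k).tail) s' T) :
    Runs (.loop k body again) s s' (T + 1) := by
  obtain ⟨n, hn, hbody⟩ := hbody
  exact ⟨n + 1, Nat.succ_le_succ hn, .last hagain hbody⟩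

theorem Runs.next {k : K} {body : Option A → Prog K A} {again : Option A → Bool}
    {s s' s'' : K → List A} {T T' : ℕ} (hagain : again (s k).head? = true)
    (hbody : Runs (body (s k).head?) (Function.update s k (s k).tail) s' T)
    (hloop : Runs (.loop k body again) s' s'' T') :
    Runs (.loop k body again) s s'' (T + T' + 1) := by
  obtain ⟨m, hm, hbody⟩ := hbody
  obtain ⟨n, hn, hloop⟩ := hloop
  exact ⟨m + n + 1, by omega, .next hagain hbody hloop⟩

theorem Run.length_le {p : Prog K A} {s s' : K → List A} {T : ℕ} (h : Run p s T s') (k : K) :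
    (s' k).length ≤ (s k).length + T := by
  have hpop (k' : K) (s : K → List A) :
      (Function.update s k' (s k').tail k).length ≤ (s k).length := by
    rcases eq_or_ne k k' with rfl | hk
    · simp
    · simp [hk]
  induction h with
  | skip s => exact le_rfl
  | push k' a s =>
    rcases eq_or_ne k k' with rfl | hk
    · simp
    · simp [hk]
  | seq _ _ hp hq => omega
  | last _ _ hbody =>
    have := hbody.trans (Nat.add_le_add_right (hpop _ _) _)
    omega
  | next _ _ _ hbody hloop =>
    have := hbody.trans (Nat.add_le_add_right (hpop _ _) _)
    omega

/-- Run `p a` for all symbols `a` popped from the stack `k`, until it is empty. -/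
def Prog.forEach (k : K) (p : A → Prog K A) : Prog K A :=
  .loop k (fun o => o.elim .skip p) Option.isSome

theorem Runs.forEach_nil {k : K} {p : A → Prog K A} {s : K → List A} (hk : s k = []) :
    Runs (.forEach k p) s s 1 := by
  have hpop : Function.update s k (s k).tail = s := by
    rw [hk, List.tail_nil, ← hk, Function.update_eq_self]
  refine Runs.last (T := 0) (by simp [hk]) ?_
  rw [hpop, hk]
  exact Runs.skip _

theorem Runs.forEach_cons {k : K} {p : A → Prog K A} {s s' s'' : K → List A} {a : A} {l : List A}
    {T T' : ℕ} (hk : s k = a :: l) (hbody : Runs (p a) (Function.update s k l) s' T)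
    (hloop : Runs (.forEach k p) s' s'' T') : Runs (.forEach k p) s s'' (T + T' + 1) := by
  refine Runs.next (by simp [hk]) ?_ hloop
  rw [hk]
  exact hbody

end Runs

/-! ### Transducers -/

/-- The stacks of the program that writes the formula: input, output in reverse order, output,
scratch, and counters in unary. -/
inductive Reg : Type
  | inp | acc | out | tmp
  | ctr (κ : Counter)
  deriving DecidableEq

instance : Fintype Reg where
  elems := {.inp, .acc, .out, .tmp, .ctr .cur, .ctr .arg}
  complete
    | .inp | .acc | .out | .tmp | .ctr .cur | .ctr .arg => by decide

/-- The number `n` in unary, without the separator. -/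
def ones (n : ℕ) : List Sym := List.replicate n .one

theorem ones_add (m n : ℕ) : ones (m + n) = ones m ++ ones n := List.replicate_add m n _

theorem encUnary_add (m n : ℕ) : encUnary (m + n) = ones m ++ encUnary n := by
  induction m with
  | zero => rw [Nat.zero_add]; rfl
  | succ m ih => rw [Nat.add_right_comm, encUnary, ih]; rfl

theorem ones_reverse (n : ℕ) : (ones n).reverse = ones n := List.reverse_replicate

theorem length_ones (n : ℕ) : (ones n).length = n := List.length_replicate

theorem ones_append_cons (n : ℕ) (l : List Sym) : ones n ++ .one :: l = ones (n + 1) ++ l := by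
  rw [ones_add, List.append_assoc]
  rfl

theorem length_encUnary (n : ℕ) : (encUnary n).length = n + 1 := by
  rw [← add_zero n, encUnary_add, List.length_append, length_ones]
  rfl

/-- The stacks with given contents. -/
def stk (i a o t : List Sym) (c : Counter → ℕ) : Reg → List Sym
  | .inp => i
  | .acc => a
  | .out => o
  | .tmp => t
  | .ctr κ => ones (c κ)

section Update

variable (i a o t l : List Sym) (c : Counter → ℕ)

theorem update_stk_inp : Function.update (stk i a o t c) .inp l = stk l a o t c := by
  funext k; cases k <;> rfl

theorem update_stk_acc : Function.update (stk i a o t c) .acc l = stk i l o t c := by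
  funext k; cases k <;> rfl

theorem update_stk_out : Function.update (stk i a o t c) .out l = stk i a l t c := by
  funext k; cases k <;> rfl

theorem update_stk_tmp : Function.update (stk i a o t c) .tmp l = stk i a o l c := by
  funext k; cases k <;> rfl

theorem update_stk_ctr (κ : Counter) (n : ℕ) :
    Function.update (stk i a o t c) (.ctr κ) (ones n) = stk i a o t (Function.update c κ n) := by
  funext k
  cases k with
  | ctr κ' =>
    rcases eq_or_ne κ' κ with rfl | hκ
    · simp [stk]
    · simp [stk, hκ]
  | _ => rfl

theorem update_counters_cur (j r j' : ℕ) :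
    Function.update (counters j r) .cur j' = counters j' r := by
  funext κ; cases κ <;> rfl

theorem update_counters_arg (j r r' : ℕ) :
    Function.update (counters j r) .arg r' = counters j r' := by
  funext κ; cases κ <;> rfl

end Update

/-- The program `p` reads `u`, writes `w`, and changes the counters from `c` to `c'`, in at most `T`
steps. -/
def Transduces (p : Prog Reg Sym) (u w : List Sym) (c c' : Counter → ℕ) (T : ℕ) : Prop :=
  ∀ i a o, Runs p (stk (u ++ i) a o [] c) (stk i (w.reverse ++ a) o [] c') T

namespace Prog

/-- Write the string `w`. -/
def write : List Sym → Prog Reg Sym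
  | [] => skip
  | a :: w => seq (push .acc a) (write w)

/-- Write `m` ones for each one on the counter `κ`, which is restored from the scratch stack. -/
def writeOnes (κ : Counter) (m : ℕ) : Prog Reg Sym :=
  seq (forEach (.ctr κ) fun _ => seq (push .tmp .one) (write (ones m)))
    (forEach .tmp fun _ => push (.ctr κ) .one)

/-- Read a number in unary and add it to the counter `κ`. -/
def readUnary (κ : Counter) : Prog Reg Sym :=
  loop .inp (fun o => if o = some .one then push (.ctr κ) .one else skip) fun o => o = some .one

/-- Skip a number in unary. -/
def skipUnary : Prog Reg Sym := loop .inp (fun _ => skip) fun o => o = some .one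

/-- Copy the input to the output up to the next separator. -/
def copyToSep : Prog Reg Sym :=
  loop .inp (fun o => o.elim skip (push .acc)) fun o => o ≠ some .sep

/-- Set the counter `κ` to zero. -/
def clear (κ : Counter) : Prog Reg Sym := forEach (.ctr κ) fun _ => skip

/-- Read a symbol and run the program for this symbol. -/
def read (p : Sym → Prog Reg Sym) : Prog Reg Sym :=
  loop .inp (fun o => o.elim skip p) fun _ => false

end Prog

theorem runs_push_acc (x : Sym) (i a o t : List Sym) (c : Counter → ℕ) :
    Runs (.push .acc x) (stk i a o t c) (stk i (x :: a) o t c) 1 := by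
  have h := Runs.push .acc x (stk i a o t c)
  rwa [update_stk_acc] at h

theorem runs_push_tmp (x : Sym) (i a o t : List Sym) (c : Counter → ℕ) :
    Runs (.push .tmp x) (stk i a o t c) (stk i a o (x :: t) c) 1 := by
  have h := Runs.push .tmp x (stk i a o t c)
  rwa [update_stk_tmp] at h

theorem runs_push_ctr (κ : Counter) (i a o t : List Sym) (c : Counter → ℕ) :
    Runs (.push (.ctr κ) .one) (stk i a o t c)
      (stk i a o t (Function.update c κ (c κ + 1))) 1 := by
  have h := Runs.push (.ctr κ) .one (stk i a o t c)
  rwa [show Sym.one :: stk i a o t c (.ctr κ) = ones (c κ + 1) from rfl, update_stk_ctr] at h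

theorem runs_write (w i a o t : List Sym) (c : Counter → ℕ) :
    Runs (.write w) (stk i a o t c) (stk i (w.reverse ++ a) o t c) w.length := by
  induction w generalizing a with
  | nil => exact Runs.skip _
  | cons x w ih =>
    rw [List.reverse_cons, List.append_assoc]
    exact ((runs_push_acc x ..).seq (ih _)).mono (by simp [Nat.add_comm])

theorem runs_copy_ctr (κ : Counter) (m n : ℕ) (i a o t : List Sym) (c : Counter → ℕ) :
    Runs (.forEach (.ctr κ) fun _ => .seq (.push .tmp .one) (.write (ones m)))
      (stk i a o t (Function.update c κ n))
      (stk i (ones (m * n) ++ a) o (ones n ++ t) (Function.update c κ 0)) (n * (m + 2) + 1) := by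
  induction n generalizing a t with
  | zero => exact (Runs.forEach_nil (by simp [stk, ones])).mono (by omega)
  | succ n ih =>
    have hbody := (runs_push_tmp .one i a o t (Function.update c κ n)).seq (runs_write (ones m) ..)
    have hloop := ih (ones m ++ a) (.one :: t)
    rw [ones_reverse, length_ones] at hbody
    rw [ones_append_cons, ← List.append_assoc, ← ones_add, ← Nat.mul_succ] at hloop
    have hpop : stk i a o t (Function.update c κ (n + 1)) (.ctr κ) = .one :: ones n := by
      simp [stk, ones, List.replicate_succ]
    refine (Runs.forEach_cons (T := 1 + m) hpop ?_ hloop).mono (le_of_eq (by ring))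
    rwa [update_stk_ctr, Function.update_idem]

theorem runs_restore_ctr (κ : Counter) (n : ℕ) (i a o : List Sym) (c : Counter → ℕ) :
    Runs (.forEach .tmp fun _ => .push (.ctr κ) .one) (stk i a o (ones n) c)
      (stk i a o [] (Function.update c κ (c κ + n))) (n * 2 + 1) := by
  induction n generalizing c with
  | zero =>
    rw [Nat.add_zero, Function.update_eq_self]
    exact Runs.forEach_nil rfl
  | succ n ih =>
    have hloop := ih (Function.update c κ (c κ + 1))
    rw [Function.update_idem, Function.update_self, Nat.add_right_comm] at hloop
    have hpop : stk i a o (ones (n + 1)) c .tmp = .one :: ones n := rfl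
    refine (Runs.forEach_cons (T := 1) hpop ?_ hloop).mono (by omega)
    rw [update_stk_tmp]
    exact runs_push_ctr ..

theorem runs_move_acc (i a o t : List Sym) (c : Counter → ℕ) :
    Runs (.forEach .acc (.push .out)) (stk i a o t c) (stk i [] (a.reverse ++ o) t c)
      (2 * a.length + 1) := by
  induction a generalizing o with
  | nil => exact Runs.forEach_nil rfl
  | cons x a ih =>
    rw [List.reverse_cons, List.append_assoc, List.length_cons]
    have hpop : stk i (x :: a) o t c .acc = x :: a := rfl
    refine (Runs.forEach_cons (T := 1) hpop ?_ (ih (x :: o))).mono (by omega)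
    have h := Runs.push .out x (stk i a o t c)
    rwa [update_stk_out, ← update_stk_acc i (x :: a)] at h

namespace Transduces

variable {p q : Prog Reg Sym} {u w u' w' : List Sym} {c c' c'' : Counter → ℕ} {T T' : ℕ}

theorem mono (h : Transduces p u w c c' T) (hT : T ≤ T') : Transduces p u w c c' T' :=
  fun i a o => (h i a o).mono hT

theorem seq (hp : Transduces p u w c c' T) (hq : Transduces q u' w' c' c'' T') :
    Transduces (.seq p q) (u ++ u') (w ++ w') c c'' (T + T') := by
  intro i a o
  rw [List.append_assoc, List.reverse_append, List.append_assoc]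
  exact (hp _ a o).seq (hq i _ o)

theorem skip : Transduces .skip [] [] c c 0 := fun _ _ _ => Runs.skip _

theorem write (w : List Sym) : Transduces (.write w) [] w c c w.length :=
  fun _ _ _ => runs_write ..

theorem push_ctr (κ : Counter) :
    Transduces (.push (.ctr κ) .one) [] [] c (Function.update c κ (c κ + 1)) 1 :=
  fun _ _ _ => runs_push_ctr ..

theorem writeOnes (κ : Counter) (m : ℕ) :
    Transduces (.writeOnes κ m) [] (ones (m * c κ)) c c ((m + 4) * (c κ + 1)) := by
  intro i a o
  have hcopy := runs_copy_ctr κ m (c κ) i a o [] c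
  have hrestore := runs_restore_ctr κ (c κ) i (ones (m * c κ) ++ a) o (Function.update c κ 0)
  rw [Function.update_eq_self, List.append_nil] at hcopy
  rw [Function.update_idem, Function.update_self, Nat.zero_add, Function.update_eq_self] at hrestore
  rw [ones_reverse]
  exact (hcopy.seq hrestore).mono (by nlinarith)

theorem clear (κ : Counter) :
    Transduces (.clear κ) [] [] c (Function.update c κ 0) (c κ + 1) := by
  suffices ∀ n, Transduces (.clear κ) [] [] (Function.update c κ n) (Function.update c κ 0)
      (n + 1) by
    simpa using this (c κ)
  intro n i a o
  induction n with
  | zero => exact Runs.forEach_nil (by simp [stk, ones])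
  | succ n ih =>
    have hpop : stk i a o [] (Function.update c κ (n + 1)) (.ctr κ) = .one :: ones n := by
      simp [stk, ones, List.replicate_succ]
    refine (Runs.forEach_cons (T := 0) hpop ?_ ih).mono (by omega)
    rw [update_stk_ctr, Function.update_idem]
    exact Runs.skip _

theorem readUnary (κ : Counter) (n : ℕ) :
    Transduces (.readUnary κ) (encUnary n) [] c (Function.update c κ (c κ + n)) (2 * n + 1) := by
  intro i a o
  induction n generalizing c with
  | zero =>
    refine Runs.last (T := 0) rfl ?_
    rw [Nat.add_zero, Function.update_eq_self, update_stk_inp]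
    exact Runs.skip _
  | succ n ih =>
    have hloop := ih (c := Function.update c κ (c κ + 1))
    rw [Function.update_idem, Function.update_self, Nat.add_right_comm] at hloop
    refine (Runs.next (T := 1) rfl ?_ hloop).mono (by omega)
    rw [update_stk_inp]
    exact runs_push_ctr ..

theorem skipUnary (n : ℕ) : Transduces .skipUnary (encUnary n) [] c c (n + 1) := by
  intro i a o
  induction n with
  | zero =>
    refine Runs.last (T := 0) rfl ?_
    rw [update_stk_inp]
    exact Runs.skip _
  | succ n ih =>
    refine (Runs.next (T := 0) rfl ?_ ih).mono (by omega)
    rw [update_stk_inp]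
    exact Runs.skip _

theorem copyToSep_cons {x : Sym} (hx : x ≠ .sep) (h : Transduces .copyToSep u u c c T) :
    Transduces .copyToSep (x :: u) (x :: u) c c (T + 2) := by
  intro i a o
  rw [List.reverse_cons, List.append_assoc]
  refine (Runs.next (T := 1) (by simpa [stk] using hx) ?_ (h i (x :: a) o)).mono (by omega)
  rw [update_stk_inp]
  exact runs_push_acc ..

theorem copyToSep_encBits (l : List Bool) :
    Transduces .copyToSep (encBits l) (encBits l) c c (2 * (encBits l).length) := by
  induction l with
  | nil =>
    intro i a o
    refine Runs.last (T := 1) rfl ?_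
    rw [update_stk_inp]
    exact runs_push_acc ..
  | cons b l ih => exact copyToSep_cons (by cases b <;> simp) ih

theorem copyToSep_encInt (z : ℤ) :
    Transduces .copyToSep (encInt z) (encInt z) c c (2 * (encInt z).length) :=
  copyToSep_cons (by split_ifs <;> simp) (copyToSep_encBits _)

theorem read {f : Sym → Prog Reg Sym} {x : Sym} (h : Transduces (f x) u w c c' T) :
    Transduces (.read f) (x :: u) w c c' (T + 1) := by
  intro i a o
  refine Runs.last rfl ?_
  rw [update_stk_inp]
  exact h i a o

end Transduces

/-- The passes of the loop `Prog.forEach .inp f` through the part `u` of the input write `w` and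
change the counters from `c` to `c'`, in at most `T` steps. -/
def Passes (f : Sym → Prog Reg Sym) (u w : List Sym) (c c' : Counter → ℕ) (T : ℕ) : Prop :=
  ∀ i a o s T', Runs (.forEach .inp f) (stk i (w.reverse ++ a) o [] c') s T' →
    Runs (.forEach .inp f) (stk (u ++ i) a o [] c) s (T + T')

namespace Passes

variable {f : Sym → Prog Reg Sym} {u w u' w' : List Sym} {c c' c'' : Counter → ℕ} {T T' : ℕ}

theorem nil : Passes f [] [] c c 0 := fun _ _ _ _ T' h => by rwa [Nat.zero_add]

theorem of_transduces {x : Sym} (h : Transduces (f x) u w c c' T) :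
    Passes f (x :: u) w c c' (T + 1) := by
  intro i a o s T' hloop
  have hpop : stk (x :: u ++ i) a o [] c .inp = x :: (u ++ i) := rfl
  refine (Runs.forEach_cons (T := T) hpop ?_ hloop).mono (by omega)
  rw [update_stk_inp]
  exact h i a o

theorem append (h : Passes f u w c c' T) (h' : Passes f u' w' c' c'' T') :
    Passes f (u ++ u') (w ++ w') c c'' (T + T') := by
  intro i a o s T₀ hloop
  rw [List.reverse_append, List.append_assoc] at hloop
  rw [List.append_assoc, Nat.add_assoc]
  exact h _ _ _ _ _ (h' _ _ _ _ _ hloop)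

theorem mono (h : Passes f u w c c' T) (hT : T ≤ T') : Passes f u w c c' T' :=
  fun i a o s T₀ hloop => (h i a o s T₀ hloop).mono (Nat.add_le_add_right hT T₀)

theorem runs (h : Passes f u w c c' T) (a o : List Sym) :
    Runs (.forEach .inp f) (stk u a o [] c) (stk [] (w.reverse ++ a) o [] c') (T + 1) := by
  simpa using h [] a o _ 1 (Runs.forEach_nil rfl)

end Passes

/-! ### Writing the constraints -/

/-- The name of the variable at a place of a template for the rows `c`, where the free variable is
that of the row in hand. -/
def holeEnc (c : Counter → ℕ) : Hole → List Sym
  | .free => Sym.left :: encUnary (c .cur)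
  | .cell κ e => Sym.right :: encUnary (cellIndex (c κ) e)
  | .next e => Sym.right :: encUnary (cellIndex (c .cur + 1) e)

/-- A formula as a member of a conjunction. -/
def QF.item {n b : ℕ} (q : QF (Fin n ⊕ Fin b)) : List Sym := Sym.and :: q.enc encName

/-- The instance of a template for the rows `c` as a member of a conjunction. -/
def Template.item (c : Counter → ℕ) (q : QF Hole) : List Sym := Sym.and :: q.enc (holeEnc c)

/-- The program `p` writes `w c` if the counters are `c`, in time linear in the counters. -/
def Writes (p : Prog Reg Sym) (w : (Counter → ℕ) → List Sym) : Prop :=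
  ∃ C, ∀ B c, (∀ κ, c κ ≤ B) → Transduces p [] (w c) c c (C * (B + 1))

theorem Writes.seq {p q : Prog Reg Sym} {v w : (Counter → ℕ) → List Sym} (hp : Writes p v)
    (hq : Writes q w) : Writes (.seq p q) fun c => v c ++ w c := by
  obtain ⟨C, hC⟩ := hp
  obtain ⟨D, hD⟩ := hq
  exact ⟨C + D, fun B c hc => ((hC B c hc).seq (hD B c hc)).mono (le_of_eq (by ring))⟩

theorem Writes.congr {p : Prog Reg Sym} {v w : (Counter → ℕ) → List Sym} (hp : Writes p v)
    (h : ∀ c, w c = v c) : Writes p w := (funext h : w = v) ▸ hp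

theorem writes_write (w : List Sym) : Writes (.write w) fun _ => w :=
  ⟨w.length, fun B _ _ => (Transduces.write w).mono (Nat.le_mul_of_pos_right _ B.succ_pos)⟩

theorem writes_writeOnes (κ : Counter) (m : ℕ) : Writes (.writeOnes κ m) fun c => ones (m * c κ) :=
  ⟨m + 4, fun _ _ hc => (Transduces.writeOnes κ m).mono
    (Nat.mul_le_mul_left _ (Nat.succ_le_succ (hc κ)))⟩

namespace Prog

/-- Write the name of the variable at a place of a template. -/
def writeHole : Hole → Prog Reg Sym
  | .free => seq (write [.left]) (seq (writeOnes .cur 1) (write (encUnary 0)))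
  | .cell κ e => seq (write [.right]) (seq (writeOnes κ rowWidth) (write (encUnary e.index)))
  | .next e =>
    seq (write [.right]) (seq (writeOnes .cur rowWidth) (write (encUnary (rowWidth + e.index))))

/-- Write the instance of a term. -/
def writeTerm : Term Hole → Prog Reg Sym
  | .var h => seq (write [.var]) (writeHole h)
  | .const z => write (.const :: encInt z)
  | .add s t => seq (write [.add]) (seq (writeTerm s) (writeTerm t))
  | .sub s t => seq (write [.sub]) (seq (writeTerm s) (writeTerm t))
  | .mul s t => seq (write [.mul]) (seq (writeTerm s) (writeTerm t))

/-- Write the instance of a template. -/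
def writeQF : QF Hole → Prog Reg Sym
  | .lt s t => seq (write [.lt]) (seq (writeTerm s) (writeTerm t))
  | .le s t => seq (write [.le]) (seq (writeTerm s) (writeTerm t))
  | .eq s t => seq (write [.eq]) (seq (writeTerm s) (writeTerm t))
  | .ge s t => seq (write [.ge]) (seq (writeTerm s) (writeTerm t))
  | .gt s t => seq (write [.gt]) (seq (writeTerm s) (writeTerm t))
  | .and p q => seq (write [.and]) (seq (writeQF p) (writeQF q))
  | .or p q => seq (write [.or]) (seq (writeQF p) (writeQF q))
  | .not p => seq (write [.not]) (writeQF p)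

/-- Write the instance of a template as a member of a conjunction. -/
def writeItem (q : QF Hole) : Prog Reg Sym := seq (write [.and]) (writeQF q)

end Prog

theorem writes_writeHole (h : Hole) : Writes (.writeHole h) fun c => holeEnc c h := by
  have hname (s : Sym) (κ : Counter) (m r : ℕ) :
      Writes (.seq (.write [s]) (.seq (.writeOnes κ m) (.write (encUnary r)))) fun c =>
        s :: encUnary (m * c κ + r) :=
    ((writes_write [s]).seq ((writes_writeOnes κ m).seq (writes_write _))).congr fun c =>
      congrArg (s :: ·) (encUnary_add ..)
  cases h with
  | free => exact (hname ..).congr fun c => by rw [one_mul]; rfl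
  | cell κ e => exact hname ..
  | next e =>
    refine (hname ..).congr fun c => ?_
    rw [holeEnc, cellIndex, Nat.mul_succ, Nat.add_assoc]

theorem writes_writeTerm (t : Term Hole) : Writes (.writeTerm t) fun c => t.enc (holeEnc c) := by
  induction t with
  | var h => exact (writes_write [.var]).seq (writes_writeHole h)
  | const z => exact writes_write _
  | add s t hs ht | sub s t hs ht | mul s t hs ht => exact (writes_write _).seq (hs.seq ht)

theorem writes_writeQF (q : QF Hole) : Writes (.writeQF q) fun c => q.enc (holeEnc c) := by
  induction q with
  | lt s t | le s t | eq s t | ge s t | gt s t =>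
    exact (writes_write _).seq ((writes_writeTerm s).seq (writes_writeTerm t))
  | and p q hp hq | or p q hp hq => exact (writes_write _).seq (hp.seq hq)
  | not p hp => exact (writes_write _).seq hp

theorem writes_writeItem (q : QF Hole) : Writes (.writeItem q) fun c => Template.item c q :=
  (writes_write [.and]).seq (writes_writeQF q)

section Items

variable {n k N j : ℕ}

theorem encName_var_cell {y : Fin n ⊕ Cell N} {c : Counter → ℕ} {κ : Counter} (h : c κ ≤ N)
    (e : Entry) : encName (Hole.var y c (.cell κ e)) = holeEnc c (.cell κ e) :=
  congrArg (Sym.right :: encUnary ·) (val_cellVar h e)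

theorem item_map {y : Fin n ⊕ Cell N} {c : Counter → ℕ} {q : QF Hole}
    (h : q.All fun a => encName (Hole.var y c a) = holeEnc c a) :
    (q.map (Hole.var y c)).item = Template.item c q := by
  rw [QF.item, QF.enc_map]
  exact congrArg (Sym.and :: ·) (QF.enc_congr q h)

theorem Gate.template_all {V : Type} {P : Hole → Prop} (h : ∀ e, P (.cell .cur e)) (g : Gate V) :
    g.template.All P := by
  cases g <;> simp [template, Template.outputIs, Template.selects, Template.twice, QF.All, Term.All,
    QF.verum, h]

theorem item_template {V : Type} (hj : j ≤ N) (g : Gate V) :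
    (inst n N j 0 g.template).item = Template.item (counters j 0) g.template :=
  item_map (g.template_all fun e => encName_var_cell hj e)

theorem item_sumIs (hj : j ≤ N) (z : ℤ) : (inst n N j 0 (Template.sumIs z)).item =
    Template.item (counters j 0) (Template.sumIs z) :=
  item_map ⟨encName_var_cell hj _, trivial⟩

theorem item_inputFormula (hn : n ≤ N) (i : Fin n) :
    (inputFormula N i).item = Template.item (counters i 0) Template.input := by
  have hcell (e : Entry) : encName (Hole.var (Sum.inl i : Fin n ⊕ Cell N) (counters i 0)
      (.cell .cur e)) = holeEnc (counters i 0) (.cell .cur e) :=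
    encName_var_cell (i.2.le.trans hn) e
  have hnext (e : Entry) : encName (Hole.var (Sum.inl i : Fin n ⊕ Cell N) (counters i 0)
      (.next e)) = holeEnc (counters i 0) (.next e) :=
    congrArg (Sym.right :: encUnary ·) (val_cellVar (Nat.succ_le_of_lt (i.2.trans_le hn)) e)
  have hfree : encName (Hole.var (Sum.inl i : Fin n ⊕ Cell N) (counters i 0) .free) =
      holeEnc (counters i 0) .free := rfl
  exact item_map (by simp [Template.input, QF.All, Term.All, hcell, hnext, hfree])

theorem nodeRow_lt (a : Fin n ⊕ Fin k) : nodeRow a < n + k := by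
  rcases a with i | j
  · exact i.2.trans_le (Nat.le_add_right n k)
  · exact j.2.trans_le (Nat.le_add_left k n)

theorem item_operandFormula (hj : j ≤ n + k) (e : Bool → Entry) (a : Fin n ⊕ Fin k) :
    (operandFormula (n + k) j e a).item =
      Template.item (counters j (nodeRow a)) (Template.operand e (nodeEntry a)) :=
  item_map ⟨⟨encName_var_cell hj _, encName_var_cell (nodeRow_lt a).le _⟩,
    encName_var_cell hj _, encName_var_cell (nodeRow_lt a).le _⟩

theorem item_outputFormula (j : ℕ) (a : Fin n ⊕ Fin k) :
    (outputFormula (n + k) a).item =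
      Template.item (counters j (nodeRow a)) (Template.output (nodeEntry a)) :=
  item_map (c := counters 0 (nodeRow a))
    ⟨encName_var_cell (nodeRow_lt a).le _, encName_var_cell (nodeRow_lt a).le _⟩

theorem item_scalarFormula (hj : j ≤ N) (ζ : ℚ) : (scalarFormula n N j ζ).item =
    [.and, .eq, .const] ++ (encInt ζ.num ++ ([.mul] ++
      ((Template.own .coef).enc (holeEnc (counters j 0)) ++
        ([.const, .plusSign] ++ encNat ζ.den)))) := by
  have hden : encInt (ζ.den : ℤ) = Sym.plusSign :: encNat ζ.den := by
    rw [encInt, if_neg (by omega), Int.natAbs_natCast]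
  have hcoef : encName (Sum.inr (cellVar N j .coef) : Fin n ⊕ Cell N) =
      holeEnc (counters j 0) (.cell .cur .coef) :=
    congrArg (Sym.right :: encUnary ·) (val_cellVar hj _)
  simp [QF.item, scalarFormula, QF.enc, Term.enc, hden, hcoef]

theorem flatMap_item_inputFormula (hn : n ≤ N) :
    (List.ofFn (inputFormula (n := n) N)).reverse.flatMap QF.item =
      (List.range n).reverse.flatMap fun j => Template.item (counters j 0) Template.input := by
  rw [← List.map_coe_finRange_eq_range, List.ofFn_eq_map, ← List.map_reverse, ← List.map_reverse,
    List.flatMap_map, List.flatMap_map]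
  exact congrArg List.flatten (List.map_congr_left fun i _ => item_inputFormula hn i)

end Items

/-! ### The reduction as a program -/

theorem Gate.exists_template_le (C : QF Hole → ℕ) :
    ∃ D, ∀ {V : Type} (g : Gate V), C g.template ≤ D := by
  let gates : List (Gate Unit) := [.const 0, .add () (), .sub () (), .smul 0 (), .mul () (),
    .max () (), .min () (), .pos ()]
  refine ⟨(gates.map fun g => C g.template).sum, fun g => List.le_sum_of_mem ?_⟩
  cases g <;> simp [gates, template]

theorem Gate.writes_template : ∃ C, ∀ {V : Type} (g : Gate V) (B : ℕ) (c : Counter → ℕ),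
    (∀ κ, c κ ≤ B) →
    Transduces (.writeItem g.template) [] (Template.item c g.template) c c (C * (B + 1)) := by
  choose C hC using writes_writeItem
  obtain ⟨D, hD⟩ := Gate.exists_template_le C
  exact ⟨D, fun g B c hc => (hC _ B c hc).mono (Nat.mul_le_mul_right _ (hD g))⟩

theorem counters_le {j r B : ℕ} (hj : j ≤ B) (hr : r ≤ B) (κ : Counter) : counters j r κ ≤ B := by
  cases κ <;> assumption

namespace Prog

/-- Run `p` unless the option is `none`. -/
def optional {β : Type} (o : Option β) (p : Prog Reg Sym) : Prog Reg Sym := o.elim skip fun _ => p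

/-- Read the rest of the name of a node after its first symbol and run `p` for the entries with the
values of the node. -/
def branch (p : (Bool → Entry) → Prog Reg Sym) : Sym → Prog Reg Sym
  | .left => p .input
  | .right => p .out
  | _ => skip

/-- Read the row of a node and write the template `q`. -/
def nodeItem (q : QF Hole) : Prog Reg Sym :=
  seq (readUnary .arg) (seq (writeItem q) (clear .arg))

/-- Read an operand and write the constraint for the entries `e`. -/
def operand (e : Bool → Entry) : Prog Reg Sym :=
  read (branch fun e' => nodeItem (Template.operand e e'))

/-- Read the constant of a gate and write its constraint. -/
def scalar : Prog Reg Sym :=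
  seq (write [.and, .eq, .const]) (seq copyToSep (seq (write [.mul])
    (seq (writeTerm (Template.own .coef)) (seq (write [.const, .plusSign]) copyToSep))))

/-- Read a gate of the same kind as `g` after its first symbol, and write its constraints. -/
def gate {V : Type} (g : Gate V) : Prog Reg Sym :=
  seq (optional g.scalar scalar) (seq (optional g.leftOperand (operand .left))
    (seq (optional g.rightOperand (operand .right))
      (seq (writeItem g.template) (push (.ctr .cur) .one))))

/-- Read a gate or an output after its first symbol, and write its constraints. -/
def gateOrOutput : Sym → Prog Reg Sym
  | .const => gate (.const 0 : Gate Unit)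
  | .add => gate (.add () ())
  | .sub => gate (.sub () ())
  | .smul => gate (.smul 0 ())
  | .mul => gate (.mul () ())
  | .max => gate (.max () ())
  | .min => gate (.min () ())
  | x => branch (fun e => nodeItem (Template.output e)) x

end Prog

theorem Gate.exists_enc_eq_cons {V : Type} (e : V → List Sym) {g : Gate V} (hg : g.IsArithmetic) :
    ∃ x, Prog.gateOrOutput x = Prog.gate g ∧ g.enc e = x :: (g.scalar.toList.flatMap encRat ++
      (g.leftOperand.toList.flatMap e ++ g.rightOperand.toList.flatMap e)) := by
  cases g with
  | pos a => exact hg.elim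
  | const ζ => exact ⟨.const, rfl, by simp [enc, scalar, leftOperand, rightOperand]⟩
  | add a b => exact ⟨.add, rfl, by simp [enc, scalar, leftOperand, rightOperand]⟩
  | sub a b => exact ⟨.sub, rfl, by simp [enc, scalar, leftOperand, rightOperand]⟩
  | smul ζ a => exact ⟨.smul, rfl, by simp [enc, scalar, leftOperand, rightOperand]⟩
  | mul a b => exact ⟨.mul, rfl, by simp [enc, scalar, leftOperand, rightOperand]⟩
  | max a b => exact ⟨.max, rfl, by simp [enc, scalar, leftOperand, rightOperand]⟩
  | min a b => exact ⟨.min, rfl, by simp [enc, scalar, leftOperand, rightOperand]⟩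

theorem Transduces.optional {β : Type} {p : Prog Reg Sym} {u w : β → List Sym} {c : Counter → ℕ}
    {T : ℕ} (o : Option β) (h : ∀ b ∈ o, Transduces p (u b) (w b) c c T) :
    Transduces (.optional o p) (o.toList.flatMap u) (o.toList.flatMap w) c c T := by
  cases o with
  | none => exact Transduces.skip.mono T.zero_le
  | some b => simpa [Prog.optional] using h b rfl

/-- The first symbol of the name of a node. -/
def nodeSym {n k : ℕ} : Fin n ⊕ Fin k → Sym
  | Sum.inl _ => .left
  | Sum.inr _ => .right

theorem encName_eq {n k : ℕ} (a : Fin n ⊕ Fin k) :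
    encName a = nodeSym a :: encUnary (nodeRow a) := by
  cases a <;> rfl

theorem Prog.branch_nodeSym {n k : ℕ} (p : (Bool → Entry) → Prog Reg Sym) (a : Fin n ⊕ Fin k) :
    Prog.branch p (nodeSym a) = p (nodeEntry a) := by
  cases a <;> rfl

theorem Prog.gateOrOutput_nodeSym {n k : ℕ} (a : Fin n ⊕ Fin k) :
    Prog.gateOrOutput (nodeSym a) = Prog.nodeItem (Template.output (nodeEntry a)) := by
  cases a <;> rfl

theorem transduces_nodeItem (q : QF Hole) : ∃ C, ∀ B j r, j ≤ B → r ≤ B →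
    Transduces (.nodeItem q) (encUnary r) (Template.item (counters j r) q) (counters j 0)
      (counters j 0) (C * (B + 1)) := by
  obtain ⟨C, hC⟩ := writes_writeItem q
  refine ⟨C + 4, fun B j r hj hr => ?_⟩
  have hread := Transduces.readUnary (c := counters j 0) .arg r
  have hclear := Transduces.clear (c := counters j r) .arg
  rw [update_counters_arg, show counters j 0 .arg + r = r from Nat.zero_add r] at hread
  rw [update_counters_arg] at hclear
  have hitem := hread.seq ((hC B (counters j r) (counters_le hj hr)).seq hclear)
  simp only [List.append_nil, List.nil_append] at hitem
  refine hitem.mono ?_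
  rw [show counters j r .arg = r from rfl]
  nlinarith

theorem transduces_nodeItem_nodeRow (q : (Bool → Entry) → QF Hole) :
    ∃ C, ∀ {n k : ℕ} (B j : ℕ) (a : Fin n ⊕ Fin k), n + k ≤ B → j ≤ B →
      Transduces (.nodeItem (q (nodeEntry a))) (encUnary (nodeRow a))
        (Template.item (counters j (nodeRow a)) (q (nodeEntry a))) (counters j 0) (counters j 0)
        (C * (B + 1)) := by
  obtain ⟨C, hC⟩ := transduces_nodeItem (q .input)
  obtain ⟨D, hD⟩ := transduces_nodeItem (q .out)
  refine ⟨C + D, fun B j a hB hj => ?_⟩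
  have hrow := (nodeRow_lt a).le.trans hB
  cases a with
  | inl i => exact (hC B j i hj hrow).mono (Nat.mul_le_mul_right _ (Nat.le_add_right C D))
  | inr i => exact (hD B j i hj hrow).mono (Nat.mul_le_mul_right _ (Nat.le_add_left D C))

theorem transduces_operand (e : Bool → Entry) :
    ∃ C, ∀ {n k : ℕ} (B j : ℕ) (a : Fin n ⊕ Fin k), n + k ≤ B → j ≤ n + k →
      Transduces (.operand e) (encName a) (operandFormula (n + k) j e a).item (counters j 0)
        (counters j 0) (C * (B + 1)) := by
  obtain ⟨C, hC⟩ := transduces_nodeItem_nodeRow (Template.operand e)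
  refine ⟨C + 1, fun B j a hB hj => ?_⟩
  have h := hC B j a hB (hj.trans hB)
  rw [← Prog.branch_nodeSym fun e' => .nodeItem (Template.operand e e')] at h
  rw [encName_eq, item_operandFormula hj]
  exact h.read.mono (by nlinarith)

theorem transduces_scalar : ∃ C, ∀ {n N : ℕ} (B j : ℕ) (ζ : ℚ), N ≤ B → j ≤ N →
    (encRat ζ).length ≤ B →
    Transduces .scalar (encRat ζ) (scalarFormula n N j ζ).item (counters j 0) (counters j 0)
      (C * (B + 1)) := by
  obtain ⟨C, hC⟩ := writes_writeTerm (Template.own .coef)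
  refine ⟨C + 10, fun B j ζ hN hj hζ => ?_⟩
  have h := (Transduces.write (c := counters j 0) [.and, .eq, .const]).seq
    ((Transduces.copyToSep_encInt ζ.num).seq ((Transduces.write [.mul]).seq
      ((hC B _ (counters_le (hj.trans hN) B.zero_le)).seq
        ((Transduces.write [.const, .plusSign]).seq
          (Transduces.copyToSep_encBits (Computability.encodeNat ζ.den))))))
  rw [item_scalarFormula hj]
  refine h.mono ?_
  rw [encRat, List.length_append, encNat] at hζ
  simp only [List.length_cons, List.length_nil]
  nlinarith

theorem transduces_gate : ∃ C, ∀ {n k : ℕ} (B j : ℕ) (g : Gate (Fin n ⊕ Fin k)), n + k ≤ B →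
    j ≤ n + k → (∀ ζ ∈ g.scalar, (encRat ζ).length ≤ B) →
    Transduces (.gate g) (g.scalar.toList.flatMap encRat ++ (g.leftOperand.toList.flatMap encName ++
      g.rightOperand.toList.flatMap encName)) ((gateFormulas (n + k) j g).flatMap QF.item)
      (counters j 0) (counters (j + 1) 0) (C * (B + 1)) := by
  obtain ⟨C₁, hscalar⟩ := transduces_scalar
  obtain ⟨C₂, hleft⟩ := transduces_operand .left
  obtain ⟨C₃, hright⟩ := transduces_operand .right
  obtain ⟨C₄, htemplate⟩ := Gate.writes_template
  refine ⟨C₁ + C₂ + C₃ + C₄ + 1, fun {n k} B j g hB hj hζ => ?_⟩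
  have hnext := Transduces.push_ctr (c := counters j 0) .cur
  rw [update_counters_cur] at hnext
  have h := (Transduces.optional g.scalar fun ζ h => hscalar (n := n) B j ζ hB hj (hζ ζ h)).seq
    ((Transduces.optional g.leftOperand fun a _ => hleft B j a hB hj).seq
      ((Transduces.optional g.rightOperand fun a _ => hright B j a hB hj).seq
        ((htemplate g B _ (counters_le (hj.trans hB) B.zero_le)).seq hnext)))
  rw [← item_template (n := n) hj] at h
  simp only [gateFormulas, List.flatMap_append, List.flatMap_map, List.flatMap_singleton,
    List.append_nil] at h ⊢
  exact h.mono (by nlinarith)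

theorem passes_gate : ∃ C, ∀ {n k : ℕ} (B j : ℕ) (g : Gate (Fin n ⊕ Fin k)), n + k ≤ B →
    j ≤ n + k → g.IsArithmetic → (g.enc encName).length ≤ B →
    Passes .gateOrOutput (g.enc encName) ((gateFormulas (n + k) j g).flatMap QF.item)
      (counters j 0) (counters (j + 1) 0) (C * (B + 1)) := by
  obtain ⟨C, hC⟩ := transduces_gate
  refine ⟨C + 1, fun B j g hB hj hg hlen => ?_⟩
  obtain ⟨x, hx, henc⟩ := g.exists_enc_eq_cons encName hg
  rw [henc] at hlen ⊢
  have hζ : ∀ ζ ∈ g.scalar, (encRat ζ).length ≤ B := by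
    intro ζ hζ
    rw [Option.mem_def.1 hζ] at hlen
    simp only [Option.toList_some, List.flatMap_singleton, List.length_cons,
      List.length_append] at hlen
    omega
  have h := hC B j g hB hj hζ
  rw [← hx] at h
  exact (Passes.of_transduces h).mono (by nlinarith)

theorem passes_gates : ∃ C, ∀ {n k : ℕ} (B j : ℕ) (l : List (Gate (Fin n ⊕ Fin k))), n + k ≤ B →
    j + l.length ≤ n + k → (∀ g ∈ l, g.IsArithmetic ∧ (g.enc encName).length ≤ B) →
    Passes .gateOrOutput (l.flatMap (Gate.enc encName))
      (((l.zipIdx j).flatMap fun p => gateFormulas (n + k) p.2 p.1).flatMap QF.item)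
      (counters j 0) (counters (j + l.length) 0) (l.length * (C * (B + 1))) := by
  obtain ⟨C, hC⟩ := passes_gate
  refine ⟨C, fun {n k} B j l hB hj hl => ?_⟩
  induction l generalizing j with
  | nil => exact Passes.nil.mono (Nat.zero_le _)
  | cons g l ih =>
    obtain ⟨⟨hg, hlen⟩, hl⟩ := List.forall_mem_cons.1 hl
    rw [List.length_cons] at hj
    have h := (hC B j g hB (by omega) hg hlen).append (ih (j + 1) (by omega) hl)
    rw [List.zipIdx_cons, List.flatMap_cons, List.flatMap_cons, List.flatMap_append,
      List.length_cons, ← Nat.add_assoc, Nat.add_right_comm j]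
    exact h.mono (le_of_eq (by ring))

theorem passes_outputs : ∃ C, ∀ {n k : ℕ} (B j : ℕ) (l : List (Fin n ⊕ Fin k)), n + k ≤ B →
    j ≤ B → Passes .gateOrOutput (l.flatMap encName)
      ((l.map (outputFormula (n + k))).flatMap QF.item) (counters j 0) (counters j 0)
      (l.length * (C * (B + 1))) := by
  obtain ⟨C, hC⟩ := transduces_nodeItem_nodeRow Template.output
  refine ⟨C + 1, fun B j l hB hj => ?_⟩
  induction l with
  | nil => exact Passes.nil.mono (Nat.zero_le _)
  | cons a l ih =>
    have h := hC B j a hB hj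
    rw [← item_outputFormula j a, ← Prog.gateOrOutput_nodeSym] at h
    rw [List.map_cons, List.flatMap_cons, List.flatMap_cons, List.length_cons, encName_eq]
    exact ((Passes.of_transduces h).append ih).mono (by nlinarith)

theorem Transduces.forEach_cur {p : Prog Reg Sym} {w : ℕ → List Sym} {n T : ℕ}
    (h : ∀ j < n, Transduces p [] (w j) (counters j 0) (counters j 0) T) :
    Transduces (.forEach (.ctr .cur) fun _ => p) [] ((List.range n).reverse.flatMap w)
      (counters n 0) (counters 0 0) (n * (T + 1) + 1) := by
  induction n with
  | zero => exact fun i a o => (Runs.forEach_nil rfl).mono (by simp)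
  | succ n ih =>
    intro i a o
    have hpop : stk i a o [] (counters (n + 1) 0) (.ctr .cur) = .one :: ones n := rfl
    rw [List.range_succ, List.reverse_append, List.reverse_singleton, List.singleton_append,
      List.flatMap_cons, List.reverse_append, List.append_assoc]
    refine (Runs.forEach_cons (T := T) hpop ?_
      (ih (fun j hj => h j (hj.trans n.lt_succ_self)) i _ o)).mono (by rw [Nat.succ_mul]; omega)
    rw [update_stk_ctr, update_counters_cur]
    exact h n n.lt_succ_self i a o

namespace Prog

/-- Read the numbers of inputs, gates and outputs, and write the numbers of free and of bound
variables. -/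
def sizes : Prog Reg Sym :=
  seq (seq (readUnary .cur) (seq (readUnary .arg) skipUnary)) <|
    seq (seq (writeOnes .cur 1) (write (encUnary 0))) <|
      seq (seq (writeOnes .cur rowWidth) (seq (writeOnes .arg rowWidth)
        (write (encUnary rowWidth)))) (clear .arg)

/-- Write the constraints for the input nodes, from the last one to the first. -/
def inputs : Prog Reg Sym :=
  seq (writeItem (Template.sumIs 1)) <|
    seq (forEach (.ctr .cur) fun _ => writeItem Template.input) (writeItem (Template.sumIs 0))

/-- Read a circuit and write its antipodal formula, in reverse order, to the accumulator. -/
def formula : Prog Reg Sym :=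
  seq sizes (seq inputs (seq (forEach .inp gateOrOutput) (seq (writeQF .verum) (clear .cur))))

/-- Read a circuit and write its antipodal formula. -/
def antipodal : Prog Reg Sym := seq formula (forEach .acc (push .out))

end Prog

theorem transduces_sizes (n k m : ℕ) :
    Transduces .sizes (encUnary n ++ (encUnary k ++ encUnary m))
      (encUnary n ++ encUnary (rowWidth * (n + k + 1))) (counters 0 0) (counters n 0)
      (60 * (n + k + m + 1)) := by
  have hn := Transduces.readUnary (c := counters 0 0) .cur n
  have hk := Transduces.readUnary (c := counters n 0) .arg k
  have hclear := Transduces.clear (c := counters n k) .arg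
  rw [update_counters_cur, show counters 0 0 .cur + n = n from Nat.zero_add n] at hn
  rw [update_counters_arg, show counters n 0 .arg + k = k from Nat.zero_add k] at hk
  rw [update_counters_arg] at hclear
  have h := (hn.seq (hk.seq (Transduces.skipUnary m))).seq <|
    ((Transduces.writeOnes .cur 1).seq (Transduces.write (encUnary 0))).seq <|
    ((Transduces.writeOnes .cur rowWidth).seq ((Transduces.writeOnes .arg rowWidth).seq
      (Transduces.write (encUnary rowWidth)))).seq hclear
  simp only [counters, ← encUnary_add, List.append_nil, List.nil_append, one_mul, add_zero] at h
  rw [mul_add_one, mul_add, add_assoc]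
  refine h.mono ?_
  simp only [length_encUnary, rowWidth]
  omega

theorem mul_succ_le_mul_succ_sq (C n : ℕ) : C * (n + 1) ≤ C * (n + 1) ^ 2 :=
  Nat.mul_le_mul_left C (Nat.le_self_pow two_ne_zero _)

theorem transduces_inputs : ∃ C, ∀ {n N : ℕ}, n ≤ N →
    Transduces .inputs [] ((inputFormulas n N).flatMap QF.item) (counters n 0) (counters 0 0)
      (C * (n + 1) ^ 2) := by
  obtain ⟨C₁, hone⟩ := writes_writeItem (Template.sumIs 1)
  obtain ⟨C₂, hinput⟩ := writes_writeItem Template.input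
  obtain ⟨C₃, hzero⟩ := writes_writeItem (Template.sumIs 0)
  refine ⟨C₁ + C₂ + C₃ + 1, fun {n N} hn => ?_⟩
  have hloop := Transduces.forEach_cur fun j (hj : j < n) =>
    hinput n (counters j 0) (counters_le hj.le n.zero_le)
  have h := (hone n _ (counters_le le_rfl n.zero_le)).seq
    (hloop.seq (hzero n (counters 0 0) (counters_le n.zero_le n.zero_le)))
  beta_reduce at h
  rw [← item_sumIs (n := n) hn, ← item_sumIs (n := n) N.zero_le,
    ← flatMap_item_inputFormula hn] at h
  rw [inputFormulas, List.flatMap_cons, List.flatMap_append, List.flatMap_singleton]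
  refine h.mono ?_
  nlinarith [mul_succ_le_mul_succ_sq C₁ n, mul_succ_le_mul_succ_sq C₃ n, Nat.zero_le (C₂ * (n + 1))]

theorem passes_constraints : ∃ C, ∀ {n m : ℕ} (c : Circuit n m) (B : ℕ), c.IsArithmetic →
    n + c.size ≤ B → m ≤ B → (∀ j, ((c.gate j).enc encName).length ≤ B) →
    Passes .gateOrOutput
      ((List.ofFn c.gate).flatMap (Gate.enc encName) ++ (List.ofFn c.out).flatMap encName)
      (((List.ofFn c.gate).zipIdx.flatMap fun p => gateFormulas (n + c.size) p.2 p.1).flatMap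
          QF.item ++ ((List.ofFn c.out).map (outputFormula (n + c.size))).flatMap QF.item)
      (counters 0 0) (counters c.size 0) (C * (B + 1) ^ 2) := by
  obtain ⟨C₁, hgates⟩ := passes_gates
  obtain ⟨C₂, houtputs⟩ := passes_outputs
  refine ⟨C₁ + C₂, fun {n m} c B hc hB hm hlen => ?_⟩
  have hg := hgates B 0 (List.ofFn c.gate) hB (by simp) fun g hg => by
    obtain ⟨j, rfl⟩ := List.mem_ofFn.1 hg
    exact ⟨hc j, hlen j⟩
  have ho := houtputs B c.size (List.ofFn c.out) hB ((Nat.le_add_left _ _).trans hB)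
  rw [List.length_ofFn, Nat.zero_add] at hg
  rw [List.length_ofFn] at ho
  refine (hg.append ho).mono ?_
  calc c.size * (C₁ * (B + 1)) + m * (C₂ * (B + 1))
      ≤ (B + 1) * (C₁ * (B + 1)) + (B + 1) * (C₂ * (B + 1)) := by gcongr <;> omega
    _ = (C₁ + C₂) * (B + 1) ^ 2 := by ring

theorem Circuit.enc_eq {n m : ℕ} (c : Circuit n m) : Circuit.enc ⟨n, m, c⟩ =
    (encUnary n ++ (encUnary c.size ++ encUnary m)) ++
      ((List.ofFn c.gate).flatMap (Gate.enc encName) ++ (List.ofFn c.out).flatMap encName) := by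
  simp only [enc, encTuple, List.flatMap, List.map_ofFn, List.append_assoc]
  rfl

theorem Circuit.enc_antipodalFormula {n m : ℕ} (c : Circuit n m) :
    ExFormula.enc ⟨n, c.antipodalFormula⟩ =
      (encUnary n ++ encUnary (rowWidth * (n + c.size + 1))) ++
        (c.antipodalConstraints.flatMap QF.item ++
          (QF.verum : QF (Fin n ⊕ Cell (n + c.size))).enc encName) := by
  rw [ExFormula.enc, List.append_assoc]
  exact congrArg (fun l => encUnary n ++ (encUnary _ ++ l)) (QF.enc_conj _ _)

theorem runs_formula : ∃ C, ∀ {n m : ℕ} (c : Circuit n m), c.IsArithmetic →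
    Runs .formula (stk (Circuit.enc ⟨n, m, c⟩) [] [] [] (counters 0 0))
      (stk [] (ExFormula.enc ⟨n, c.antipodalFormula⟩).reverse [] [] (counters 0 0))
      (C * ((Circuit.enc ⟨n, m, c⟩).length + 1) ^ 2) := by
  obtain ⟨C₁, hinputs⟩ := transduces_inputs
  obtain ⟨C₂, hconstraints⟩ := passes_constraints
  obtain ⟨C₃, hverum⟩ := writes_writeQF .verum
  refine ⟨C₁ + C₂ + C₃ + 100, fun {n m} c hc => ?_⟩
  set B := (Circuit.enc ⟨n, m, c⟩).length with hB
  simp only [c.enc_eq, List.length_append, length_encUnary] at hB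
  have hgate (j : Fin c.size) : ((c.gate j).enc encName).length ≤ B := by
    have hmem : c.gate j ∈ List.ofFn c.gate := List.mem_ofFn.2 ⟨j, rfl⟩
    have := (List.sublist_flatten_of_mem
      (List.mem_map_of_mem (f := Gate.enc encName) hmem)).length_le
    rw [← List.flatMap_def] at this
    omega
  have hclear := Transduces.clear (c := counters c.size 0) .cur
  rw [update_counters_cur] at hclear
  have h := (transduces_sizes n c.size m _ [] []).seq <|
    (hinputs (Nat.le_add_right n c.size) _ _ []).seq <|
    ((hconstraints c B hc (by omega) (by omega) hgate).runs _ []).seq <|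
    ((hverum B _ (counters_le (by omega) B.zero_le)).seq hclear) [] _ _
  rw [c.enc_eq, c.enc_antipodalFormula, Circuit.antipodalConstraints]
  simp only [List.flatMap_append, List.reverse_append, List.append_assoc, List.append_nil,
    List.nil_append] at h ⊢
  refine h.mono ?_
  have hn : (n + 1) ^ 2 ≤ (B + 1) ^ 2 := Nat.pow_le_pow_left (by omega) 2
  rw [show counters c.size 0 .cur = c.size from rfl]
  nlinarith [Nat.mul_le_mul_left C₁ hn, mul_succ_le_mul_succ_sq C₃ B, mul_succ_le_mul_succ_sq 100 B]

theorem runs_antipodal : ∃ C, ∀ {n m : ℕ} (c : Circuit n m), c.IsArithmetic →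
    Runs .antipodal (stk (Circuit.enc ⟨n, m, c⟩) [] [] [] (counters 0 0))
      (stk [] [] (ExFormula.enc ⟨n, c.antipodalFormula⟩) [] (counters 0 0))
      (C * ((Circuit.enc ⟨n, m, c⟩).length + 1) ^ 2) := by
  obtain ⟨C, hformula⟩ := runs_formula
  refine ⟨3 * C + 1, fun {n m} c hc => ?_⟩
  obtain ⟨N, hN, hrun⟩ := hformula c hc
  have hacc := hrun.length_le .acc
  have hmove := runs_move_acc [] (ExFormula.enc ⟨n, c.antipodalFormula⟩).reverse [] []
    (counters 0 0)
  rw [List.reverse_reverse, List.append_nil] at hmove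
  refine (Runs.seq ⟨N, le_rfl, hrun⟩ hmove).mono ?_
  change (ExFormula.enc ⟨n, c.antipodalFormula⟩).reverse.length ≤ 0 + N at hacc
  have hpos : 1 ≤ ((Circuit.enc ⟨n, m, c⟩).length + 1) ^ 2 := Nat.one_le_pow _ _ (Nat.succ_pos _)
  nlinarith

theorem polyTime_antipodalFormula {α : Type} {n m : α → ℕ} (c : (a : α) → Circuit (n a) (m a))
    (hc : ∀ a, (c a).IsArithmetic) : PolyTime (fun a => Circuit.enc ⟨n a, m a, c a⟩) ExFormula.enc
      fun a => ⟨n a, (c a).antipodalFormula⟩ := by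
  obtain ⟨C, h⟩ := runs_antipodal
  refine PolyTime.of_run Prog.antipodal .inp .out (Polynomial.C C * (Polynomial.X + 1) ^ 2)
    fun a => ?_
  obtain ⟨N, hN, hrun⟩ := h (c a) (hc a)
  have hempty : (fun _ => []) = stk [] [] [] [] (counters 0 0) := by
    funext k
    rcases k with _ | _ | _ | _ | (_ | _) <;> rfl
  refine ⟨N, by simpa using hN, ?_⟩
  rw [hempty, update_stk_inp, update_stk_out]
  exact hrun

theorem borsukUlam_solvable (I : borsukUlam.Inst) : borsukUlam.Solvable I :=
  exists_antipodal_eq_of_continuous (Circuit.continuous_eval I.2.2)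

theorem IsReduction.mem_TFETR {P Q : SearchProblem} [Inhabited Q.Alphabet] {f : P.Inst → Q.Inst}
    {g : (I : P.Inst) → Circuit (Q.dim (f I)) (P.dim I)} (h : IsReduction P Q f g)
    {Φ : (I : Q.Inst) → ExFormula (Q.dim I)}
    (hΦ : PolyTime Q.enc ExFormula.enc fun I => ⟨Q.dim I, Φ I⟩)
    (hSol : ∀ I x, (Φ I).Holds x ↔ x ∈ Q.Sol I) (hQ : ∀ I, Q.Solvable I) : P ∈ TFETR := by
  obtain ⟨hf, hg, hfg⟩ := h
  have hP (I) : P.Solvable I := (hQ (f I)).imp' _ (hfg I)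
  have hTrue (I) : (Φ (f I)).IsTrue := (hQ (f I)).imp fun x => (hSol (f I) x).2
  exact ⟨⟨fun I => ⟨Q.dim (f I), Φ (f I)⟩, g,
    ⟨PolyTime.comp hΦ hf, hg, fun I y hy => hfg I y ((hSol (f I) y).1 hy)⟩,
    fun I => iff_of_true (hP I) (hTrue I)⟩, hP⟩

end BorsukUlamETR

theorem theorem3p4 :
    BorsukUlamETR.BU ⊆ BorsukUlamETR.TFETR ∧
    ∃ Φ : (I : BorsukUlamETR.borsukUlam.Inst) →
        BorsukUlamETR.ExFormula (BorsukUlamETR.borsukUlam.dim I),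
      BorsukUlamETR.PolyTime BorsukUlamETR.borsukUlam.enc BorsukUlamETR.ExFormula.enc
        (fun I => ⟨BorsukUlamETR.borsukUlam.dim I, Φ I⟩) ∧
      ∀ I, (∀ x, (Φ I).Holds x ↔ x ∈ BorsukUlamETR.borsukUlam.Sol I) ∧ (Φ I).IsTrue := by
  let Φ : (I : BorsukUlamETR.borsukUlam.Inst) →
      BorsukUlamETR.ExFormula (BorsukUlamETR.borsukUlam.dim I) := fun I => I.2.1.antipodalFormula
  have hΦ : BorsukUlamETR.PolyTime BorsukUlamETR.borsukUlam.enc BorsukUlamETR.ExFormula.enc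
      fun I => ⟨BorsukUlamETR.borsukUlam.dim I, Φ I⟩ :=
    BorsukUlamETR.polyTime_antipodalFormula
      (fun I : BorsukUlamETR.borsukUlam.Inst => I.2.1) fun I => I.2.2
  have hSol : ∀ I x, (Φ I).Holds x ↔ x ∈ BorsukUlamETR.borsukUlam.Sol I :=
    fun I x => I.2.1.antipodalFormula_holds_iff I.2.2 x
  have : Inhabited BorsukUlamETR.borsukUlam.Alphabet := ⟨BorsukUlamETR.Sym.one⟩
  refine ⟨?_, Φ, hΦ, fun I => ⟨hSol I, ?_⟩⟩
  · rintro P ⟨f, g, hred⟩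
    exact hred.mem_TFETR hΦ hSol BorsukUlamETR.borsukUlam_solvable
  · exact (BorsukUlamETR.borsukUlam_solvable I).imp fun x => (hSol I x).2
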